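/- Let $\Sigma$ be a first-order many-sorted signature (sorts, function symbols $f:A_1\cdots A_n\to B$, relation symbols $R\rightarrowtail A_1\cdots A_n$, with finite, possibly empty, families of sorts), and let $\mathbb T$ be a geometric theory of signature $\Sigma$, given by axioms $\varphi_i(\vec x_i)\vdash\psi_i(\vec x_i)$, $i\in I$, between geometric formulas (built from atomic formulas with $\top$, finite $\wedge$, $\exists$, $\bot$ and arbitrary set-indexed disjunctions $\bigvee$). Let $\Sigma_r$ be the signature obtained from $\Sigma$ by replacing every function symbol $f:A_1\cdots A_n\to B$ by a relation symbol $R_f\rightarrowtail A_1\cdots A_n\,B$. The translation $\varphi\mapsto\varphi^r$ of geometric formulas of $\Sigma$ into geometric formulas of $\Sigma_r$ in the same variables replaces every atomic formula $g_1(\vec x)=g_2(\vec x)$ or $R(g_1(\vec x),\dots,g_m(\vec x))$ as follows: introduce a variable $z_g$ for every subterm $g$ occurring in the construction of the terms $g_j$, form the conjunction of the formulas $R_f(z_{h_1},\dots,z_{h_k},z_g)$ for $g=f(h_1,\dots,h_k)$, of the formulas $z_g=x_i$ for $g=x_i$, and of the formula $z_{g_1}=z_{g_2}$, respectively $R(z_{g_1},\dots,z_{g_m})$,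 and quantify all the variables $z_g$ existentially; the translation commutes with $\top,\wedge,\exists,\bot,\bigvee$. Let $\mathbb T_r$ be the geometric theory of signature $\Sigma_r$ whose axioms are $$R_f(\vec x,y)\wedge R_f(\vec x,y')\vdash y=y',\qquad \top(\vec x)\vdash(\exists y)\,R_f(\vec x,y)$$ for every function symbol $f$ of $\Sigma$, and the translations $\varphi_i^r(\vec x_i)\vdash\psi_i^r(\vec x_i)$ of the axioms of $\mathbb T$. The syntactic category $\mathcal C_{\mathbb T}$ has as objects the geometric formulas $\varphi(\vec x)$ in a finite list of variables, up to renaming of the variables, and as morphisms $\varphi(\vec x)\to\psi(\vec y)$ the geometric formulas $\theta(\vec x,\vec y)$ such that the sequents $\theta(\vec x,\vec y)\vdash\varphi(\vec x)\wedge\psi(\vec y)$, $\varphi(\vec x)\vdash(\exists\vec y)\theta(\vec x,\vec y)$ and $\theta(\vec x,\vec y)\wedge\theta(\vec x,\vec y\,')\vdash\vec y=\vec y\,'$ are provable in $\mathbb T$ (by the inference rules of geometric logic), up to provable equivalence in $\mathbb T$; the composite of $\theta(\vec x,\vec y)$ and $\theta'(\vec y,\vec z)$ is $(\exists\vec y)(\theta(\vec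 x,\vec y)\wedge\theta'(\vec y,\vec z))$. Then: (i) The translation $\varphi\mapsto\varphi^r$, $\theta\mapsto\theta^r$ of formulas defines a functor $\mathcal C_{\mathbb T}\to\mathcal C_{\mathbb T_r}$, and this functor is an equivalence of categories. (ii) If $\mathbb T$ is coherent [resp. regular, resp. cartesian], then $\mathbb T_r$ is coherent [resp. regular, resp. cartesian], and the equivalence of (i) restricts to an equivalence $\mathcal C_{\mathbb T}^{\rm coh}\to\mathcal C_{\mathbb T_r}^{\rm coh}$ [resp. $\mathcal C_{\mathbb T}^{\rm reg}\to\mathcal C_{\mathbb T_r}^{\rm reg}$, resp. $\mathcal C_{\mathbb T}^{\rm car}\to\mathcal C_{\mathbb T_r}^{\rm car}$]. Here a formula is regular if it is built from atomic formulas with $\top,\wedge,\exists$ only, coherent if it is built with $\top,\wedge,\exists,\bot$ and finite disjunctions only, and Horn if it is built with $\top,\wedge$ only. A theory is coherent [resp. regular] if all formulas in its axioms are. The theory $\mathbb T$ is cartesian if it can be defined by axioms between formulas of the form $(\exists\vec y)\,\eta(\vec x,\vec y)$ with $\eta$ Horn and $\eta(\vec x,\vec y)\wedge\eta(\vec x,\vec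 y\,')\vdash\vec y=\vec y\,'$ provable in $\mathbb T$; the $\mathbb T$-cartesian formulas are the regular formulas which are provably equivalent in $\mathbb T$ to a formula of this form. The categories $\mathcal C_{\mathbb T}^{\rm coh}$, $\mathcal C_{\mathbb T}^{\rm reg}$, $\mathcal C_{\mathbb T}^{\rm car}$ are the subcategories of $\mathcal C_{\mathbb T}$ whose objects are the coherent, regular, $\mathbb T$-cartesian formulas, and whose morphisms are those represented by coherent, regular, $\mathbb T$-cartesian provably functional formulas. -/

import Mathlib

universe u w

namespace GeometricLogic

/-! ## Signatures, contexts, terms, geometric formulas -/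

/-- A first-order many-sorted signature: sorts, function symbols `f : A₁ ⋯ Aₙ → B`, and relation
symbols `R ↣ A₁ ⋯ Aₙ`, the lists of sorts being finite and possibly empty. -/
structure Signature where
  Srt : Type u
  Fn : Type u
  dom : Fn → List Srt
  cod : Fn → Srt
  Rel : Type u
  arity : Rel → List Srt

/-- `Var Γ A` is the type of the variables of sort `A` in the context `Γ`. A context is the list of
the sorts of its variables, so variables have no names and contexts and formulas are
automatically considered up to renaming of variables by variables of the same sorts. -/
inductive Var {K : Type u} : List K → K → Type u
  | zero {Γ : List K} {A : K} : Var (A :: Γ) A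
  | succ {Γ : List K} {A B : K} : Var Γ A → Var (B :: Γ) A

namespace Var

variable {K : Type u}

/-- The variables of `Γ` as variables of the disjoint union `Γ ++ Δ`. -/
def inl {Δ : List K} : {Γ : List K} → {A : K} → Var Γ A → Var (Γ ++ Δ) A
  | _, _, zero => zero
  | _, _, succ v => succ (inl v)

/-- The variables of `Δ` as variables of the disjoint union `Γ ++ Δ`. -/
def inr {Δ : List K} : {Γ : List K} → {A : K} → Var Δ A → Var (Γ ++ Δ) A
  | [], _, v => v
  | _ :: _, _, v => succ (inr v)

/-- Case distinction on the variables of a disjoint union of contexts. -/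
def elim {Δ : List K} {X : K → Type*} : {Γ : List K} → (∀ ⦃A⦄, Var Γ A → X A) →
    (∀ ⦃A⦄, Var Δ A → X A) → ∀ ⦃A⦄, Var (Γ ++ Δ) A → X A
  | [], _, g, _, v => g v
  | _ :: _, f, _, _, zero => f zero
  | _ :: _, f, g, _, succ v => elim (fun _ v => f (succ v)) g v

/-- The map out of a one-variable context. -/
def single {X : K → Type*} {B : K} (x : X B) : ∀ ⦃A⦄, Var [B] A → X A
  | _, zero => x

/-- The concatenation of a family of contexts indexed by the variables of a context. -/
def flat : (Δ : List K) → (∀ ⦃A⦄, Var Δ A → List K) → List K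
  | [], _ => []
  | _ :: Δ, N => N zero ++ flat Δ (fun _ v => N (succ v))

/-- The inclusion of the member with index `v` in the concatenation of a family of contexts. -/
def inFlat : {Δ : List K} → (N : ∀ ⦃A⦄, Var Δ A → List K) → {A : K} → (v : Var Δ A) →
    ∀ ⦃B⦄, Var (N v) B → Var (flat Δ N) B
  | _ :: _, _, _, zero, _, x => inl x
  | _ :: _, N, _, succ v, _, x => inr (inFlat (fun _ v => N (succ v)) v x)

end Var

/-- Terms with values in a given sort, in the variables of a context. -/
inductive Term (S : Signature.{u}) (Γ : List S.Srt) : S.Srt → Type u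
  | var {B : S.Srt} : Var Γ B → Term S Γ B
  | app (f : S.Fn) (a : ∀ ⦃A : S.Srt⦄, Var (S.dom f) A → Term S Γ A) : Term S Γ (S.cod f)

/-- Families of terms in `Δ` to be substituted for the variables of `Γ`. -/
abbrev Subst (S : Signature.{u}) (Γ Δ : List S.Srt) : Type u :=
  ∀ ⦃A : S.Srt⦄, Var Γ A → Term S Δ A

/-- Geometric formulas in a context. The existential quantifier is applied to one variable at
a time; disjunctions are indexed by arbitrary types of the universe `Type w`. -/
inductive Formula (S : Signature.{u}) : List S.Srt → Type (max u (w + 1))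
  | rel {Γ : List S.Srt} (R : S.Rel) (a : Subst S (S.arity R) Γ) : Formula S Γ
  | eq {Γ : List S.Srt} {A : S.Srt} (s t : Term S Γ A) : Formula S Γ
  | top {Γ : List S.Srt} : Formula S Γ
  | and {Γ : List S.Srt} (φ ψ : Formula S Γ) : Formula S Γ
  | ex {Γ : List S.Srt} (A : S.Srt) (φ : Formula S (A :: Γ)) : Formula S Γ
  | bot {Γ : List S.Srt} : Formula S Γ
  | disj {Γ : List S.Srt} (I : Type w) (φ : I → Formula S Γ) : Formula S Γ

variable {S : Signature.{u}}

namespace Term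

/-- Substitution in a term. -/
def subst {Γ Δ : List S.Srt} (σ : Subst S Γ Δ) : {B : S.Srt} → Term S Γ B → Term S Δ B
  | _, var v => σ v
  | _, app f a => app f (fun _ v => subst σ (a v))

end Term

/-- The extension of a substitution to a context with one more variable. -/
def Subst.lift {Γ Δ : List S.Srt} (A : S.Srt) (σ : Subst S Γ Δ) : Subst S (A :: Γ) (A :: Δ)
  | _, .zero => .var .zero
  | _, .succ v => (σ v).subst (fun _ x => .var (.succ x))

/-- The substitution of a term for the first variable of a context. -/
def Subst.inst {Γ : List S.Srt} {A : S.Srt} (t : Term S Γ A) : Subst S (A :: Γ) Γ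
  | _, .zero => t
  | _, .succ v => .var v

namespace Formula

/-- Substitution in a formula. -/
def subst : {Γ Δ : List S.Srt} → Subst S Γ Δ → Formula.{u, w} S Γ → Formula.{u, w} S Δ
  | _, _, σ, rel R a => rel R (fun _ v => (a v).subst σ)
  | _, _, σ, eq s t => eq (s.subst σ) (t.subst σ)
  | _, _, _, top => top
  | _, _, σ, and φ ψ => and (subst σ φ) (subst σ ψ)
  | _, _, σ, ex A φ => ex A (subst (σ.lift A) φ)
  | _, _, _, bot => bot
  | _, _, σ, disj I φ => disj I (fun i => subst σ (φ i))

/-- Replacement of variables by variables. -/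
def rename {Γ Δ : List S.Srt} (ρ : ∀ ⦃A⦄, Var Γ A → Var Δ A) (φ : Formula.{u, w} S Γ) :
    Formula.{u, w} S Δ :=
  φ.subst (fun _ v => .var (ρ v))

/-- `∃ y⃗, φ (y⃗, x⃗)` for a finite family of variables `y⃗` of sorts `Δ`. -/
def exs {Γ : List S.Srt} : (Δ : List S.Srt) → Formula.{u, w} S (Δ ++ Γ) → Formula.{u, w} S Γ
  | [], φ => φ
  | A :: Δ, φ => exs Δ (ex A φ)

/-- The conjunction of a family of formulas indexed by the variables of a context. -/
def conj {Γ : List S.Srt} :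
    (Δ : List S.Srt) → (∀ ⦃A⦄, Var Δ A → Formula.{u, w} S Γ) → Formula.{u, w} S Γ
  | [], _ => top
  | _ :: Δ, φ => and (φ .zero) (conj Δ (fun _ v => φ (.succ v)))

/-- The conjunction of the equations `a v = b v`. -/
def eqs {Γ Δ : List S.Srt} (a b : Subst S Δ Γ) : Formula.{u, w} S Γ :=
  conj Δ (fun _ v => eq (a v) (b v))

/-- Horn formulas: built from atomic formulas with `⊤` and `∧`. -/
def IsHorn : {Γ : List S.Srt} → Formula.{u, w} S Γ → Prop
  | _, rel _ _ => True
  | _, eq _ _ => True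
  | _, top => True
  | _, and φ ψ => IsHorn φ ∧ IsHorn ψ
  | _, ex _ _ => False
  | _, bot => False
  | _, disj _ _ => False

/-- Regular formulas: built from atomic formulas with `⊤`, `∧` and `∃`. -/
def IsRegular : {Γ : List S.Srt} → Formula.{u, w} S Γ → Prop
  | _, rel _ _ => True
  | _, eq _ _ => True
  | _, top => True
  | _, and φ ψ => IsRegular φ ∧ IsRegular ψ
  | _, ex _ φ => IsRegular φ
  | _, bot => False
  | _, disj _ _ => False

/-- Coherent formulas: built from atomic formulas with `⊤`, `∧`, `∃`, `⊥` and finite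
disjunctions. -/
def IsCoherent : {Γ : List S.Srt} → Formula.{u, w} S Γ → Prop
  | _, rel _ _ => True
  | _, eq _ _ => True
  | _, top => True
  | _, and φ ψ => IsCoherent φ ∧ IsCoherent ψ
  | _, ex _ φ => IsCoherent φ
  | _, bot => True
  | _, disj I φ => Finite I ∧ ∀ i, IsCoherent (φ i)

end Formula

/-! ## Theories and provability -/

/-- A geometric sequent `lhs ⊢ rhs` between two formulas in the same variables. -/
structure Sequent (S : Signature.{u}) where
  ctx : List S.Srt
  lhs : Formula.{u, w} S ctx
  rhs : Formula.{u, w} S ctx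

/-- A geometric theory is given by its axioms, which are geometric sequents. -/
abbrev Theory (S : Signature.{u}) := Set (Sequent.{u, w} S)

/-- Provability of a sequent (in the displayed context) from the axioms of a theory, by the
inference rules of geometric logic: axioms, identity, cut, substitution; equality; finite
conjunction; disjunction; existential quantification; distributivity; Frobenius. -/
inductive Provable (T : Theory.{u, w} S) :
    {Γ : List S.Srt} → Formula.{u, w} S Γ → Formula.{u, w} S Γ → Prop
  | ax (s : Sequent.{u, w} S) (h : s ∈ T) : Provable T s.lhs s.rhs
  | id {Γ : List S.Srt} (φ : Formula.{u, w} S Γ) : Provable T φ φ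
  | cut {Γ : List S.Srt} {φ ψ χ : Formula.{u, w} S Γ} :
      Provable T φ ψ → Provable T ψ χ → Provable T φ χ
  | subst {Γ Δ : List S.Srt} {φ ψ : Formula.{u, w} S Γ} (σ : Subst S Γ Δ) :
      Provable T φ ψ → Provable T (φ.subst σ) (ψ.subst σ)
  | eq_refl {Γ : List S.Srt} {A : S.Srt} (t : Term S Γ A) : Provable T .top (.eq t t)
  | eq_subst {Γ : List S.Srt} {A : S.Srt} (s t : Term S Γ A) (φ : Formula.{u, w} S (A :: Γ)) :
      Provable T (.and (.eq s t) (φ.subst (Subst.inst s))) (φ.subst (Subst.inst t))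
  | top_intro {Γ : List S.Srt} (φ : Formula.{u, w} S Γ) : Provable T φ .top
  | and_left {Γ : List S.Srt} (φ ψ : Formula.{u, w} S Γ) : Provable T (.and φ ψ) φ
  | and_right {Γ : List S.Srt} (φ ψ : Formula.{u, w} S Γ) : Provable T (.and φ ψ) ψ
  | and_intro {Γ : List S.Srt} {φ ψ χ : Formula.{u, w} S Γ} :
      Provable T φ ψ → Provable T φ χ → Provable T φ (.and ψ χ)
  | bot_elim {Γ : List S.Srt} (φ : Formula.{u, w} S Γ) : Provable T .bot φ
  | disj_intro {Γ : List S.Srt} {I : Type w} (φ : I → Formula.{u, w} S Γ) (i : I) :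
      Provable T (φ i) (.disj I φ)
  | disj_elim {Γ : List S.Srt} {I : Type w} {φ : I → Formula.{u, w} S Γ}
      {ψ : Formula.{u, w} S Γ} : (∀ i, Provable T (φ i) ψ) → Provable T (.disj I φ) ψ
  | ex_elim {Γ : List S.Srt} {A : S.Srt} {φ : Formula.{u, w} S (A :: Γ)}
      {ψ : Formula.{u, w} S Γ} :
      Provable T φ (ψ.rename (fun _ v => .succ v)) → Provable T (.ex A φ) ψ
  | ex_intro {Γ : List S.Srt} {A : S.Srt} {φ : Formula.{u, w} S (A :: Γ)}
      {ψ : Formula.{u, w} S Γ} :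
      Provable T (.ex A φ) ψ → Provable T φ (ψ.rename (fun _ v => .succ v))
  | distrib {Γ : List S.Srt} {I : Type w} (φ : Formula.{u, w} S Γ)
      (ψ : I → Formula.{u, w} S Γ) :
      Provable T (.and φ (.disj I ψ)) (.disj I (fun i => .and φ (ψ i)))
  | frobenius {Γ : List S.Srt} {A : S.Srt} (φ : Formula.{u, w} S Γ)
      (ψ : Formula.{u, w} S (A :: Γ)) :
      Provable T (.and φ (.ex A ψ)) (.ex A (.and (φ.rename (fun _ v => .succ v)) ψ))

namespace Theory

/-- Provable equivalence of two formulas in the same variables. -/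
def Equiv (T : Theory.{u, w} S) {Γ : List S.Srt} (φ ψ : Formula.{u, w} S Γ) : Prop :=
  Provable T φ ψ ∧ Provable T ψ φ

/-- The sequent `θ (x⃗, y⃗) ∧ θ (x⃗, y⃗') ⊢ y⃗ = y⃗'` is provable; here `y⃗` are the variables of `Δ`
and `x⃗` those of `Γ`. -/
def Unique (T : Theory.{u, w} S) {Γ Δ : List S.Srt} (θ : Formula.{u, w} S (Δ ++ Γ)) : Prop :=
  Provable T (Γ := Δ ++ (Δ ++ Γ))
    (.and (θ.rename (Var.elim (fun _ v => Var.inl v) (fun _ v => Var.inr (Var.inr v))))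
      (θ.rename (fun _ v => Var.inr v)))
    (.eqs (fun _ v => .var (Var.inl v)) (fun _ v => .var (Var.inr (Var.inl v))))

/-- Coherent theories. -/
def IsCoherent (T : Theory.{u, w} S) : Prop :=
  ∀ s ∈ T, s.lhs.IsCoherent ∧ s.rhs.IsCoherent

/-- Regular theories. -/
def IsRegular (T : Theory.{u, w} S) : Prop :=
  ∀ s ∈ T, s.lhs.IsRegular ∧ s.rhs.IsRegular

/-- The formula has the form `∃ y⃗, η (x⃗, y⃗)` with `η` Horn and `y⃗` provably unique in `T`. -/
def IsCartesianForm (T : Theory.{u, w} S) {Γ : List S.Srt} (φ : Formula.{u, w} S Γ) : Prop :=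
  ∃ (Δ : List S.Srt) (η : Formula.{u, w} S (Δ ++ Γ)),
    η.IsHorn ∧ T.Unique η ∧ φ = .exs Δ η

/-- `T`-cartesian formulas: the regular formulas that can be written, up to provable equivalence
in `T`, in the form `∃ y⃗, η (x⃗, y⃗)` with `η` Horn and `y⃗` provably unique in `T`. -/
def IsCartesianFormula (T : Theory.{u, w} S) {Γ : List S.Srt} (φ : Formula.{u, w} S Γ) : Prop :=
  φ.IsRegular ∧ ∃ φ' : Formula.{u, w} S Γ, T.IsCartesianForm φ' ∧ T.Equiv φ φ'

/-- Cartesian theories: those which can be defined by axioms between formulas of the form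
`∃ y⃗, η (x⃗, y⃗)` with `η` Horn and `y⃗` provably unique in the theory. -/
def IsCartesian (T : Theory.{u, w} S) : Prop :=
  ∃ T' : Theory.{u, w} S,
    (∀ (Γ : List S.Srt) (φ ψ : Formula.{u, w} S Γ), Provable T' φ ψ ↔ Provable T φ ψ) ∧
    ∀ s ∈ T', T.IsCartesianForm s.lhs ∧ T.IsCartesianForm s.rhs

end Theory

/-! ## Elementary facts on substitution and provability -/

namespace Var

variable {K : Type u}

theorem elim_inl {Γ Δ : List K} {X : K → Type*} (f : ∀ ⦃A⦄, Var Γ A → X A)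
    (g : ∀ ⦃A⦄, Var Δ A → X A) {A : K} (v : Var Γ A) : elim f g (inl v) = f v := by
  induction v with
  | zero => rfl
  | succ v ih => exact ih (fun _ v => f (succ v))

theorem elim_inr {Γ Δ : List K} {X : K → Type*} (f : ∀ ⦃A⦄, Var Γ A → X A)
    (g : ∀ ⦃A⦄, Var Δ A → X A) {A : K} (v : Var Δ A) : elim f g (inr v) = g v := by
  induction Γ with
  | nil => rfl
  | cons B Γ ih => exact ih (fun _ v => f (succ v))

theorem elim_eta {Γ Δ : List K} {X : K → Type*} (h : ∀ ⦃A⦄, Var (Γ ++ Δ) A → X A) :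
    elim (fun _ v => h (inl v)) (fun _ v => h (inr v)) = h := by
  induction Γ with
  | nil => rfl
  | cons B Γ ih =>
    funext A v
    cases v with
    | zero => rfl
    | succ v => exact congrFun (congrFun (ih (fun _ v => h (succ v))) A) v

theorem elim_comp {Γ Δ : List K} {X Y : K → Type*} (f : ∀ ⦃A⦄, Var Γ A → X A)
    (g : ∀ ⦃A⦄, Var Δ A → X A) (h : ∀ ⦃A⦄, X A → Y A) {A : K} (v : Var (Γ ++ Δ) A) :
    h (elim f g v) = elim (X := Y) (fun _ v => h (f v)) (fun _ v => h (g v)) v := by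
  have := elim_eta (X := Y) (fun _ v => h (elim f g v))
  simp only [elim_inl, elim_inr] at this
  rw [this]

end Var

theorem Term.subst_subst {Γ Δ Λ : List S.Srt} (σ : Subst S Γ Δ) (τ : Subst S Δ Λ) {B : S.Srt}
    (t : Term S Γ B) : (t.subst σ).subst τ = t.subst (fun _ v => (σ v).subst τ) := by
  induction t with
  | var v => rfl
  | app f a ih => simp only [Term.subst, ih]

theorem Term.subst_var {Γ : List S.Srt} {B : S.Srt} (t : Term S Γ B) :
    t.subst (fun _ v => .var v) = t := by
  induction t with
  | var v => rfl
  | app f a ih => simp only [Term.subst, ih]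

theorem Subst.lift_comp {Γ Δ Λ : List S.Srt} (A : S.Srt) (σ : Subst S Γ Δ) (τ : Subst S Δ Λ) :
    (fun _ v => ((σ.lift A : Subst S _ _) v).subst (τ.lift A)) =
      (Subst.lift A (fun _ v => (σ v).subst τ) : ∀ B, Var (A :: Γ) B → Term S (A :: Λ) B) := by
  funext B v
  cases v with
  | zero => rfl
  | succ v =>
    simp only [Subst.lift, Term.subst_subst]
    rfl

theorem Subst.lift_var {Γ : List S.Srt} (A : S.Srt) :
    (Subst.lift A (fun _ v => .var v) : Subst S (A :: Γ) (A :: Γ)) = fun _ v => .var v := by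
  funext B v
  cases v <;> rfl

namespace Formula

theorem subst_subst {Γ Δ Λ : List S.Srt} (σ : Subst S Γ Δ) (τ : Subst S Δ Λ)
    (φ : Formula.{u, w} S Γ) : (φ.subst σ).subst τ = φ.subst (fun _ v => (σ v).subst τ) := by
  induction φ generalizing Δ Λ with
  | rel R a => simp only [subst, Term.subst_subst]
  | eq s t => simp only [subst, Term.subst_subst]
  | top => rfl
  | and φ ψ ih₁ ih₂ => simp only [subst, ih₁, ih₂]
  | ex A φ ih =>
    simp only [subst, ih]
    congr 2
    exact Subst.lift_comp A σ τ
  | bot => rfl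
  | disj I φ ih => simp only [subst, ih]

theorem subst_var {Γ : List S.Srt} (φ : Formula.{u, w} S Γ) :
    φ.subst (fun _ v => .var v) = φ := by
  induction φ with
  | rel R a => simp only [subst, Term.subst_var]
  | eq s t => simp only [subst, Term.subst_var]
  | top => rfl
  | and φ ψ ih₁ ih₂ => simp only [subst, ih₁, ih₂]
  | ex A φ ih => simp only [subst, Subst.lift_var, ih]
  | bot => rfl
  | disj I φ ih => simp only [subst, ih]

/-- The weakening of a formula by the variables of `Δ`. -/
def wk {Γ : List S.Srt} (Δ : List S.Srt) (φ : Formula.{u, w} S Γ) : Formula.{u, w} S (Δ ++ Γ) :=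
  φ.rename (fun _ v => Var.inr v)

end Formula

/-- The weakening of a family of terms by the variables of `Δ`. -/
def Subst.wk {Θ Γ : List S.Srt} (Δ : List S.Srt) (a : Subst S Θ Γ) : Subst S Θ (Δ ++ Γ) :=
  fun _ v => (a v).subst (fun _ x => .var (Var.inr x))

/-- Two families of terms as one family. -/
abbrev Subst.pair {Δ Γ Λ : List S.Srt} (b : Subst S Δ Λ) (a : Subst S Γ Λ) :
    Subst S (Δ ++ Γ) Λ :=
  Var.elim b a

/-- The first variables of a disjoint union of contexts. -/
abbrev Subst.fst {Δ Γ : List S.Srt} : Subst S Δ (Δ ++ Γ) := fun _ v => .var (Var.inl v)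

/-- The last variables of a disjoint union of contexts. -/
abbrev Subst.snd {Δ Γ : List S.Srt} : Subst S Γ (Δ ++ Γ) := fun _ v => .var (Var.inr v)

theorem Subst.pair_subst {Δ Γ Λ Θ : List S.Srt} (b : Subst S Δ Λ) (a : Subst S Γ Λ)
    (τ : Subst S Λ Θ) : (fun _ v => ((Subst.pair b a : Subst S _ _) v).subst τ) =
      (Subst.pair (fun _ v => (b v).subst τ) (fun _ v => (a v).subst τ) :
        ∀ A, Var (Δ ++ Γ) A → Term S Θ A) := by
  funext A v
  exact Var.elim_comp b a (fun _ t => t.subst τ) v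

theorem Subst.pair_wk {Δ Γ Λ : List S.Srt} (Θ : List S.Srt) (b : Subst S Δ Λ)
    (a : Subst S Γ Λ) : (Subst.pair b a).wk Θ = Subst.pair (b.wk Θ) (a.wk Θ) :=
  Subst.pair_subst b a _

theorem Subst.pair_fst_snd {Δ Γ : List S.Srt} :
    (Subst.pair Subst.fst Subst.snd : Subst S (Δ ++ Γ) (Δ ++ Γ)) = fun _ v => .var v :=
  Var.elim_eta (X := Term S (Δ ++ Γ)) (fun _ v => .var v)

theorem Subst.wk_pair {Θ Δ Γ Λ : List S.Srt} (a : Subst S Θ Γ) (b : Subst S Δ Λ)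
    (c : Subst S Γ Λ) : (fun _ v => ((a.wk Δ : Subst S _ _) v).subst (Subst.pair b c)) =
      fun A (v : Var Θ A) => (a v).subst c := by
  funext A v
  simp only [Subst.wk, Term.subst_subst, Term.subst, Subst.pair, Var.elim_inr]

namespace Formula

theorem rename_pair {Δ Γ Λ : List S.Srt} (φ : Formula.{u, w} S Γ) (b : Subst S Δ Λ)
    (a : Subst S Γ Λ) : (φ.wk Δ).subst (Subst.pair b a) = φ.subst a := by
  simp only [wk, rename, subst_subst, Term.subst, Subst.pair, Var.elim_inr]

theorem rename_inl_pair {Δ Γ Λ : List S.Srt} (φ : Formula.{u, w} S Δ) (b : Subst S Δ Λ)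
    (a : Subst S Γ Λ) :
    (φ.rename (fun _ v => Var.inl v)).subst (Subst.pair b a) = φ.subst b := by
  simp only [rename, subst_subst, Term.subst, Subst.pair, Var.elim_inl]

theorem rename_elim {Δ Γ Λ Θ : List S.Srt} (φ : Formula.{u, w} S (Δ ++ Γ))
    (f : ∀ ⦃A⦄, Var Δ A → Var Λ A) (g : ∀ ⦃A⦄, Var Γ A → Var Λ A) (σ : Subst S Λ Θ) :
    (φ.rename (Var.elim f g)).subst σ =
      φ.subst (Subst.pair (fun _ v => σ (f v)) (fun _ v => σ (g v))) := by
  simp only [rename, subst_subst, Term.subst]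
  congr 1
  funext A v
  exact Var.elim_comp f g (fun _ t => σ t) v

theorem subst_wk {Γ Λ : List S.Srt} (Δ : List S.Srt) (φ : Formula.{u, w} S Γ)
    (a : Subst S Γ Λ) : (φ.subst a).wk Δ = φ.subst (a.wk Δ) := by
  simp only [wk, rename, subst_subst]
  rfl

theorem subst_exs {Γ Λ : List S.Srt} (Δ : List S.Srt) (θ : Formula.{u, w} S (Δ ++ Γ))
    (a : Subst S Γ Λ) :
    (exs Δ θ).subst a = exs Δ (θ.subst (Subst.pair Subst.fst (a.wk Δ))) := by
  induction Δ with
  | nil =>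
    simp only [exs]
    congr 1
    funext A v
    exact (Term.subst_var (a v)).symm
  | cons B Δ ih =>
    simp only [exs, ih, subst]
    congr 3
    funext A v
    cases v with
    | zero => rfl
    | succ v =>
      refine (Var.elim_comp (Subst.fst : Subst S Δ (Δ ++ Λ)) (a.wk Δ)
        (fun _ t => t.subst (fun _ x => .var (.succ x))) v).trans ?_
      simp only [Subst.wk, Term.subst_subst]
      rfl

theorem subst_conj {Γ Λ : List S.Srt} (Δ : List S.Srt)
    (φ : ∀ ⦃A⦄, Var Δ A → Formula.{u, w} S Γ) (a : Subst S Γ Λ) :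
    (conj Δ φ).subst a = conj Δ (fun _ v => (φ v).subst a) := by
  induction Δ with
  | nil => rfl
  | cons B Δ ih => simp only [conj, subst, ih]

theorem subst_eqs {Γ Λ Δ : List S.Srt} (b c : Subst S Δ Γ) (a : Subst S Γ Λ) :
    (eqs.{u, w} b c).subst a = eqs (fun _ v => (b v).subst a) (fun _ v => (c v).subst a) := by
  simp only [eqs, subst_conj, subst]

theorem isHorn_conj {Γ : List S.Srt} (Δ : List S.Srt)
    (φ : ∀ ⦃A⦄, Var Δ A → Formula.{u, w} S Γ) (h : ∀ A (v : Var Δ A), (φ v).IsHorn) :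
    (conj Δ φ).IsHorn := by
  induction Δ with
  | nil => trivial
  | cons B Δ ih => exact ⟨h _ _, ih _ (fun _ v => h _ _)⟩

theorem isHorn_eqs {Γ Δ : List S.Srt} (b c : Subst S Δ Γ) : (eqs.{u, w} b c).IsHorn :=
  isHorn_conj _ _ fun _ _ => trivial

theorem IsHorn.isRegular {Γ : List S.Srt} {φ : Formula.{u, w} S Γ} (h : φ.IsHorn) :
    φ.IsRegular := by
  induction φ with
  | and φ ψ ih₁ ih₂ => exact ⟨ih₁ h.1, ih₂ h.2⟩
  | ex A φ _ => exact h.elim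
  | _ => exact h

theorem IsRegular.isCoherent {Γ : List S.Srt} {φ : Formula.{u, w} S Γ} (h : φ.IsRegular) :
    φ.IsCoherent := by
  induction φ with
  | and φ ψ ih₁ ih₂ => exact ⟨ih₁ h.1, ih₂ h.2⟩
  | ex A φ ih => exact ih h
  | disj I φ _ => exact h.elim
  | bot => trivial
  | _ => exact h

theorem IsHorn.subst {Γ Δ : List S.Srt} {φ : Formula.{u, w} S Γ} (h : φ.IsHorn)
    (σ : Subst S Γ Δ) : (φ.subst σ).IsHorn := by
  induction φ with
  | and φ ψ ih₁ ih₂ => exact ⟨ih₁ h.1 σ, ih₂ h.2 σ⟩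
  | ex A φ _ => exact h.elim
  | disj I φ _ => exact h.elim
  | bot => exact h.elim
  | _ => trivial

theorem IsRegular.subst {Γ Δ : List S.Srt} {φ : Formula.{u, w} S Γ} (h : φ.IsRegular)
    (σ : Subst S Γ Δ) : (φ.subst σ).IsRegular := by
  induction φ generalizing Δ with
  | and φ ψ ih₁ ih₂ => exact ⟨ih₁ h.1 σ, ih₂ h.2 σ⟩
  | ex A φ ih => exact ih h _
  | disj I φ _ => exact h.elim
  | bot => exact h.elim
  | _ => trivial

theorem IsCoherent.subst {Γ Δ : List S.Srt} {φ : Formula.{u, w} S Γ} (h : φ.IsCoherent)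
    (σ : Subst S Γ Δ) : (φ.subst σ).IsCoherent := by
  induction φ generalizing Δ with
  | and φ ψ ih₁ ih₂ => exact ⟨ih₁ h.1 σ, ih₂ h.2 σ⟩
  | ex A φ ih => exact ih h _
  | disj I φ ih => exact ⟨h.1, fun i => ih i (h.2 i) σ⟩
  | _ => trivial

theorem IsRegular.exs {Γ : List S.Srt} {Δ : List S.Srt} {θ : Formula.{u, w} S (Δ ++ Γ)}
    (h : θ.IsRegular) : (exs Δ θ).IsRegular := by
  induction Δ with
  | nil => exact h
  | cons B Δ ih => exact ih (θ := Formula.ex B θ) h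

theorem IsCoherent.exs {Γ : List S.Srt} {Δ : List S.Srt} {θ : Formula.{u, w} S (Δ ++ Γ)}
    (h : θ.IsCoherent) : (exs Δ θ).IsCoherent := by
  induction Δ with
  | nil => exact h
  | cons B Δ ih => exact ih (θ := Formula.ex B θ) h

end Formula

namespace Provable

variable {T : Theory.{u, w} S} {Γ Δ Λ : List S.Srt}

theorem left {χ φ ψ : Formula.{u, w} S Γ} (h : Provable T χ (.and φ ψ)) : Provable T χ φ :=
  h.cut (and_left _ _)

theorem right {χ φ ψ : Formula.{u, w} S Γ} (h : Provable T χ (.and φ ψ)) : Provable T χ ψ :=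
  h.cut (and_right _ _)

theorem subst_cut {χ : Formula.{u, w} S Λ} {φ ψ : Formula.{u, w} S Γ} {a : Subst S Γ Λ}
    (h : Provable T χ (φ.subst a)) (k : Provable T φ ψ) : Provable T χ (ψ.subst a) :=
  h.cut (k.subst a)

theorem exs_adj {φ : Formula.{u, w} S (Δ ++ Γ)} {ψ : Formula.{u, w} S Γ} :
    Provable T (.exs Δ φ) ψ ↔ Provable T φ (ψ.wk Δ) := by
  induction Δ with
  | nil =>
    have : ψ.wk [] = ψ := ψ.subst_var
    rw [this]
    rfl
  | cons B Δ ih =>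
    have : ψ.wk (B :: Δ) = (ψ.wk Δ).rename (fun _ v => .succ v) := by
      simp only [Formula.wk, Formula.rename, Formula.subst_subst]
      rfl
    rw [this]
    exact ih.trans ⟨ex_intro, ex_elim⟩

theorem exs_frobenius {φ : Formula.{u, w} S Γ} {ψ : Formula.{u, w} S (Δ ++ Γ)} :
    Provable T (.and φ (.exs Δ ψ)) (.exs Δ (.and (φ.wk Δ) ψ)) := by
  induction Δ with
  | nil =>
    have : φ.wk [] = φ := φ.subst_var
    simp only [Formula.exs, this]
    exact id _
  | cons B Δ ih =>
    have e : φ.wk (B :: Δ) = (φ.wk Δ).rename (fun _ v => .succ v) := by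
      simp only [Formula.wk, Formula.rename, Formula.subst_subst]
      rfl
    refine (ih (ψ := .ex B ψ)).cut ?_
    rw [exs_adj]
    refine (frobenius _ _).cut ?_
    rw [← e]
    exact exs_adj.1 (id (Formula.exs Δ (.ex B (.and (φ.wk (B :: Δ)) ψ))))

theorem exs_intro {χ : Formula.{u, w} S Λ} {θ : Formula.{u, w} S (Δ ++ Γ)} {a : Subst S Γ Λ}
    (b : Subst S Δ Λ) (h : Provable T χ (θ.subst (Subst.pair b a))) :
    Provable T χ ((Formula.exs Δ θ).subst a) := by
  have := subst_cut h (exs_adj.1 (id (Formula.exs Δ θ)))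
  rwa [Formula.rename_pair] at this

theorem exs_elim {χ ψ : Formula.{u, w} S Λ} {θ : Formula.{u, w} S (Δ ++ Γ)} {a : Subst S Γ Λ}
    (h : Provable T χ ((Formula.exs Δ θ).subst a))
    (k : Provable T (.and (χ.wk Δ) (θ.subst (Subst.pair Subst.fst (a.wk Δ)))) (ψ.wk Δ)) :
    Provable T χ ψ := by
  rw [Formula.subst_exs] at h
  exact (and_intro (id χ) h).cut (exs_frobenius.cut (exs_adj.2 k))

theorem conj_iff {χ : Formula.{u, w} S Γ} {φ : ∀ ⦃A⦄, Var Δ A → Formula.{u, w} S Γ} :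
    Provable T χ (.conj Δ φ) ↔ ∀ A (v : Var Δ A), Provable T χ (φ v) := by
  induction Δ with
  | nil => exact ⟨fun _ _ v => (nomatch v), fun _ => top_intro _⟩
  | cons B Δ ih =>
    refine ⟨fun h A v => ?_, fun h => and_intro (h _ _) (ih.2 fun _ v => h _ _)⟩
    cases v with
    | zero => exact h.left
    | succ v => exact ih.1 h.right _ v

theorem eqs_iff {χ : Formula.{u, w} S Γ} {b c : Subst S Δ Γ} :
    Provable T χ (.eqs b c) ↔ ∀ A (v : Var Δ A), Provable T χ (.eq (b v) (c v)) :=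
  conj_iff

theorem refl {χ : Formula.{u, w} S Γ} {A : S.Srt} (t : Term S Γ A) : Provable T χ (.eq t t) :=
  (top_intro χ).cut (eq_refl t)

/-- The replacement of one term by an equal one. -/
theorem replace {χ : Formula.{u, w} S Λ} {A : S.Srt} {s t : Term S Λ A}
    {φ : Formula.{u, w} S (A :: Γ)} {a : Subst S Γ Λ} (e : Provable T χ (.eq s t))
    (h : Provable T χ (φ.subst (Subst.pair (Γ := Γ) (Var.single s) a))) :
    Provable T χ (φ.subst (Subst.pair (Γ := Γ) (Var.single t) a)) := by
  have key (r : Term S Λ A) : (φ.subst (a.lift A)).subst (Subst.inst r) =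
      φ.subst (Subst.pair (Γ := Γ) (Var.single r) a) := by
    rw [Formula.subst_subst]
    congr 1
    funext B v
    cases v with
    | zero => rfl
    | succ v =>
      simp only [Subst.lift, Term.subst_subst, Term.subst, Subst.inst, Term.subst_var]
      rfl
  rw [← key] at h ⊢
  exact (and_intro e h).cut (eq_subst s t _)

theorem eq_symm {χ : Formula.{u, w} S Γ} {A : S.Srt} {s t : Term S Γ A}
    (h : Provable T χ (.eq s t)) : Provable T χ (.eq t s) := by
  have := replace (φ := .eq (.var .zero) (.var (.succ .zero)))
    (a := (Var.single s : Subst S [A] Γ)) h (refl s)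
  exact this

theorem eq_trans {χ : Formula.{u, w} S Γ} {A : S.Srt} {r s t : Term S Γ A}
    (h : Provable T χ (.eq r s)) (k : Provable T χ (.eq s t)) : Provable T χ (.eq r t) := by
  have := replace (φ := .eq (.var .zero) (.var (.succ .zero)))
    (a := (Var.single t : Subst S [A] Γ)) (eq_symm h) k
  exact this

theorem single_pair {B : S.Srt} (φ : Formula.{u, w} S (B :: (Δ ++ Γ))) (c : Subst S (B :: Δ) Λ)
    (a : Subst S Γ Λ) :
    φ.subst (Subst.pair (Δ := [B]) (Γ := Δ ++ Γ) (Var.single (c .zero))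
      (Subst.pair (fun _ v => c (.succ v)) a)) = φ.subst (Subst.pair c a) := by
  refine congrArg (fun σ : Subst S (B :: (Δ ++ Γ)) Λ => φ.subst σ) ?_
  funext A v
  cases v <;> rfl

/-- The replacement of a family of terms by an equal one. -/
theorem replaces {χ : Formula.{u, w} S Λ} {b c : Subst S Γ Λ} {φ : Formula.{u, w} S Γ}
    (e : ∀ A (v : Var Γ A), Provable T χ (.eq (b v) (c v)))
    (h : Provable T χ (φ.subst b)) : Provable T χ (φ.subst c) := by
  suffices H : ∀ (Δ Θ : List S.Srt) (φ : Formula.{u, w} S (Δ ++ Θ)) (b c : Subst S Δ Λ)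
      (a : Subst S Θ Λ) (_ : ∀ A (v : Var Δ A), Provable T χ (.eq (b v) (c v)))
      (_ : Provable T χ (φ.subst (Subst.pair b a))), Provable T χ (φ.subst (Subst.pair c a)) by
    have e' (d : Subst S Γ Λ) : (φ.rename (fun _ v => Var.inl v)).subst
        (Subst.pair d (fun _ v => nomatch v : Subst S [] Λ)) = φ.subst d :=
      Formula.rename_inl_pair _ _ _
    rw [← e'] at h ⊢
    exact H _ _ _ _ _ _ e h
  intro Δ
  induction Δ with
  | nil => exact fun _ _ _ _ _ _ h => h
  | cons B Δ ih =>
    intro Θ φ b c a e h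
    -- first the head variable, then the others
    have h₁ : Provable T χ (φ.subst (Subst.pair (Γ := Δ ++ Θ) (Var.single (c .zero))
        (Subst.pair (fun _ v => b (.succ v)) a))) := by
      refine replace (s := b .zero) (e _ _) ?_
      rw [single_pair]
      exact h
    let p : ∀ ⦃A⦄, Var (B :: (Δ ++ Θ)) A → Var (Δ ++ (B :: Θ)) A :=
      Var.elim (Γ := [B]) (Δ := Δ ++ Θ) (Var.single (X := Var (Δ ++ (B :: Θ))) (Var.inr .zero))
        (Var.elim (fun _ v => Var.inl v) (fun _ v => Var.inr (.succ v)))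
    have key (d : Subst S Δ Λ) : (φ.rename p).subst
          (Subst.pair d (Subst.pair (Γ := Θ) (Var.single (c .zero)) a)) =
        φ.subst (Subst.pair (Γ := Δ ++ Θ) (Var.single (c .zero)) (Subst.pair d a)) := by
      simp only [Formula.rename, Formula.subst_subst, Term.subst]
      congr 1
      funext A v
      cases v with
      | zero => exact Var.elim_inr _ _ _
      | succ v =>
        refine (Var.elim_comp (X := Var (Δ ++ (B :: Θ))) (fun _ v => Var.inl v)
          (fun _ v => Var.inr (.succ v)) (fun _ x => Var.elim d (Subst.pair (Δ := [B])
            (Var.single (c .zero)) a) x) v).trans ?_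
        simp only [Var.elim_inl, Var.elim_inr]
        rfl
    have h₂ := ih (B :: Θ) (φ.rename p) (fun _ v => b (.succ v)) (fun _ v => c (.succ v))
      (Subst.pair (Γ := Θ) (Var.single (c .zero)) a) (fun A v => e _ _) (by rw [key]; exact h₁)
    rw [key] at h₂
    rw [single_pair φ c] at h₂
    exact h₂

end Provable

/-- The composite of two substitutions. -/
abbrev Subst.comp {Θ Γ Λ : List S.Srt} (a : Subst S Θ Γ) (τ : Subst S Γ Λ) : Subst S Θ Λ :=
  fun _ v => (a v).subst τ

/-- `χ'` implies the substitution instances by `τ` of the consequences of `χ`. -/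
def Theory.Transport (T : Theory.{u, w} S) {Λ Λ' : List S.Srt} (χ : Formula.{u, w} S Λ)
    (χ' : Formula.{u, w} S Λ') (τ : Subst S Λ Λ') : Prop :=
  ∀ ρ : Formula.{u, w} S Λ, Provable T χ ρ → Provable T χ' (ρ.subst τ)

section

variable {T : Theory.{u, w} S} {Γ Δ Θ Λ Λ' : List S.Srt}

theorem Theory.Transport.one {χ : Formula.{u, w} S Λ} {χ' : Formula.{u, w} S Λ'}
    {τ : Subst S Λ Λ'} (h : T.Transport χ χ' τ) {φ : Formula.{u, w} S Γ} {a : Subst S Γ Λ}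
    (k : Provable T χ (φ.subst a)) : Provable T χ' (φ.subst (a.comp τ)) := by
  have := h _ k
  rwa [Formula.subst_subst] at this

theorem Theory.Transport.two {χ : Formula.{u, w} S Λ} {χ' : Formula.{u, w} S Λ'}
    {τ : Subst S Λ Λ'} (h : T.Transport χ χ' τ) {φ : Formula.{u, w} S (Δ ++ Γ)}
    {b : Subst S Δ Λ} {a : Subst S Γ Λ} (k : Provable T χ (φ.subst (Subst.pair b a))) :
    Provable T χ' (φ.subst (Subst.pair (b.comp τ) (a.comp τ))) := by
  have := h _ k
  rwa [Formula.subst_subst, Subst.pair_subst] at this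

theorem Formula.subst_pair (φ : Formula.{u, w} S (Δ ++ Γ)) (b : Subst S Δ Λ) (a : Subst S Γ Λ)
    (τ : Subst S Λ Λ') :
    (φ.subst (Subst.pair b a)).subst τ = φ.subst (Subst.pair (b.comp τ) (a.comp τ)) := by
  rw [Formula.subst_subst, Subst.pair_subst]

theorem Provable.exs_elim' {χ ψ : Formula.{u, w} S Λ} {θ : Formula.{u, w} S (Δ ++ Γ)}
    {a : Subst S Γ Λ} (h : Provable T χ ((Formula.exs Δ θ).subst a))
    (k : ∀ (Λ' : List S.Srt) (χ' : Formula.{u, w} S Λ') (τ : Subst S Λ Λ') (b : Subst S Δ Λ'),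
      T.Transport χ χ' τ → Provable T χ' (θ.subst (Subst.pair b (a.comp τ))) →
      Provable T χ' (ψ.subst τ)) : Provable T χ ψ :=
  h.exs_elim (k _ _ Subst.snd Subst.fst
    (fun _ hρ => (Provable.and_left _ _).cut (hρ.subst _)) (Provable.and_right _ _))

theorem Provable.of_generic {φ ψ : Formula.{u, w} S (Δ ++ Γ)}
    (h : ∀ (Λ : List S.Srt) (χ : Formula.{u, w} S Λ) (b : Subst S Δ Λ) (a : Subst S Γ Λ),
      Provable T χ (φ.subst (Subst.pair b a)) → Provable T χ (ψ.subst (Subst.pair b a))) :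
    Provable T φ ψ := by
  have := h (Δ ++ Γ) φ Subst.fst Subst.snd
  rw [Subst.pair_fst_snd, Formula.subst_var, Formula.subst_var] at this
  exact this (Provable.id φ)

theorem Theory.unique_iff {θ : Formula.{u, w} S (Δ ++ Γ)} :
    T.Unique θ ↔ ∀ (Λ : List S.Srt) (χ : Formula.{u, w} S Λ) (b b' : Subst S Δ Λ)
      (a : Subst S Γ Λ), Provable T χ (θ.subst (Subst.pair b a)) →
      Provable T χ (θ.subst (Subst.pair b' a)) →
      ∀ A (v : Var Δ A), Provable T χ (.eq (b v) (b' v)) := by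
  have e₁ {Λ : List S.Srt} (b b' : Subst S Δ Λ) (a : Subst S Γ Λ) :
      (θ.rename (Var.elim (fun _ v => Var.inl v) (fun _ v => Var.inr (Var.inr v)))).subst
        (Subst.pair b (Subst.pair b' a)) = θ.subst (Subst.pair b a) := by
    rw [Formula.rename_elim]
    simp only [Subst.pair, Var.elim_inl, Var.elim_inr]
  have e₂ {Λ : List S.Srt} (b b' : Subst S Δ Λ) (a : Subst S Γ Λ) :
      (θ.rename (fun _ v => Var.inr (Γ := Δ) v)).subst
        (Subst.pair b (Subst.pair b' a)) = θ.subst (Subst.pair b' a) :=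
    Formula.rename_pair _ _ _
  constructor
  · intro h Λ χ b b' a h₁ h₂
    have := Provable.subst_cut (χ := χ) (a := Subst.pair b (Subst.pair b' a))
      (Provable.and_intro (by rw [e₁]; exact h₁) (by rw [e₂]; exact h₂)) h
    rw [Formula.subst_eqs, Provable.eqs_iff] at this
    simpa only [Term.subst, Subst.pair, Var.elim_inl, Var.elim_inr] using this
  · intro h
    refine Provable.of_generic fun Λ χ b c k => ?_
    have ec : c = Subst.pair (fun _ v => c (Var.inl v)) (fun _ v => c (Var.inr v)) :=
      (Var.elim_eta c).symm
    have k₁ := k.left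
    have k₂ := k.right
    rw [ec] at k₁ k₂
    rw [e₁] at k₁
    rw [e₂] at k₂
    rw [Formula.subst_eqs, Provable.eqs_iff]
    simpa only [Term.subst, Subst.pair, Var.elim_inl, Var.elim_inr] using h Λ χ _ _ _ k₁ k₂

end

/-! ## The syntactic category -/

/-- The formula `θ (x⃗, y⃗)`, with `x⃗` the variables of `Γ` and `y⃗` those of `Δ`, is provably
functional from `φ (x⃗)` to `ψ (y⃗)`. -/
structure Theory.Functional (T : Theory.{u, w} S) {Γ Δ : List S.Srt} (φ : Formula.{u, w} S Γ)
    (ψ : Formula.{u, w} S Δ) (θ : Formula.{u, w} S (Δ ++ Γ)) : Prop where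
  sub : Provable T θ
    (.and (φ.rename (fun _ v => Var.inr v)) (ψ.rename (fun _ v => Var.inl v)))
  total : Provable T φ (.exs Δ θ)
  unique : T.Unique θ

/-- The formula `φ (x⃗) ∧ y⃗ = x⃗`, which represents the identity of `φ (x⃗)`. -/
def Formula.idGraph {Γ : List S.Srt} (φ : Formula.{u, w} S Γ) : Formula.{u, w} S (Γ ++ Γ) :=
  .and (φ.rename (fun _ v => Var.inr v))
    (.eqs (fun _ v => .var (Var.inl v)) (fun _ v => .var (Var.inr v)))

/-- The formula `(∃ y⃗) (θ (x⃗, y⃗) ∧ θ' (y⃗, z⃗))`, with `x⃗`, `y⃗`, `z⃗` the variables of `Γ`, `Δ`, `Θ`. -/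
def Formula.compGraph {Γ Δ Θ : List S.Srt} (θ : Formula.{u, w} S (Δ ++ Γ))
    (θ' : Formula.{u, w} S (Θ ++ Δ)) : Formula.{u, w} S (Θ ++ Γ) :=
  .exs Δ (.and
    (θ.rename (Var.elim (fun _ v => Var.inl v) (fun _ v => Var.inr (Var.inr v))))
    (θ'.rename (Var.elim (fun _ v => Var.inr (Var.inl v)) (fun _ v => Var.inl v))))

section

variable {T : Theory.{u, w} S} {Γ Δ Θ Ξ Λ : List S.Srt}

namespace Theory.Functional

variable {φ : Formula.{u, w} S Γ} {ψ : Formula.{u, w} S Δ} {θ : Formula.{u, w} S (Δ ++ Γ)}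
  {χ : Formula.{u, w} S Λ} {b b' : Subst S Δ Λ} {a : Subst S Γ Λ}

theorem src (h : T.Functional φ ψ θ) (k : Provable T χ (θ.subst (Subst.pair b a))) :
    Provable T χ (φ.subst a) := by
  have := (k.subst_cut h.sub).left
  rwa [← Formula.wk, Formula.rename_pair] at this

theorem tgt (h : T.Functional φ ψ θ) (k : Provable T χ (θ.subst (Subst.pair b a))) :
    Provable T χ (ψ.subst b) := by
  have := (k.subst_cut h.sub).right
  rwa [Formula.rename_inl_pair] at this

theorem eq (h : T.Functional φ ψ θ) (k : Provable T χ (θ.subst (Subst.pair b a)))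
    (k' : Provable T χ (θ.subst (Subst.pair b' a))) (A : S.Srt) (v : Var Δ A) :
    Provable T χ (.eq (b v) (b' v)) :=
  Theory.unique_iff.1 h.unique _ _ _ _ _ k k' A v

theorem mk' (h₁ : ∀ (Λ : List S.Srt) (χ : Formula.{u, w} S Λ) (b : Subst S Δ Λ)
      (a : Subst S Γ Λ), Provable T χ (θ.subst (Subst.pair b a)) →
      Provable T χ (φ.subst a) ∧ Provable T χ (ψ.subst b))
    (h₂ : Provable T φ (.exs Δ θ))
    (h₃ : ∀ (Λ : List S.Srt) (χ : Formula.{u, w} S Λ) (b b' : Subst S Δ Λ)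
      (a : Subst S Γ Λ), Provable T χ (θ.subst (Subst.pair b a)) →
      Provable T χ (θ.subst (Subst.pair b' a)) →
      ∀ A (v : Var Δ A), Provable T χ (.eq (b v) (b' v))) : T.Functional φ ψ θ where
  sub := Provable.of_generic fun Λ χ b a k => Provable.and_intro
    (by rw [← Formula.wk, Formula.rename_pair]; exact (h₁ _ _ _ _ k).1)
    (by rw [Formula.rename_inl_pair]; exact (h₁ _ _ _ _ k).2)
  total := h₂
  unique := Theory.unique_iff.2 h₃

end Theory.Functional

theorem Provable.pair_eq {χ : Formula.{u, w} S Λ} {b b' : Subst S Δ Λ} {a a' : Subst S Γ Λ}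
    (hb : ∀ A (v : Var Δ A), Provable T χ (.eq (b v) (b' v)))
    (ha : ∀ A (v : Var Γ A), Provable T χ (.eq (a v) (a' v))) (A : S.Srt)
    (v : Var (Δ ++ Γ) A) :
    Provable T χ (.eq ((Subst.pair b a : Subst S _ _) v) ((Subst.pair b' a' : Subst S _ _) v)) := by
  induction Δ with
  | nil => exact ha _ _
  | cons B Δ ih =>
    cases v with
    | zero => exact hb _ _
    | succ v =>
      exact ih (b := fun _ v => b (.succ v)) (b' := fun _ v => b' (.succ v)) (fun _ v => hb _ _) v

theorem Provable.replaces₂ {χ : Formula.{u, w} S Λ} {θ : Formula.{u, w} S (Δ ++ Γ)}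
    {b b' : Subst S Δ Λ} {a a' : Subst S Γ Λ}
    (hb : ∀ A (v : Var Δ A), Provable T χ (.eq (b v) (b' v)))
    (ha : ∀ A (v : Var Γ A), Provable T χ (.eq (a v) (a' v)))
    (h : Provable T χ (θ.subst (Subst.pair b a))) : Provable T χ (θ.subst (Subst.pair b' a')) :=
  h.replaces (Provable.pair_eq hb ha)

theorem Formula.idGraph_iff {φ : Formula.{u, w} S Γ} {χ : Formula.{u, w} S Λ}
    {b a : Subst S Γ Λ} : Provable T χ (φ.idGraph.subst (Subst.pair b a)) ↔
      Provable T χ (φ.subst a) ∧ ∀ A (v : Var Γ A), Provable T χ (.eq (b v) (a v)) := by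
  have e₁ : (φ.rename (fun _ v => Var.inr v)).subst (Subst.pair b a) = φ.subst a :=
    Formula.rename_pair _ _ _
  have e₂ : Provable T χ ((Formula.eqs (fun _ v => .var (Var.inl v))
      (fun _ v => .var (Var.inr v)) : Formula S (Γ ++ Γ)).subst (Subst.pair b a)) ↔
      ∀ A (v : Var Γ A), Provable T χ (.eq (b v) (a v)) := by
    rw [Formula.subst_eqs, Provable.eqs_iff]
    simp only [Term.subst, Subst.pair, Var.elim_inl, Var.elim_inr]
  constructor
  · intro h
    exact ⟨by rw [← e₁]; exact h.left, e₂.1 h.right⟩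
  · intro h
    exact Provable.and_intro (by rw [e₁]; exact h.1) (e₂.2 h.2)

theorem Formula.comp_body (θ : Formula.{u, w} S (Δ ++ Γ)) (θ' : Formula.{u, w} S (Θ ++ Δ))
    (b : Subst S Δ Λ) (c : Subst S Θ Λ) (a : Subst S Γ Λ) :
    (Formula.and
      (θ.rename (Var.elim (fun _ v => Var.inl v) (fun _ v => Var.inr (Var.inr v))))
      (θ'.rename (Var.elim (fun _ v => Var.inr (Var.inl v)) (fun _ v => Var.inl v)))).subst
      (Subst.pair b (Subst.pair c a)) =
      .and (θ.subst (Subst.pair b a)) (θ'.subst (Subst.pair c b)) := by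
  simp only [Formula.subst, Formula.rename_elim]
  simp only [Subst.pair, Var.elim_inl, Var.elim_inr]

theorem Provable.comp_intro {θ : Formula.{u, w} S (Δ ++ Γ)} {θ' : Formula.{u, w} S (Θ ++ Δ)}
    {χ : Formula.{u, w} S Λ} {b : Subst S Δ Λ} {c : Subst S Θ Λ} {a : Subst S Γ Λ}
    (h : Provable T χ (θ.subst (Subst.pair b a))) (h' : Provable T χ (θ'.subst (Subst.pair c b))) :
    Provable T χ ((Formula.compGraph θ θ').subst (Subst.pair c a)) :=
  Provable.exs_intro b (by rw [Formula.comp_body]; exact Provable.and_intro h h')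

theorem Provable.comp_elim {θ : Formula.{u, w} S (Δ ++ Γ)} {θ' : Formula.{u, w} S (Θ ++ Δ)}
    {χ ψ : Formula.{u, w} S Λ} {c : Subst S Θ Λ} {a : Subst S Γ Λ}
    (h : Provable T χ ((Formula.compGraph θ θ').subst (Subst.pair c a)))
    (k : ∀ (Λ' : List S.Srt) (χ' : Formula.{u, w} S Λ') (τ : Subst S Λ Λ') (b : Subst S Δ Λ'),
      T.Transport χ χ' τ → Provable T χ' (θ.subst (Subst.pair b (a.comp τ))) →
      Provable T χ' (θ'.subst (Subst.pair (c.comp τ) b)) →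
      Provable T χ' (ψ.subst τ)) : Provable T χ ψ := by
  refine Provable.exs_elim' h fun Λ' χ' τ b ht hb => ?_
  have e : (Subst.pair c a).comp τ = Subst.pair (c.comp τ) (a.comp τ) := Subst.pair_subst _ _ _
  rw [e, Formula.comp_body] at hb
  exact k _ _ _ _ ht hb.left hb.right

theorem Theory.functional_id (φ : Formula.{u, w} S Γ) : T.Functional φ φ φ.idGraph := by
  refine .mk' (fun Λ χ b a h => ?_) ?_ (fun Λ χ b b' a h h' A v => ?_)
  · rw [Formula.idGraph_iff] at h
    exact ⟨h.1, h.1.replaces fun A v => (h.2 A v).eq_symm⟩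
  · have := Provable.exs_intro (T := T) (χ := φ) (θ := φ.idGraph) (a := fun _ v => .var v)
      (fun _ v => .var v)
      (Formula.idGraph_iff.2 ⟨by rw [Formula.subst_var]; exact .id _, fun _ _ => .refl _⟩)
    rwa [Formula.subst_var] at this
  · rw [Formula.idGraph_iff] at h h'
    exact (h.2 A v).eq_trans (h'.2 A v).eq_symm

theorem Theory.Functional.comp {φ : Formula.{u, w} S Γ} {ψ : Formula.{u, w} S Δ}
    {ω : Formula.{u, w} S Θ} {θ : Formula.{u, w} S (Δ ++ Γ)} {θ' : Formula.{u, w} S (Θ ++ Δ)}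
    (h : T.Functional φ ψ θ) (h' : T.Functional ψ ω θ') :
    T.Functional φ ω (Formula.compGraph θ θ') := by
  refine .mk' (fun Λ χ c a k => ⟨?_, ?_⟩) ?_ (fun Λ χ c c' a k k' A v => ?_)
  · refine k.comp_elim fun Λ' χ' τ b ht h₁ h₂ => ?_
    rw [Formula.subst_subst]
    exact h.src h₁
  · refine k.comp_elim fun Λ' χ' τ b ht h₁ h₂ => ?_
    rw [Formula.subst_subst]
    exact h'.tgt h₂
  · have k : Provable T φ ((Formula.exs Δ θ).subst (fun _ v => .var v)) := by
      rw [Formula.subst_var]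
      exact h.total
    refine k.exs_elim' fun Λ' χ' τ b ht h₁ => ?_
    refine ((h.tgt h₁).subst_cut h'.total).exs_elim' fun Λ'' χ'' τ' c ht' h₂ => ?_
    rw [Formula.subst_subst]
    exact Provable.exs_intro c (Provable.comp_intro (ht'.two h₁) h₂)
  · refine k.comp_elim (ψ := .eq (c v) (c' v)) fun Λ' χ' τ b ht h₁ h₂ => ?_
    refine (ht.two k').comp_elim (ψ := (Formula.eq (c v) (c' v)).subst τ)
      fun Λ'' χ'' τ' b' ht' h₁' h₂' => ?_
    have e := h.eq (ht'.two h₁) h₁'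
    have := h'.eq ((ht'.two h₂).replaces₂ (fun _ _ => .refl _) e) h₂' A v
    exact this

theorem Formula.comp_mono {θ₁ θ₂ : Formula.{u, w} S (Δ ++ Γ)}
    {θ₁' θ₂' : Formula.{u, w} S (Θ ++ Δ)} (h : Provable T θ₁ θ₂) (h' : Provable T θ₁' θ₂') :
    Provable T (Formula.compGraph θ₁ θ₁') (Formula.compGraph θ₂ θ₂') := by
  refine Provable.of_generic fun Λ χ c a k => k.comp_elim fun Λ' χ' τ b ht h₁ h₂ => ?_
  rw [Formula.subst_subst, Subst.pair_subst]
  exact Provable.comp_intro (h₁.subst_cut h) (h₂.subst_cut h')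

end

/-- The objects of the syntactic category: the geometric formulas in context. -/
structure SynCat (T : Theory.{u, w} S) where
  ctx : List S.Srt
  formula : Formula.{u, w} S ctx

namespace SynCat

variable {T : Theory.{u, w} S}

/-- The provably functional formulas between two formulas. -/
def Graph (X Y : SynCat T) : Type (max u (w + 1)) :=
  {θ : Formula.{u, w} S (Y.ctx ++ X.ctx) // T.Functional X.formula Y.formula θ}

/-- Provable equivalence of provably functional formulas. -/
instance graphSetoid (X Y : SynCat T) : Setoid (Graph X Y) where
  r θ θ' := T.Equiv θ.1 θ'.1
  iseqv := ⟨fun _ => ⟨.id _, .id _⟩, fun h => ⟨h.2, h.1⟩,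
    fun h k => ⟨h.1.cut k.1, k.2.cut h.2⟩⟩

/-- The morphisms of the syntactic category: the provably functional formulas, up to provable
equivalence. -/
def Hom (X Y : SynCat T) : Type (max u (w + 1)) := Quotient (graphSetoid X Y)

/-- The morphism represented by a provably functional formula. -/
def Hom.mk {X Y : SynCat T} (θ : Formula.{u, w} S (Y.ctx ++ X.ctx))
    (h : T.Functional X.formula Y.formula θ) : Hom X Y :=
  Quotient.mk _ ⟨θ, h⟩

theorem Hom.mk_eq {X Y : SynCat T} {θ θ' : Formula.{u, w} S (Y.ctx ++ X.ctx)}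
    {h : T.Functional X.formula Y.formula θ} {h' : T.Functional X.formula Y.formula θ'}
    (e : T.Equiv θ θ') : Hom.mk θ h = Hom.mk θ' h' :=
  Quotient.sound e

/-- The identity morphism. -/
def Hom.id (X : SynCat T) : Hom X X := .mk X.formula.idGraph (Theory.functional_id _)

/-- The composition of morphisms. -/
def Hom.comp {X Y Z : SynCat T} (f : Hom X Y) (g : Hom Y Z) : Hom X Z :=
  Quotient.map₂ (fun θ θ' => ⟨Formula.compGraph θ.1 θ'.1, θ.2.comp θ'.2⟩)
    (fun _ _ (h : T.Equiv _ _) _ _ (h' : T.Equiv _ _) =>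
      ⟨Formula.comp_mono h.1 h'.1, Formula.comp_mono h.2 h'.2⟩) f g

instance : CategoryTheory.Category.{max u (w + 1)} (SynCat T) where
  Hom := Hom
  id := Hom.id
  comp := Hom.comp
  id_comp := by
    rintro X Y ⟨θ, h⟩
    refine Hom.mk_eq ⟨.of_generic fun Λ χ c a k => ?_, .of_generic fun Λ χ c a k => ?_⟩
    · refine k.comp_elim fun Λ' χ' τ b ht h₁ h₂ => ?_
      rw [Formula.subst_subst, Subst.pair_subst]
      exact h₂.replaces₂ (fun _ _ => .refl _) (Formula.idGraph_iff.1 h₁).2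
    · exact Provable.comp_intro (Formula.idGraph_iff.2 ⟨h.src k, fun _ _ => .refl _⟩) k
  comp_id := by
    rintro X Y ⟨θ, h⟩
    refine Hom.mk_eq ⟨.of_generic fun Λ χ c a k => ?_, .of_generic fun Λ χ c a k => ?_⟩
    · refine k.comp_elim fun Λ' χ' τ b ht h₁ h₂ => ?_
      rw [Formula.subst_subst, Subst.pair_subst]
      exact h₁.replaces₂ (fun A v => ((Formula.idGraph_iff.1 h₂).2 A v).eq_symm)
        (fun _ _ => .refl _)
    · exact Provable.comp_intro k (Formula.idGraph_iff.2 ⟨h.tgt k, fun _ _ => .refl _⟩)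
  assoc := by
    rintro X Y Z W ⟨θ, h⟩ ⟨θ', h'⟩ ⟨θ'', h''⟩
    refine Hom.mk_eq ⟨.of_generic fun Λ χ c a k => ?_, .of_generic fun Λ χ c a k => ?_⟩
    · refine k.comp_elim fun Λ' χ' τ b ht h₁ h₂ => ?_
      refine h₁.comp_elim fun Λ'' χ'' τ' b' ht' h₃ h₄ => ?_
      rw [Formula.subst_pair, Formula.subst_pair]
      exact Provable.comp_intro h₃ (Provable.comp_intro h₄ (ht'.two h₂))
    · refine k.comp_elim fun Λ' χ' τ b ht h₁ h₂ => ?_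
      refine h₂.comp_elim fun Λ'' χ'' τ' b' ht' h₃ h₄ => ?_
      rw [Formula.subst_pair, Formula.subst_pair]
      exact Provable.comp_intro (Provable.comp_intro (ht'.two h₁) h₃) h₄

end SynCat

/-! ## Subcategories of the syntactic category -/

/-- A class of formulas which contains the formulas representing the identities of its members and
is stable under the formation of the formulas representing composites. -/
structure Fragment (T : Theory.{u, w} S) where
  mem : ∀ {Γ : List S.Srt}, Formula.{u, w} S Γ → Prop
  id_mem : ∀ {Γ : List S.Srt} {φ : Formula.{u, w} S Γ}, mem φ → mem φ.idGraph
  comp_mem : ∀ {Γ Δ Θ : List S.Srt} {φ : Formula.{u, w} S Γ} {ψ : Formula.{u, w} S Δ}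
    {ω : Formula.{u, w} S Θ} {θ : Formula.{u, w} S (Δ ++ Γ)} {θ' : Formula.{u, w} S (Θ ++ Δ)},
    T.Functional φ ψ θ → T.Functional ψ ω θ' → mem θ → mem θ' → mem (Formula.compGraph θ θ')

/-- The morphism of the syntactic category represented by a provably functional formula. -/
def SynCat.homMk {T : Theory.{u, w} S} {X Y : SynCat T} (θ : Formula.{u, w} S (Y.ctx ++ X.ctx))
    (h : T.Functional X.formula Y.formula θ) : X ⟶ Y :=
  SynCat.Hom.mk θ h

/-- The subcategory of the syntactic category whose objects are the formulas of a given class and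
whose morphisms are those represented by a provably functional formula of that class. -/
structure SynSub {T : Theory.{u, w} S} (P : Fragment T) where
  obj : SynCat T
  mem : P.mem obj.formula

namespace SynSub

open CategoryTheory

variable {T : Theory.{u, w} S} (P : Fragment T)

instance : Category.{max u (w + 1)} (SynSub P) where
  Hom X Y := {f : X.obj ⟶ Y.obj // ∃ θ h, P.mem θ ∧ f = SynCat.homMk θ h}
  id X := ⟨𝟙 X.obj, _, _, P.id_mem X.mem, rfl⟩
  comp f g := ⟨f.1 ≫ g.1, by
    obtain ⟨_, θ, h, hm, rfl⟩ := f
    obtain ⟨_, θ', h', hm', rfl⟩ := g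
    exact ⟨_, h.comp h', P.comp_mem h h' hm hm', rfl⟩⟩
  id_comp f := Subtype.ext (Category.id_comp f.1)
  comp_id f := Subtype.ext (Category.comp_id f.1)
  assoc f g h := Subtype.ext (Category.assoc f.1 g.1 h.1)

/-- The inclusion functor. -/
def ι : SynSub P ⥤ SynCat T where
  obj X := X.obj
  map f := f.1

end SynSub

namespace Theory

variable (T : Theory.{u, w} S)

/-- The class of coherent formulas. -/
def coherent : Fragment T where
  mem φ := φ.IsCoherent
  id_mem h := ⟨h.subst _, (Formula.isHorn_eqs _ _).isRegular.isCoherent⟩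
  comp_mem _ _ h h' := Formula.IsCoherent.exs ⟨h.subst _, h'.subst _⟩

/-- The class of regular formulas. -/
def regular : Fragment T where
  mem φ := φ.IsRegular
  id_mem h := ⟨h.subst _, (Formula.isHorn_eqs _ _).isRegular⟩
  comp_mem _ _ h h' := Formula.IsRegular.exs ⟨h.subst _, h'.subst _⟩

variable {T}

theorem IsCartesianFormula.idGraph {Γ : List S.Srt} {φ : Formula.{u, w} S Γ}
    (h : T.IsCartesianFormula φ) : T.IsCartesianFormula φ.idGraph := by
  obtain ⟨hr, φ', ⟨U, η, hη, hu, rfl⟩, he⟩ := h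
  refine ⟨T.regular.id_mem hr, _, ⟨U,
    .and (η.rename (Var.elim (fun _ v => Var.inl v) (fun _ v => Var.inr (Var.inr v))))
      (.eqs (fun _ v => .var (Var.inr (Var.inl v))) (fun _ v => .var (Var.inr (Var.inr v)))),
    ⟨hη.subst _, Formula.isHorn_eqs _ _⟩, ?_, rfl⟩, ?_⟩
  all_goals
    have key {Λ : List S.Srt} {χ : Formula.{u, w} S Λ} (c : Subst S U Λ) (b a : Subst S Γ Λ) :
        Provable T χ ((Formula.and
          (η.rename (Var.elim (fun _ v => Var.inl v) (fun _ v => Var.inr (Var.inr v))))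
          (.eqs (fun _ v => .var (Var.inr (Var.inl v)))
            (fun _ v => .var (Var.inr (Var.inr v))))).subst
          (Subst.pair c (Subst.pair b a))) ↔ Provable T χ (η.subst (Subst.pair c a)) ∧
          ∀ A (v : Var Γ A), Provable T χ (.eq (b v) (a v)) := by
      simp only [Formula.subst, Formula.rename_elim, Formula.subst_eqs, Term.subst]
      simp only [Subst.pair, Var.elim_inl, Var.elim_inr]
      exact ⟨fun h => ⟨h.left, Provable.eqs_iff.1 h.right⟩,
        fun h => h.1.and_intro (Provable.eqs_iff.2 h.2)⟩
  · rw [unique_iff] at hu ⊢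
    intro Λ χ b b' a h h'
    rw [show a = Subst.pair (fun _ v => a (Var.inl v)) (fun _ v => a (Var.inr v)) from
      (Var.elim_eta a).symm] at h h'
    exact hu _ _ _ _ _ ((key _ _ _).1 h).1 ((key _ _ _).1 h').1
  · constructor
    · refine .of_generic fun Λ χ b a h => ?_
      rw [Formula.idGraph_iff] at h
      refine (h.1.subst_cut he.1).exs_elim' fun Λ' χ' τ c ht hc => ?_
      rw [Formula.subst_pair]
      exact .exs_intro c ((key _ _ _).2 ⟨hc, fun A v => ht _ (h.2 A v)⟩)
    · refine .of_generic fun Λ χ b a h => h.exs_elim' fun Λ' χ' τ c ht hc => ?_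
      rw [Formula.subst_pair]
      rw [show (Subst.pair b a).comp τ = _ from Subst.pair_subst _ _ _, key] at hc
      exact Formula.idGraph_iff.2 ⟨(Provable.exs_intro c hc.1).subst_cut he.2, hc.2⟩

theorem IsCartesianFormula.compGraph {Γ Δ Θ : List S.Srt} {φ : Formula.{u, w} S Γ}
    {ψ : Formula.{u, w} S Δ} {ω : Formula.{u, w} S Θ} {θ : Formula.{u, w} S (Δ ++ Γ)}
    {θ' : Formula.{u, w} S (Θ ++ Δ)} (f : T.Functional φ ψ θ) (f' : T.Functional ψ ω θ')
    (h : T.IsCartesianFormula θ) (h' : T.IsCartesianFormula θ') :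
    T.IsCartesianFormula (Formula.compGraph θ θ') := by
  have hreg := T.regular.comp_mem f f' h.1 h'.1
  obtain ⟨-, _, ⟨U, η, hη, hu, rfl⟩, he⟩ := h
  obtain ⟨-, _, ⟨V, η', hη', hu', rfl⟩, he'⟩ := h'
  refine ⟨hreg, _, ⟨U ++ (V ++ Δ),
    .and (η.rename (Var.elim (fun _ v => Var.inl (Var.inl v))
        (Var.elim (fun _ v => Var.inl (Var.inr (Var.inr v))) (fun _ v => Var.inr (Var.inr v)))))
      (η'.rename (Var.elim (fun _ v => Var.inl (Var.inr (Var.inl v)))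
        (Var.elim (fun _ v => Var.inr (Var.inl v)) (fun _ v => Var.inl (Var.inr (Var.inr v)))))),
    ⟨hη.subst _, hη'.subst _⟩, ?_, rfl⟩, ?_⟩
  all_goals
    have key {Λ : List S.Srt} {χ : Formula.{u, w} S Λ} (p : Subst S U Λ) (q : Subst S V Λ)
        (b : Subst S Δ Λ) (c : Subst S Θ Λ) (a : Subst S Γ Λ) :
        Provable T χ ((Formula.and
          (η.rename (Var.elim (fun _ v => Var.inl (Var.inl v))
            (Var.elim (fun _ v => Var.inl (Var.inr (Var.inr v)))
              (fun _ v => Var.inr (Var.inr v)))))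
          (η'.rename (Var.elim (fun _ v => Var.inl (Var.inr (Var.inl v)))
            (Var.elim (fun _ v => Var.inr (Var.inl v))
              (fun _ v => Var.inl (Var.inr (Var.inr v))))))).subst
          (Subst.pair (Subst.pair p (Subst.pair q b)) (Subst.pair c a))) ↔
        Provable T χ (η.subst (Subst.pair p (Subst.pair b a))) ∧
          Provable T χ (η'.subst (Subst.pair q (Subst.pair c b))) := by
      have e₁ : (η.rename (Var.elim (fun _ v => Var.inl (Var.inl v))
            (Var.elim (fun _ v => Var.inl (Var.inr (Var.inr v)))
              (fun _ v => Var.inr (Var.inr v))))).subst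
          (Subst.pair (Subst.pair p (Subst.pair q b)) (Subst.pair c a)) =
          η.subst (Subst.pair p (Subst.pair b a)) := by
        rw [Formula.rename_elim]
        simp only [Subst.pair, Var.elim_inl]
        congr 2
        funext A v
        refine (Var.elim_comp _ _ (fun _ x => Subst.pair (Subst.pair p (Subst.pair q b))
          (Subst.pair c a) x) v).trans ?_
        simp only [Subst.pair, Var.elim_inl, Var.elim_inr]
      have e₂ : (η'.rename (Var.elim (fun _ v => Var.inl (Var.inr (Var.inl v)))
            (Var.elim (fun _ v => Var.inr (Var.inl v))
              (fun _ v => Var.inl (Var.inr (Var.inr v)))))).subst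
          (Subst.pair (Subst.pair p (Subst.pair q b)) (Subst.pair c a)) =
          η'.subst (Subst.pair q (Subst.pair c b)) := by
        rw [Formula.rename_elim]
        simp only [Subst.pair, Var.elim_inl, Var.elim_inr]
        congr 2
        funext A v
        refine (Var.elim_comp _ _ (fun _ x => Subst.pair (Subst.pair p (Subst.pair q b))
          (Subst.pair c a) x) v).trans ?_
        simp only [Subst.pair, Var.elim_inl, Var.elim_inr]
      rw [Formula.subst, e₁, e₂]
      exact ⟨fun h => ⟨h.left, h.right⟩, fun h => h.1.and_intro h.2⟩
  · rw [unique_iff] at hu hu' ⊢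
    intro Λ χ d d' a h h'
    have eta {Δ Γ : List S.Srt} (d : Subst S (Δ ++ Γ) Λ) :
        Subst.pair (fun _ v => d (Var.inl v)) (fun _ v => d (Var.inr v)) = d := Var.elim_eta d
    rw [← eta a, ← eta d, ← eta (fun _ v => d (Var.inr v)), key] at h
    rw [← eta a, ← eta d', ← eta (fun _ v => d' (Var.inr v)), key] at h'
    have eb := f.eq ((Provable.exs_intro _ h.1).subst_cut he.2)
      ((Provable.exs_intro _ h'.1).subst_cut he.2)
    have rf {Ξ : List S.Srt} (r : Subst S Ξ Λ) (A : S.Srt) (v : Var Ξ A) :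
        Provable T χ (.eq (r v) (r v)) := .refl _
    have ep := hu _ _ _ _ _ (h.1.replaces₂ (rf _) (Provable.pair_eq eb (rf _))) h'.1
    have eq := hu' _ _ _ _ _ (h.2.replaces₂ (rf _) (Provable.pair_eq (rf _) eb)) h'.2
    rw [← eta d, ← eta (fun _ v => d (Var.inr v)), ← eta d', ← eta (fun _ v => d' (Var.inr v))]
    exact Provable.pair_eq ep (Provable.pair_eq eq eb)
  · constructor
    · refine .of_generic fun Λ χ c a h => h.comp_elim fun Λ' χ' τ b ht h₁ h₂ => ?_
      refine (h₁.subst_cut he.1).exs_elim' fun Λ₁ χ₁ τ₁ p ht₁ hp => ?_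
      refine ((ht₁.two h₂).subst_cut he'.1).exs_elim' fun Λ₂ χ₂ τ₂ q ht₂ hq => ?_
      rw [Formula.subst_pair, Formula.subst_pair, Formula.subst_pair]
      rw [show (Subst.pair _ _ : Subst S _ _).comp τ₁ = _ from Subst.pair_subst _ _ _] at hp
      rw [show (Subst.pair _ _ : Subst S _ _).comp τ₂ = _ from Subst.pair_subst _ _ _] at hq
      have hp' := ht₂.two hp
      rw [show (Subst.pair _ _ : Subst S _ _).comp τ₂ = _ from Subst.pair_subst _ _ _] at hp'
      exact .exs_intro _ ((key _ _ _ _ _).2 ⟨hp', hq⟩)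
    · refine .of_generic fun Λ χ c a h => h.exs_elim' fun Λ' χ' τ d ht hd => ?_
      have eta {Δ Γ : List S.Srt} (d : Subst S (Δ ++ Γ) Λ') :
        Subst.pair (fun _ v => d (Var.inl v)) (fun _ v => d (Var.inr v)) = d := Var.elim_eta d
      rw [show (Subst.pair c a).comp τ = _ from Subst.pair_subst _ _ _, ← eta d,
        ← eta (fun _ v => d (Var.inr v)), key] at hd
      rw [Formula.subst_pair]
      exact .comp_intro ((Provable.exs_intro _ hd.1).subst_cut he.2)
        ((Provable.exs_intro _ hd.2).subst_cut he'.2)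

variable (T)

/-- The class of `T`-cartesian formulas. -/
def cartesian : Fragment T where
  mem φ := T.IsCartesianFormula φ
  id_mem h := h.idGraph
  comp_mem f f' h h' := h.compGraph f f' h'

end Theory

/-! ## The relational signature, the translation, the relational theory -/

/-- The relational signature: every function symbol `f : A₁ ⋯ Aₙ → B` is replaced by a relation
symbol `R_f ↣ A₁ ⋯ Aₙ B`. -/
@[reducible] def Signature.relational (S : Signature.{u}) : Signature.{u} where
  Srt := S.Srt
  Fn := PEmpty
  dom := PEmpty.elim
  cod := PEmpty.elim
  Rel := S.Rel ⊕ S.Fn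
  arity := Sum.elim S.arity (fun f => S.dom f ++ [S.cod f])

/-- The atomic formula `R_f (x₁, …, xₙ, y)`. -/
def Formula.graphRel {Γ : List S.Srt} (f : S.Fn) (x : ∀ ⦃A⦄, Var (S.dom f) A → Var Γ A)
    (y : Var Γ (S.cod f)) : Formula.{u, w} S.relational Γ :=
  .rel (S := S.relational) (Sum.inr f)
    (fun _ v => .var (Var.elim x (Var.single y) v))

namespace Term

/-- The context of the auxiliary variables `z_g`, one for each subterm `g` occurring in the
construction of a term, the first one being associated with the term itself. -/
def nodes {Γ : List S.Srt} : {B : S.Srt} → Term S Γ B → List S.Srt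
  | B, var _ => [B]
  | _, app f a => S.cod f :: Var.flat (S.dom f) (fun _ v => nodes (a v))

/-- The auxiliary variable associated with the term itself. -/
def root {Γ : List S.Srt} : {B : S.Srt} → (t : Term S Γ B) → Var t.nodes B
  | _, var _ => .zero
  | _, app _ _ => .zero

/-- The conjunction, over all the subterms `g` occurring in the construction of a term in the
variables `x⃗`, of the formulas `z_g = xᵢ` if `g` is the variable `xᵢ`, and
`R_f (z_{g₁}, …, z_{gₘ}, z_g)` if `g` is `f (g₁, …, gₘ)`. -/
def graph {Γ : List S.Srt} :
    {B : S.Srt} → (t : Term S Γ B) → Formula.{u, w} S.relational (t.nodes ++ Γ)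
  | _, var x => .eq (.var .zero) (.var (.succ x))
  | _, app f a =>
    .and
      (.conj (S.dom f) (fun _ v => (graph (a v)).rename
        (Var.elim
          (fun _ z => .succ (Var.inl (Var.inFlat (fun _ v => (a v).nodes) v z)))
          (fun _ x => .succ (Var.inr x)))))
      (.graphRel f
        (fun _ v => .succ (Var.inl (Var.inFlat (fun _ v => (a v).nodes) v (a v).root)))
        .zero)

end Term

namespace Formula

/-- The translation of formulas. An atomic formula in `x⃗` is replaced by the formula obtained by
quantifying existentially all the auxiliary variables `z_g` associated with the subterms `g` of its
terms, in the conjunction of the formulas which link these variables to each other and to `x⃗`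
and of the atomic formula in which the terms are replaced by their variables. -/
def translate : {Γ : List S.Srt} → Formula.{u, w} S Γ → Formula.{u, w} S.relational Γ
  | Γ, rel R a =>
    let N : List S.Srt := Var.flat (S.arity R) (fun _ v => (a v).nodes)
    exs (S := S.relational) N
      (and
        (conj (S.arity R) (fun _ v => (a v).graph.rename
          (Var.elim (fun _ z => Var.inl (Var.inFlat (fun _ v => (a v).nodes) v z))
            (fun _ x => Var.inr x))))
        (rel (S := S.relational) (Γ := N ++ Γ) (Sum.inl R)
          (fun _ v => .var (Var.inl (Var.inFlat (fun _ v => (a v).nodes) v (a v).root)))))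
  | _, eq s t =>
    exs (S := S.relational) (s.nodes ++ t.nodes)
      (and
        (and
          (s.graph.rename (Var.elim (fun _ z => Var.inl (Var.inl z)) (fun _ x => Var.inr x)))
          (t.graph.rename (Var.elim (fun _ z => Var.inl (Var.inr z)) (fun _ x => Var.inr x))))
        (eq (.var (Var.inl (Var.inl s.root))) (.var (Var.inl (Var.inr t.root)))))
  | _, top => top
  | _, and φ ψ => and (translate φ) (translate ψ)
  | _, ex A φ => ex (S := S.relational) A (translate φ)
  | _, bot => bot
  | _, disj I φ => disj I (fun i => translate (φ i))

end Formula

/-- The translation of sequents. -/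
def Sequent.translate (s : Sequent.{u, w} S) : Sequent.{u, w} S.relational where
  ctx := s.ctx
  lhs := s.lhs.translate
  rhs := s.rhs.translate

/-- The axiom `R_f (x⃗, y) ∧ R_f (x⃗, y') ⊢ y = y'`. -/
def Sequent.functionality (f : S.Fn) : Sequent.{u, w} S.relational where
  ctx := S.cod f :: S.cod f :: S.dom f
  lhs := .and (.graphRel f (fun _ v => .succ (.succ v)) .zero)
    (.graphRel f (fun _ v => .succ (.succ v)) (.succ .zero))
  rhs := .eq (.var .zero) (.var (.succ .zero))

/-- The axiom `⊤ ⊢ (∃ y) R_f (x⃗, y)`. -/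
def Sequent.totality (f : S.Fn) : Sequent.{u, w} S.relational where
  ctx := S.dom f
  lhs := .top
  rhs := .ex (S.cod f) (.graphRel f (fun _ v => .succ v) .zero)

/-- The relational theory associated with a signature. -/
def Signature.relationalTheory (S : Signature.{u}) : Theory.{u, w} S.relational :=
  Set.range Sequent.functionality ∪ Set.range Sequent.totality

/-- The relational theory associated with a theory. -/
def Theory.relational (T : Theory.{u, w} S) : Theory.{u, w} S.relational :=
  S.relationalTheory ∪ Sequent.translate '' T

namespace SynCat

open CategoryTheory

variable {T : Theory.{u, w} S}

/-- The translation of the objects of the syntactic category. -/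
def translate (X : SynCat T) : SynCat T.relational where
  ctx := X.ctx
  formula := X.formula.translate

/-- The functor is given by the translation of formulas: it sends every object `φ (x⃗)` to the
translation of `φ (x⃗)`, and the morphism represented by a provably functional formula `θ (x⃗, y⃗)`
to the morphism represented by the translation of `θ (x⃗, y⃗)`, which is provably functional. -/
def IsTranslation (F : SynCat T ⥤ SynCat T.relational) : Prop :=
  ∃ hobj : ∀ X, F.obj X = X.translate,
    ∀ (X Y : SynCat T) (θ : Formula.{u, w} S (Y.ctx ++ X.ctx))
      (h : T.Functional X.formula Y.formula θ),
      ∃ h' : T.relational.Functional X.translate.formula Y.translate.formula θ.translate,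
        F.map (homMk θ h) =
          eqToHom (hobj X) ≫ homMk (X := X.translate) (Y := Y.translate) θ.translate h' ≫
            eqToHom (hobj Y).symm

end SynCat

end GeometricLogic

namespace GeometricLogic

variable {S : Signature.{u}}

/-! ## Local reasoning in geometric logic -/

section

variable {T : Theory.{u, w} S} {Γ Δ Λ Λ' : List S.Srt}

/-! A signature without function symbols has only variables as terms, so a relational formula can be
read back in the original signature by replacing `R_f (x, y)` with `f (x) = y`. This reading,
`Formula.ofRelational`, commutes strictly with substitution, connectives and quantifiers, hence
sends proofs to proofs rule by rule (`Provable.ofRelational`). In the other direction one needs that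
translation preserves provability (`Theory.Proves.translate_provable`), and that the two round trips
are provable equivalences (`Formula.translate_ofRelational`,
`Theory.Proves.translate_ofRelational`). Together these give `Theory.provable_relational_iff`: the
relational theory proves a sequent exactly when the original theory proves its reading.
Functoriality, faithfulness, fullness and essential surjectivity are then formal: morphisms are read
back, and every relational formula is equivalent to the translation of its reading.

The work lies in the forward direction. Translation does not commute with substitution, because a
compound term has no counterpart among relational terms; it only has a value, specified by the
formula `Term.val`. Functionality of the `R_f` makes values unique (`Theory.IsVal.unique`). Totality
makes them exist (`Theory.Proves.exists_val`), but only locally, as existential witnesses in a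
larger context. Arguments are therefore in the style of Kripke–Joyal semantics: a stage is a
hypothesis `χ` in a context `Λ`, elements are tuples of terms over `Λ`, and `Theory.Transport` is a
change of stage. Atomic formulas translate to assertions about values
(`Theory.Proves.translate_rel`, `Theory.Proves.translate_eq`), whence the substitution lemma
`Theory.Proves.translate_subst` and soundness.

For the fragments, an atomic formula translates to an existential quantification of a Horn formula,
so regularity and coherence persist. In the cartesian case the auxiliary variables are moreover
provably unique, being values of terms; `Formula.IsPrenex` records such Horn formulas, and
`Theory.IsCartesianForm.exists_ofRelational` uses them to carry cartesian forms over. -/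

theorem Theory.Transport.refl (χ : Formula.{u, w} S Λ) :
    T.Transport χ χ (fun _ v => .var v) := fun ρ h => by
  rwa [Formula.subst_var]

theorem Theory.Transport.comp {Λ'' : List S.Srt} {χ : Formula.{u, w} S Λ}
    {χ' : Formula.{u, w} S Λ'} {χ'' : Formula.{u, w} S Λ''} {τ : Subst S Λ Λ'}
    {τ' : Subst S Λ' Λ''} (h : T.Transport χ χ' τ) (h' : T.Transport χ' χ'' τ') :
    T.Transport χ χ'' (Subst.comp τ τ') := fun ρ k => by
  have := h' _ (h _ k)
  rwa [Formula.subst_subst] at this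

theorem Theory.Transport.eq {χ : Formula.{u, w} S Λ} {χ' : Formula.{u, w} S Λ'}
    {τ : Subst S Λ Λ'} (h : T.Transport χ χ' τ) {A : S.Srt} {s t : Term S Λ A}
    (k : Provable T χ (.eq s t)) : Provable T χ' (.eq (s.subst τ) (t.subst τ)) :=
  h _ k

/-- The extension of a family of terms by one term. -/
def Subst.cons {B : S.Srt} (c : Term S Λ B) (a : Subst S Γ Λ) : Subst S (B :: Γ) Λ
  | _, .zero => c
  | _, .succ v => a v

theorem Subst.cons_comp {B : S.Srt} (c : Term S Λ B) (a : Subst S Γ Λ) (τ : Subst S Λ Λ') :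
    (Subst.cons c a).comp τ = Subst.cons (c.subst τ) (a.comp τ) := by
  funext A v
  cases v <;> rfl

theorem Subst.pair_eq_cons {B : S.Srt} (b : Subst S [B] Λ) (a : Subst S Γ Λ) :
    (Subst.pair b a : Subst S (B :: Γ) Λ) = Subst.cons (b .zero) a := by
  funext A v
  cases v <;> rfl

theorem Subst.comp_assoc {Θ Λ'' : List S.Srt} (a : Subst S Θ Λ) (τ : Subst S Λ Λ')
    (τ' : Subst S Λ' Λ'') : (a.comp τ).comp τ' = a.comp (τ.comp τ') := by
  funext A v
  exact Term.subst_subst _ _ _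

theorem Provable.cons_eq {B : S.Srt} {χ : Formula.{u, w} S Λ} {c c' : Term S Λ B}
    {a a' : Subst S Γ Λ} (hc : Provable T χ (.eq c c'))
    (ha : ∀ A (v : Var Γ A), Provable T χ (.eq (a v) (a' v))) (A : S.Srt) (v : Var (B :: Γ) A) :
    Provable T χ (.eq (Subst.cons c a v) (Subst.cons c' a' v)) := by
  cases v with
  | zero => exact hc
  | succ v => exact ha _ v

/-- The Kripke–Joyal clause for `∃`: a witness becomes available after a change of stage, and it
suffices to conclude there. This is the case of one variable of `Provable.exs_elim'`, with the
witness as an explicit head. -/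
theorem Provable.ex_elim' {A : S.Srt} {χ ψ : Formula.{u, w} S Λ}
    {θ : Formula.{u, w} S (A :: Γ)} {a : Subst S Γ Λ}
    (h : Provable T χ ((Formula.ex A θ).subst a))
    (k : ∀ (Λ' : List S.Srt) (χ' : Formula.{u, w} S Λ') (τ : Subst S Λ Λ') (b : Term S Λ' A),
      T.Transport χ χ' τ → Provable T χ' (θ.subst (Subst.cons b (a.comp τ))) →
      Provable T χ' (ψ.subst τ)) : Provable T χ ψ := by
  refine Provable.exs_elim' (Δ := [A]) (Γ := Γ) (θ := θ) h fun Λ' χ' τ b ht hb => ?_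
  refine k Λ' χ' τ (b .zero) ht ?_
  rwa [← Subst.pair_eq_cons]

theorem Provable.ex_intro' {A : S.Srt} {χ : Formula.{u, w} S Λ}
    {θ : Formula.{u, w} S (A :: Γ)} {a : Subst S Γ Λ} (b : Term S Λ A)
    (h : Provable T χ (θ.subst (Subst.cons b a))) :
    Provable T χ ((Formula.ex A θ).subst a) :=
  Provable.exs_intro (Δ := [A]) (Γ := Γ) (θ := θ) (Subst.cons b (fun _ v => nomatch v))
    (by rw [Subst.pair_eq_cons]; exact h)

/-- Distributivity lets each branch keep the ambient hypothesis `χ`, so that facts known under `χ`,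
such as the values of terms, remain usable. -/
theorem Provable.disj_elim' {I : Type w} {χ ψ : Formula.{u, w} S Λ}
    {φ : I → Formula.{u, w} S Λ} (h : Provable T χ (.disj I φ))
    (k : ∀ i, Provable T (.and χ (φ i)) ψ) : Provable T χ ψ :=
  ((Provable.id χ).and_intro h).cut ((distrib χ φ).cut (disj_elim k))

/-- A Yoneda argument: the implication is tested at the generic stage `φ`, with the identity
substitution. -/
theorem Provable.of_generic' {φ ψ : Formula.{u, w} S Γ}
    (h : ∀ (Λ : List S.Srt) (χ : Formula.{u, w} S Λ) (a : Subst S Γ Λ),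
      Provable T χ (φ.subst a) → Provable T χ (ψ.subst a)) : Provable T φ ψ := by
  have := h Γ φ (fun _ v => .var v)
  rw [Formula.subst_var, Formula.subst_var] at this
  exact this (.id φ)

theorem Subst.single_comp {B : S.Srt} (c : Term S Λ B) (τ : Subst S Λ Λ') :
    (fun _ v => ((Var.single c : Subst S [B] Λ) v).subst τ) =
      (Var.single (c.subst τ) : ∀ A, Var [B] A → Term S Λ' A) := by
  funext A v
  cases v with
  | zero => rfl
  | succ v => cases v

theorem Subst.pair_eta (a : Subst S (Δ ++ Γ) Λ) :
    Subst.pair (fun _ v => a (Var.inl v)) (fun _ v => a (Var.inr v)) = a :=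
  Var.elim_eta a

end

/-! ## The values of terms in the relational signature -/

/-- The formula `y = t (x⃗)`, expressed in the relational signature. -/
def Term.val {Γ : List S.Srt} : {B : S.Srt} → Term S Γ B → Formula.{u, w} S.relational (B :: Γ)
  | _, var x => .eq (.var .zero) (.var (.succ x))
  | _, app f s =>
    .exs (S := S.relational) (Γ := S.cod f :: Γ) (S.dom f) (.and
      (.conj (S.dom f) (fun _ v => (val (s v)).subst
        (Subst.cons (S := S.relational) (Γ := Γ) (.var (Var.inl v))
          (fun _ x => .var (Var.inr (.succ x))))))
      (.graphRel f (fun _ v => Var.inl v) (Var.inr .zero)))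

/-- Under the hypothesis `χ`, the value at `a` of the term `t` is `c`. -/
def Theory.IsVal (U : Theory.{u, w} S.relational) {Γ : List S.Srt} {Λ : List S.relational.Srt}
    {B : S.Srt} (χ : Formula.{u, w} S.relational Λ) (t : Term S Γ B) (a : Subst S.relational Γ Λ)
    (c : Term S.relational Λ B) : Prop :=
  Provable U χ (t.val.subst (Subst.cons (S := S.relational) (Γ := Γ) c a))

/-- The atomic formula expressing that `c` is the value of `f` at `z`. -/
def Formula.fnRel {Λ : List S.relational.Srt} (f : S.Fn) (z : Subst S.relational (S.dom f) Λ)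
    (c : Term S.relational Λ (S.cod f)) : Formula.{u, w} S.relational Λ :=
  .rel (S := S.relational) (Sum.inr f)
    (Subst.pair (S := S.relational) (Δ := S.dom f) (Γ := [S.cod f]) z (Var.single c))

theorem Formula.subst_fnRel {Λ Λ' : List S.relational.Srt} (f : S.Fn)
    (z : Subst S.relational (S.dom f) Λ)
    (c : Term S.relational Λ (S.cod f)) (τ : Subst S.relational Λ Λ') :
    (fnRel.{u, w} f z c).subst τ = fnRel f (z.comp τ) (c.subst τ) := by
  refine congrArg (rel (S := S.relational) (Sum.inr f)) ?_
  refine (Subst.pair_subst (S := S.relational) (Δ := S.dom f) (Γ := [S.cod f]) _ _ _).trans ?_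
  rw [Subst.single_comp]

theorem Formula.subst_graphRel {Γ : List S.Srt} {Λ : List S.relational.Srt} (f : S.Fn)
    (x : ∀ ⦃A⦄, Var (S.dom f) A → Var Γ A) (y : Var Γ (S.cod f)) (a : Subst S.relational Γ Λ) :
    (graphRel.{u, w} f x y).subst a = fnRel f (fun _ v => a (x v)) (a y) := by
  refine congrArg (rel (S := S.relational) (Sum.inr f)) ?_
  funext A v
  refine (Var.elim_comp x (Var.single y) (fun _ v => a v) v).trans ?_
  refine congrFun (congrFun (congrArg (Var.elim (fun _ v => a (x v))) ?_) A) v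
  funext A v
  cases v with
  | zero => rfl
  | succ v => cases v

section

variable {U : Theory.{u, w} S.relational} {Γ : List S.Srt} {Λ Λ' : List S.relational.Srt}
  {B : S.Srt} {χ ψ : Formula.{u, w} S.relational Λ} {a a' : Subst S.relational Γ Λ}
  {c c' : Term S.relational Λ B}

theorem provable_graphRel {f : S.Fn}
    {x : ∀ ⦃A⦄, Var (S.dom f) A → Var Γ A} {y : Var Γ (S.cod f)} :
    Provable U χ ((Formula.graphRel f x y).subst a) ↔
      Provable U χ (.fnRel f (fun _ v => a (x v)) (a y)) := by
  rw [← Formula.subst_graphRel (S := S) f x y a]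

namespace Theory

theorem isVal_var {x : Var Γ B} :
    U.IsVal χ (.var x) a c ↔ Provable U χ (.eq c (a x)) := Iff.rfl

theorem IsVal.transport {χ' : Formula.{u, w} S.relational Λ'} {τ : Subst S.relational Λ Λ'}
    {t : Term S Γ B} (h : U.IsVal χ t a c) (ht : U.Transport χ χ' τ) :
    U.IsVal χ' t (a.comp τ) (c.subst τ) := by
  have := ht.one h
  rwa [Subst.cons_comp] at this

theorem isVal_comp {Λ'' : List S.relational.Srt} {χ : Formula.{u, w} S.relational Λ''}
    {τ : Subst S.relational Λ Λ'} {τ' : Subst S.relational Λ' Λ''} {t : Term S Γ B}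
    {c : Term S.relational Λ'' B} :
    U.IsVal χ t ((a.comp τ).comp τ') c ↔ U.IsVal χ t (a.comp (Subst.comp τ τ')) c := by
  rw [Subst.comp_assoc (S := S.relational) a τ τ']

/-- Recognizes a transported goal as an assertion about values at the new stage, after an
elimination has changed the stage. -/
theorem isVal_formula_subst {χ' : Formula.{u, w} S.relational Λ'} {τ : Subst S.relational Λ Λ'}
    {t : Term S Γ B} :
    Provable U χ' ((t.val.subst (Subst.cons (S := S.relational) (Γ := Γ) c a)).subst τ) ↔
      U.IsVal χ' t (a.comp τ) (c.subst τ) := by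
  rw [Formula.subst_subst]
  exact iff_of_eq (congrArg (fun σ => Provable U χ' (t.val.subst σ))
    (Subst.cons_comp (S := S.relational) (Γ := Γ) c a τ))

/-- Evaluates the matrix under the quantifiers of `Term.val` at an application: `z` consists of
values of the arguments and `R_f` relates it to `c`. -/
theorem val_body {f : S.Fn} {s : Subst S (S.dom f) Γ} {z : Subst S.relational (S.dom f) Λ}
    {c : Term S.relational Λ (S.cod f)} :
    Provable U χ ((Formula.and
      (.conj (S := S.relational) (S.dom f) (fun _ v => Formula.subst (S := S.relational)
        (Γ := _ :: Γ) (Subst.cons (S := S.relational) (Γ := Γ) (.var (Var.inl v))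
          (fun _ x => .var (Var.inr (.succ x)))) (Term.val (s v))))
      (.graphRel f (fun _ v => Var.inl v) (Var.inr .zero))).subst
        (Subst.pair (S := S.relational) z (Subst.cons (S := S.relational) (Γ := Γ) c a))) ↔
    (∀ A (v : Var (S.dom f) A), U.IsVal χ (s v) a (z v)) ∧ Provable U χ (.fnRel f z c) := by
  have e₁ : ∀ A (v : Var (S.dom f) A), ((s v).val.subst
        (Subst.cons (S := S.relational) (Γ := Γ) (.var (Var.inl v))
          (fun _ x => .var (Var.inr (Γ := S.dom f) (Var.succ (B := S.cod f) x))))).subst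
        (Subst.pair (S := S.relational) z (Subst.cons (S := S.relational) (Γ := Γ) c a)) =
      (s v).val.subst (Subst.cons (S := S.relational) (Γ := Γ) (z v) a) := by
    intro A v
    rw [Formula.subst_subst]
    congr 1
    funext B w
    cases w with
    | zero => exact Var.elim_inl _ _ _
    | succ w => exact Var.elim_inr _ _ _
  have e₂ : (Formula.graphRel.{u, w} f (fun _ v => Var.inl v) (Var.inr .zero)).subst
        (Subst.pair (S := S.relational) z (Subst.cons (S := S.relational) (Γ := Γ) c a)) =
        .fnRel f z c := by
    refine (Formula.subst_graphRel (S := S) f _ _ _).trans ?_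
    congr 1
    · funext A v
      exact Var.elim_inl _ _ _
    · exact Var.elim_inr _ _ _
  rw [Formula.subst, Formula.subst_conj, e₂]
  constructor
  · intro h
    refine ⟨fun A v => ?_, h.right⟩
    have := Provable.conj_iff.1 h.left A v
    rwa [e₁] at this
  · intro h
    refine .and_intro (Provable.conj_iff.2 fun A v => ?_) h.2
    rw [e₁]
    exact h.1 A v

theorem isVal_app_intro {f : S.Fn} {s : Subst S (S.dom f) Γ} {z : Subst S.relational (S.dom f) Λ}
    {c : Term S.relational Λ (S.cod f)} (hz : ∀ A (v : Var (S.dom f) A), U.IsVal χ (s v) a (z v))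
    (hc : Provable U χ (.fnRel f z c)) : U.IsVal χ (.app f s) a c :=
  Provable.exs_intro (S := S.relational) (Γ := S.cod f :: Γ) z (val_body.2 ⟨hz, hc⟩)

/-- The values of the arguments are bound by quantifiers in `Term.val`, so they can be named only
after a change of stage. -/
theorem IsVal.app_elim {f : S.Fn} {s : Subst S (S.dom f) Γ} {c : Term S.relational Λ (S.cod f)}
    (h : U.IsVal χ (.app f s) a c)
    (k : ∀ (Λ' : List S.relational.Srt) (χ' : Formula.{u, w} S.relational Λ')
      (τ : Subst S.relational Λ Λ') (z : Subst S.relational (S.dom f) Λ'), U.Transport χ χ' τ →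
      (∀ A (v : Var (S.dom f) A), U.IsVal χ' (s v) (a.comp τ) (z v)) →
      Provable U χ' (.fnRel f z (c.subst τ)) → Provable U χ' (ψ.subst τ)) : Provable U χ ψ := by
  refine Provable.exs_elim' (S := S.relational) (Γ := S.cod f :: Γ) h fun Λ' χ' τ z ht hz => ?_
  rw [Subst.cons_comp] at hz
  exact k _ _ _ _ ht (val_body.1 hz).1 (val_body.1 hz).2

theorem IsVal.replace {t : Term S Γ B} (h : U.IsVal χ t a c)
    (ha : ∀ A (v : Var Γ A), Provable U χ (.eq (a v) (a' v))) (hc : Provable U χ (.eq c c')) :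
    U.IsVal χ t a' c' :=
  Provable.replaces (S := S.relational) (Provable.cons_eq (S := S.relational) hc ha) h

end Theory

/-- Replacement needs a formula in variables of which both sides are instances; here it is `R_f`
applied to distinct variables. -/
theorem Provable.fnRel_replace {f : S.Fn} {z z' : Subst S.relational (S.dom f) Λ}
    {c c' : Term S.relational Λ (S.cod f)} (h : Provable U χ (.fnRel f z c))
    (hz : ∀ A (v : Var (S.dom f) A), Provable U χ (.eq (z v) (z' v)))
    (hc : Provable U χ (.eq c c')) : Provable U χ (.fnRel f z' c') := by
  have e (z : Subst S.relational (S.dom f) Λ) (c : Term S.relational Λ (S.cod f)) :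
    (Formula.graphRel.{u, w} f (fun _ v => .succ v) .zero).subst
      (Subst.cons (S := S.relational) c z) = .fnRel f z c := by
    exact Formula.subst_graphRel (S := S) (Γ := S.cod f :: S.dom f) f (fun _ v => .succ v) .zero
      (Subst.cons (S := S.relational) c z)
  rw [← e] at h ⊢
  exact Provable.replaces (S := S.relational) (Provable.cons_eq (S := S.relational) hc hz) h

/-- A theory proves the axioms of another one. -/
def Theory.Proves {S : Signature.{u}} (U T : Theory.{u, w} S) : Prop :=
  ∀ s ∈ T, Provable U s.lhs s.rhs

theorem Theory.Proves.functional (hU : U.Proves S.relationalTheory) {f : S.Fn}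
    {z : Subst S.relational (S.dom f) Λ} {c c' : Term S.relational Λ (S.cod f)}
    (h : Provable U χ (.fnRel f z c)) (h' : Provable U χ (.fnRel f z c')) :
    Provable U χ (.eq c c') := by
  let σ : Subst S.relational (S.cod f :: S.cod f :: S.dom f) Λ :=
    Subst.cons (S := S.relational) c (Subst.cons (S := S.relational) c' z)
  have := (hU _ (Or.inl ⟨f, rfl⟩)).subst σ
  refine Provable.cut (.and_intro ?_ ?_) this
  · exact (provable_graphRel (S := S)).2 h
  · exact (provable_graphRel (S := S)).2 h'

theorem Theory.Proves.total (hU : U.Proves S.relationalTheory) {f : S.Fn}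
    (z : Subst S.relational (S.dom f) Λ)
    (k : ∀ (Λ' : List S.relational.Srt) (χ' : Formula.{u, w} S.relational Λ')
      (τ : Subst S.relational Λ Λ') (c : Term S.relational Λ' (S.cod f)), U.Transport χ χ' τ →
      Provable U χ' (.fnRel f (z.comp τ) c) → Provable U χ' (ψ.subst τ)) : Provable U χ ψ := by
  have := (hU _ (Or.inr ⟨f, rfl⟩)).subst z
  refine Provable.ex_elim' ((Provable.top_intro χ).cut this) fun Λ' χ' τ c ht hc => ?_
  have := (provable_graphRel (S := S)).1 hc
  exact k _ _ _ _ ht this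

/-- By induction on the term: at an application, the two families of values of the arguments agree,
and functionality of `R_f` identifies the results. -/
theorem Theory.IsVal.unique (hU : U.Proves S.relationalTheory) {t : Term S Γ B}
    (h : U.IsVal χ t a c) (h' : U.IsVal χ t a c') : Provable U χ (.eq c c') := by
  induction t generalizing Λ with
  | var x => exact Provable.eq_trans h (Provable.eq_symm h')
  -- The two families of arguments are named at successive stages, so the first is transported to
  -- the second stage before being compared. The induction therefore has to be uniform in `Λ`.
  | app f s ih =>
    refine h.app_elim fun Λ₁ χ₁ τ₁ z₁ ht₁ hz₁ hc₁ => ?_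
    refine (h'.transport ht₁).app_elim (ψ := .eq _ _) fun Λ₂ χ₂ τ₂ z₂ ht₂ hz₂ hc₂ => ?_
    have e := ht₂ _ hc₁
    rw [Formula.subst_fnRel] at e
    exact hU.functional (e.fnRel_replace
      (fun A v => ih v ((hz₁ A v).transport ht₂) (hz₂ A v)) (.refl _)) hc₂

/-- A property of families indexed by the variables of a context holds locally if its members
hold locally. -/
theorem Provable.locally_family {U : Theory.{u, w} S} {Λ : List S.Srt}
    {χ ψ : Formula.{u, w} S Λ} (Δ : List S.Srt) (X : ∀ {A}, Var Δ A → List S.Srt → Type*)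
    (P : ∀ {A} (v : Var Δ A) (Λ' : List S.Srt) (_ : Formula.{u, w} S Λ') (_ : Subst S Λ Λ'),
      X v Λ' → Prop)
    (act : ∀ {A} (v : Var Δ A) {Λ₁ Λ₂ : List S.Srt}, Subst S Λ₁ Λ₂ → X v Λ₁ → X v Λ₂)
    (hP : ∀ {A} (v : Var Δ A) {Λ₁ Λ₂ : List S.Srt} {χ₁ : Formula.{u, w} S Λ₁}
      {χ₂ : Formula.{u, w} S Λ₂} {τ₁ : Subst S Λ Λ₁} {τ : Subst S Λ₁ Λ₂} {x : X v Λ₁},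
      U.Transport χ₁ χ₂ τ → P v Λ₁ χ₁ τ₁ x → P v Λ₂ χ₂ (τ₁.comp τ) (act v τ x))
    (hloc : ∀ {A} (v : Var Δ A) {Λ₁ : List S.Srt} {χ₁ ψ₁ : Formula.{u, w} S Λ₁}
      {τ₁ : Subst S Λ Λ₁}, U.Transport χ χ₁ τ₁ →
      (∀ (Λ₂ : List S.Srt) (χ₂ : Formula.{u, w} S Λ₂) (τ : Subst S Λ₁ Λ₂) (x : X v Λ₂),
        U.Transport χ₁ χ₂ τ → P v Λ₂ χ₂ (τ₁.comp τ) x → Provable U χ₂ (ψ₁.subst τ)) →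
      Provable U χ₁ ψ₁)
    (k : ∀ (Λ' : List S.Srt) (χ' : Formula.{u, w} S Λ') (τ : Subst S Λ Λ'), U.Transport χ χ' τ →
      (∀ A (v : Var Δ A), ∃ x, P v Λ' χ' τ x) → Provable U χ' (ψ.subst τ)) : Provable U χ ψ := by
  induction Δ with
  | nil =>
    have := k Λ χ _ (.refl χ) (fun A v => nomatch v)
    rwa [Formula.subst_var] at this
  | cons B Δ ih =>
    -- Finiteness of the context is what allows a common stage: the tail is settled first, then the
    -- head over the resulting stage, and the data of the tail are transported along by `act`.
    refine ih (fun v => X (.succ v)) (fun v => P (.succ v)) (fun v => act (.succ v))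
      (fun v => hP (.succ v)) (fun v => hloc (.succ v)) fun Λ₁ χ₁ τ₁ ht₁ h₁ => ?_
    refine hloc .zero ht₁ fun Λ₂ χ₂ τ x ht hx => ?_
    rw [Formula.subst_subst]
    refine k Λ₂ χ₂ _ (ht₁.comp ht) fun A v => ?_
    cases v with
    | zero => exact ⟨x, hx⟩
    | succ v =>
      obtain ⟨y, hy⟩ := h₁ A v
      exact ⟨_, hP _ ht hy⟩

end

/-- The map out of a concatenation of contexts defined by maps out of its members. -/
def Var.flatElim {K : Type u} {X : K → Type*} : {Δ : List K} → (N : ∀ ⦃A⦄, Var Δ A → List K) →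
    (∀ ⦃A⦄ (v : Var Δ A) ⦃B⦄, Var (N v) B → X B) → ∀ ⦃B⦄, Var (Var.flat Δ N) B → X B
  | [], _, _, _, w => nomatch w
  | _ :: _, _, h, _, w => elim (h .zero) (flatElim _ (fun _ v => h (.succ v))) w

theorem Var.flatElim_inFlat {K : Type u} {X : K → Type*} {Δ : List K}
    (N : ∀ ⦃A⦄, Var Δ A → List K) (h : ∀ ⦃A⦄ (v : Var Δ A) ⦃B⦄, Var (N v) B → X B)
    {A B : K} (v : Var Δ A) (w : Var (N v) B) : flatElim N h (inFlat N v w) = h v w := by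
  induction v with
  | zero => exact elim_inl _ _ _
  | succ v ih => exact (elim_inr _ _ _).trans (ih _ (fun _ v => h (.succ v)) w)

theorem Provable.rel_replace {T : Theory.{u, w} S} {Λ : List S.Srt} {χ : Formula.{u, w} S Λ}
    {R : S.Rel} {a b : Subst S (S.arity R) Λ}
    (e : ∀ A (v : Var (S.arity R) A), Provable T χ (.eq (a v) (b v)))
    (h : Provable T χ (.rel R a)) : Provable T χ (.rel R b) :=
  Provable.replaces (φ := .rel R (fun _ v => .var v)) e h

/-! ### Existence of values, and values under substitution -/

section

variable {U : Theory.{u, w} S.relational} {Γ Δ : List S.Srt} {Λ Λ' : List S.relational.Srt}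
  {B : S.Srt} {χ ψ : Formula.{u, w} S.relational Λ} {a a' : Subst S.relational Γ Λ}
  {c c' : Term S.relational Λ B}

/-- Terms have values, locally. -/
theorem Theory.Proves.exists_val (hU : U.Proves S.relationalTheory) (t : Term S Γ B)
    (a : Subst S.relational Γ Λ)
    (k : ∀ (Λ' : List S.relational.Srt) (χ' : Formula.{u, w} S.relational Λ')
      (τ : Subst S.relational Λ Λ') (c : Term S.relational Λ' B), U.Transport χ χ' τ →
      U.IsVal χ' t (a.comp τ) c → Provable U χ' (ψ.subst τ)) : Provable U χ ψ := by
  induction t generalizing Λ with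
  | var x =>
    have := k Λ χ _ (a x) (.refl χ) (Theory.isVal_var.2
      (by rw [Subst.comp, Term.subst_var]; exact .refl _))
    rwa [Formula.subst_var] at this
  | app f s ih =>
    -- All the arguments receive values at one common stage; totality of `R_f` then supplies the
    -- value of the application.
    refine Provable.locally_family (S := S.relational) (S.dom f)
      (fun {A} _ Λ' => Term S.relational Λ' A)
      (fun v Λ' χ' τ c => U.IsVal χ' (s v) (a.comp τ) c) (fun v _ _ τ c => c.subst τ) ?_ ?_ ?_
    · intro A v Λ₁ Λ₂ χ₁ χ₂ τ₁ τ x ht hx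
      exact Theory.isVal_comp.1 (hx.transport ht)
    · intro A v Λ₁ χ₁ ψ₁ τ₁ ht h
      refine ih v (a.comp τ₁) fun Λ₂ χ₂ τ₂ c ht₂ hc => h Λ₂ χ₂ τ₂ c ht₂ ?_
      exact Theory.isVal_comp.1 hc
    · intro Λ₁ χ₁ τ₁ ht₁ h
      choose z hz using h
      refine hU.total z fun Λ₂ χ₂ τ₂ c ht₂ hc => ?_
      rw [Formula.subst_subst]
      refine k Λ₂ χ₂ _ c (ht₁.comp ht₂) (Theory.isVal_app_intro (fun A v => ?_) hc)
      exact Theory.isVal_comp.1 ((hz A v).transport ht₂)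

/-- Families of terms have values, locally. -/
theorem Theory.Proves.exists_vals (hU : U.Proves S.relationalTheory) (s : Subst S Δ Γ)
    (a : Subst S.relational Γ Λ)
    (k : ∀ (Λ' : List S.relational.Srt) (χ' : Formula.{u, w} S.relational Λ')
      (τ : Subst S.relational Λ Λ') (c : Subst S.relational Δ Λ'), U.Transport χ χ' τ →
      (∀ A (v : Var Δ A), U.IsVal χ' (s v) (a.comp τ) (c v)) → Provable U χ' (ψ.subst τ)) :
    Provable U χ ψ := by
  refine Provable.locally_family (S := S.relational) Δ
    (fun {A} _ Λ' => Term S.relational Λ' A)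
    (fun v Λ' χ' τ c => U.IsVal χ' (s v) (a.comp τ) c) (fun v _ _ τ c => c.subst τ) ?_ ?_ ?_
  · intro A v Λ₁ Λ₂ χ₁ χ₂ τ₁ τ x ht hx
    exact Theory.isVal_comp.1 (hx.transport ht)
  · intro A v Λ₁ χ₁ ψ₁ τ₁ ht h
    refine hU.exists_val (s v) (a.comp τ₁) fun Λ₂ χ₂ τ₂ c ht₂ hc => h Λ₂ χ₂ τ₂ c ht₂ ?_
    exact Theory.isVal_comp.1 hc
  · intro Λ₁ χ₁ τ₁ ht₁ h
    choose z hz using h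
    exact k Λ₁ χ₁ τ₁ z ht₁ hz

/-- The values of the terms obtained by substitution. -/
theorem Theory.isVal_subst {σ : Subst S Γ Δ} {b : Subst S.relational Δ Λ}
    (h : ∀ A (v : Var Γ A), U.IsVal χ (σ v) b (a v)) (hU : U.Proves S.relationalTheory)
    (t : Term S Γ B) : U.IsVal χ (t.subst σ) b c ↔ U.IsVal χ t a c := by
  induction t generalizing Λ with
  | var x =>
    rw [Theory.isVal_var]
    exact ⟨fun k => k.unique hU (h _ x), fun k =>
      (h _ x).replace (fun _ _ => .refl _) (Provable.eq_symm k)⟩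
  | app f s ih =>
    constructor
    · intro k
      refine IsVal.app_elim k fun Λ' χ' τ z ht hz hc => ?_
      have : U.IsVal χ' (Term.app f s) (a.comp τ) (c.subst τ) :=
        isVal_app_intro (fun A v => (ih v fun A v => (h A v).transport ht).1 (hz A v)) hc
      exact isVal_formula_subst.2 this
    · intro k
      refine IsVal.app_elim k fun Λ' χ' τ z ht hz hc => ?_
      have : U.IsVal χ' (Term.app f (fun _ v => (s v).subst σ)) (b.comp τ) (c.subst τ) :=
        isVal_app_intro (fun A v => (ih v fun A v => (h A v).transport ht).2 (hz A v)) hc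
      exact isVal_formula_subst.2 this

/-! ## The translation of atomic formulas -/

namespace Theory

/-- Under the hypothesis `χ`, the family `z` consists of the values at `a` of the subterms of the
term `t`. -/
def IsGraph (U : Theory.{u, w} S.relational) (χ : Formula.{u, w} S.relational Λ) (t : Term S Γ B)
    (z : Subst S.relational t.nodes Λ) (a : Subst S.relational Γ Λ) : Prop :=
  Provable U χ (t.graph.subst (Subst.pair (S := S.relational) (Γ := Γ) z a))

theorem IsGraph.transport {χ' : Formula.{u, w} S.relational Λ'} {τ : Subst S.relational Λ Λ'}
    {t : Term S Γ B} {z : Subst S.relational t.nodes Λ} (h : U.IsGraph χ t z a)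
    (ht : U.Transport χ χ' τ) : U.IsGraph χ' t (z.comp τ) (a.comp τ) :=
  ht.two h

theorem isGraph_comp {Λ'' : List S.relational.Srt} {χ : Formula.{u, w} S.relational Λ''}
    {τ : Subst S.relational Λ Λ'} {τ' : Subst S.relational Λ' Λ''} {t : Term S Γ B}
    {z : Subst S.relational t.nodes Λ''} :
    U.IsGraph χ t z ((a.comp τ).comp τ') ↔ U.IsGraph χ t z (a.comp (Subst.comp τ τ')) := by
  rw [Subst.comp_assoc (S := S.relational) a τ τ']

theorem isGraph_rename {Θ : List S.Srt} {t : Term S Γ B} {i : ∀ ⦃A⦄, Var t.nodes A → Var Θ A}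
    {j : ∀ ⦃A⦄, Var Γ A → Var Θ A} {σ : Subst S.relational Θ Λ} :
    Provable U χ ((Formula.rename (S := S.relational) (Γ := t.nodes ++ Γ) (Var.elim i j)
      t.graph).subst σ) ↔
      U.IsGraph χ t (fun _ z => σ (i z)) (fun _ x => σ (j x)) :=
  iff_of_eq (congrArg (Provable U χ)
    (Formula.rename_elim (S := S.relational) (Γ := Γ) t.graph i j σ))

/-- The recursive clause for graphs: the variables of each argument form a graph of that argument,
and `R_f` links their roots to the head variable. -/
theorem isGraph_app {f : S.Fn} {s : Subst S (S.dom f) Γ}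
    {z : Subst S.relational (Term.app f s).nodes Λ} :
    U.IsGraph χ (.app f s) z a ↔
      (∀ A (v : Var (S.dom f) A), U.IsGraph χ (s v)
        (fun _ w => z (.succ (Var.inFlat (fun _ v => (s v).nodes) v w))) a) ∧
      Provable U χ (.fnRel f
        (fun _ v => z (.succ (Var.inFlat (fun _ v => (s v).nodes) v (s v).root))) (z .zero)) := by
  have e₁ {B : S.Srt} (w : Var (Var.flat (S.dom f) (fun _ v => (s v).nodes)) B) :
      (Subst.pair (S := S.relational) (Γ := Γ) z a) (.succ (Var.inl w)) = z (.succ w) :=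
    Var.elim_inl z a (.succ w)
  have e₂ {B : S.Srt} (x : Var Γ B) :
      (Subst.pair (S := S.relational) (Γ := Γ) z a)
        (.succ (Var.inr (Γ := Var.flat (S.dom f) (fun _ v => (s v).nodes)) x)) = a x :=
    Var.elim_inr z a x
  rw [IsGraph, Term.graph, Formula.subst, Formula.subst_conj]
  have key : ∀ {A} (v : Var (S.dom f) A), _ := fun v => isGraph_rename (U := U) (χ := χ)
    (t := s v) (i := fun _ w => .succ (Var.inl (Var.inFlat (fun _ v => (s v).nodes) v w)))
    (j := fun _ x => .succ (Var.inr x)) (σ := (Subst.pair (S := S.relational) (Γ := Γ) z a))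
  have key' := provable_graphRel (U := U) (χ := χ) (f := f)
    (x := fun _ v => .succ (Var.inl (Var.inFlat (fun _ v => (s v).nodes) v (s v).root)))
    (y := .zero) (a := (Subst.pair (S := S.relational) (Γ := Γ) z a))
  simp only [e₁, e₂] at key key'
  constructor
  · intro h
    exact ⟨fun A v => (key v).1 (Provable.conj_iff.1 h.left A v), key'.1 h.right⟩
  · intro h
    exact .and_intro (Provable.conj_iff.2 fun A v => (key v).2 (h.1 A v)) (key'.2 h.2)

theorem isGraph_var {x : Var Γ B} {z : Subst S.relational [B] Λ} :
    U.IsGraph χ (.var x) z a ↔ Provable U χ (.eq (z .zero) (a x)) := Iff.rfl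

/-- Connects the translation as defined, with one variable for each subterm, to the recursive
`Term.val`, where only the variable of the whole term remains free. -/
theorem IsGraph.isVal {t : Term S Γ B} {z : Subst S.relational t.nodes Λ}
    (h : U.IsGraph χ t z a) : U.IsVal χ t a (z t.root) := by
  induction t with
  | var x => exact h
  | app f s ih =>
    have := isGraph_app.1 h
    exact isVal_app_intro (fun A v => ih v (this.1 A v)) this.2

/-- Families of terms have, locally, families of values of subterms, if their members do. -/
theorem exists_graphs_of (s : Subst S Δ Γ)
    (hs : ∀ {A} (v : Var Δ A) {Λ : List S.relational.Srt} {χ ψ : Formula.{u, w} S.relational Λ}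
      (a : Subst S.relational Γ Λ)
      (_ : ∀ (Λ' : List S.relational.Srt) (χ' : Formula.{u, w} S.relational Λ')
        (τ : Subst S.relational Λ Λ') (z : Subst S.relational (s v).nodes Λ'),
        U.Transport χ χ' τ → U.IsGraph χ' (s v) z (a.comp τ) → Provable U χ' (ψ.subst τ)),
      Provable U χ ψ)
    (a : Subst S.relational Γ Λ)
    (k : ∀ (Λ' : List S.relational.Srt) (χ' : Formula.{u, w} S.relational Λ')
      (τ : Subst S.relational Λ Λ')
      (z : Subst S.relational (Var.flat Δ (fun _ v => (s v).nodes)) Λ'), U.Transport χ χ' τ →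
      (∀ A (v : Var Δ A), U.IsGraph χ' (s v)
        (fun _ w => z (Var.inFlat (fun _ v => (s v).nodes) v w)) (a.comp τ)) →
      Provable U χ' (ψ.subst τ)) : Provable U χ ψ := by
  refine Provable.locally_family (S := S.relational) Δ
    (fun {A} v Λ' => Subst S.relational (s v).nodes Λ')
    (fun v Λ' χ' τ z => U.IsGraph χ' (s v) z (a.comp τ))
    (fun v _ _ τ z => Subst.comp (S := S.relational) z τ) ?_ ?_ ?_
  · intro A v Λ₁ Λ₂ χ₁ χ₂ τ₁ τ x ht hx
    exact isGraph_comp.1 (hx.transport ht)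
  · intro A v Λ₁ χ₁ ψ₁ τ₁ ht h
    refine hs v (a.comp τ₁) fun Λ₂ χ₂ τ₂ c ht₂ hc => h Λ₂ χ₂ τ₂ c ht₂ ?_
    exact isGraph_comp.1 hc
  · intro Λ₁ χ₁ τ₁ ht₁ h
    choose z hz using h
    refine k Λ₁ χ₁ τ₁ (Var.flatElim (fun _ v => (s v).nodes) z) ht₁ fun A v => ?_
    simp only [Var.flatElim_inFlat]
    exact hz A v

/-- Totality is applied at every node, from the leaves to the root. The passage to families is
isolated in `exists_graphs_of` because it is used here with the induction hypothesis as its input.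
-/
theorem Proves.exists_graph (hU : U.Proves S.relationalTheory) (t : Term S Γ B)
    (a : Subst S.relational Γ Λ)
    (k : ∀ (Λ' : List S.relational.Srt) (χ' : Formula.{u, w} S.relational Λ')
      (τ : Subst S.relational Λ Λ') (z : Subst S.relational t.nodes Λ'), U.Transport χ χ' τ →
      U.IsGraph χ' t z (a.comp τ) → Provable U χ' (ψ.subst τ)) : Provable U χ ψ := by
  induction t generalizing Λ with
  | var x =>
    have := k Λ χ _ (Subst.cons (S := S.relational) (a x) (fun _ v => nomatch v)) (.refl χ)
      (isGraph_var.2 (by rw [Subst.comp, Term.subst_var]; exact .refl _))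
    rwa [Formula.subst_var] at this
  | app f s ih =>
    refine exists_graphs_of s (fun v _ _ _ => ih v) a fun Λ₁ χ₁ τ₁ z ht₁ hz => ?_
    refine hU.total (fun _ v => z (Var.inFlat (fun _ v => (s v).nodes) v (s v).root))
      fun Λ₂ χ₂ τ₂ c ht₂ hc => ?_
    rw [Formula.subst_subst]
    refine k Λ₂ χ₂ _ (Subst.cons (S := S.relational) c (Subst.comp (S := S.relational) z τ₂))
      (ht₁.comp ht₂) (isGraph_app.2 ⟨fun A v => ?_, hc⟩)
    exact isGraph_comp.1 ((hz A v).transport ht₂)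

/-- Families of terms have, locally, families of values of subterms. -/
theorem Proves.exists_graphs (hU : U.Proves S.relationalTheory) (s : Subst S Δ Γ)
    (a : Subst S.relational Γ Λ)
    (k : ∀ (Λ' : List S.relational.Srt) (χ' : Formula.{u, w} S.relational Λ')
      (τ : Subst S.relational Λ Λ')
      (z : Subst S.relational (Var.flat Δ (fun _ v => (s v).nodes)) Λ'), U.Transport χ χ' τ →
      (∀ A (v : Var Δ A), U.IsGraph χ' (s v)
        (fun _ w => z (Var.inFlat (fun _ v => (s v).nodes) v w)) (a.comp τ)) →
      Provable U χ' (ψ.subst τ)) : Provable U χ ψ :=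
  exists_graphs_of s (fun v _ _ _ => hU.exists_graph (s v)) a k

theorem rel_body {R : S.Rel} {s : Subst S (S.arity R) Γ}
    {z : Subst S.relational (Var.flat (S.arity R) (fun _ v => (s v).nodes)) Λ} :
    Provable U χ ((Formula.and
        (.conj (S := S.relational) (S.arity R) (fun _ v => Formula.rename (S := S.relational)
          (Γ := (s v).nodes ++ Γ)
          (Var.elim (fun _ z => Var.inl (Var.inFlat (fun _ v => (s v).nodes) v z))
            (fun _ x => Var.inr x)) (s v).graph))
        (.rel (S := S.relational)
          (Γ := Var.flat (S.arity R) (fun _ v => (s v).nodes) ++ Γ) (Sum.inl R)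
          (fun _ v => .var (Var.inl (Var.inFlat (fun _ v => (s v).nodes) v (s v).root))))).subst
        (Subst.pair (S := S.relational) (Γ := Γ) z a)) ↔
      (∀ A (v : Var (S.arity R) A), U.IsGraph χ (s v)
        (fun _ w => z (Var.inFlat (fun _ v => (s v).nodes) v w)) a) ∧
      Provable U χ (.rel (S := S.relational) (Sum.inl R)
        (fun _ v => z (Var.inFlat (fun _ v => (s v).nodes) v (s v).root))) := by
  have key : ∀ {A} (v : Var (S.arity R) A), _ := fun v => isGraph_rename (U := U) (χ := χ)
    (t := s v) (i := fun _ w => Var.inl (Var.inFlat (fun _ v => (s v).nodes) v w))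
    (j := fun _ x => Var.inr x) (σ := (Subst.pair (S := S.relational) (Γ := Γ) z a))
  simp only [Subst.pair, Var.elim_inl, Var.elim_inr] at key
  rw [Formula.subst, Formula.subst_conj, Formula.subst]
  simp only [Term.subst, Subst.pair, Var.elim_inl]
  constructor
  · intro h
    exact ⟨fun A v => (key v).1 (Provable.conj_iff.1 h.left A v), h.right⟩
  · intro h
    exact .and_intro (Provable.conj_iff.2 fun A v => (key v).2 (h.1 A v)) h.2

/-- Any family `c` of values will do: the witnesses hidden in the translation are values of the same
terms, so they equal `c` by uniqueness; conversely such witnesses exist locally. -/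
theorem Proves.translate_rel (hU : U.Proves S.relationalTheory) {R : S.Rel}
    {s : Subst S (S.arity R) Γ} {c : Subst S.relational (S.arity R) Λ}
    (h : ∀ A (v : Var (S.arity R) A), U.IsVal χ (s v) a (c v)) :
    Provable U χ ((Formula.rel R s).translate.subst a) ↔
      Provable U χ (.rel (S := S.relational) (Sum.inl R) c) := by
  constructor
  · intro k
    refine Provable.exs_elim' (S := S.relational) k fun Λ' χ' τ z ht hz => ?_
    obtain ⟨h₁, h₂⟩ := rel_body.1 hz
    exact h₂.rel_replace fun A v => (h₁ A v).isVal.unique hU ((h A v).transport ht)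
  · intro k
    refine hU.exists_graphs s a fun Λ' χ' τ z ht hz => ?_
    rw [Formula.subst_subst]
    refine Provable.exs_intro (S := S.relational) z (rel_body.2 ⟨hz, ?_⟩)
    exact (ht _ k).rel_replace fun A v => ((h A v).transport ht).unique hU (hz A v).isVal

theorem eq_body {s t : Term S Γ B} {y : Subst S.relational s.nodes Λ}
    {z : Subst S.relational t.nodes Λ} :
    Provable U χ ((Formula.and
        (.and
          (Formula.rename (S := S.relational) (Γ := s.nodes ++ Γ) (Δ := (s.nodes ++ t.nodes) ++ Γ)
            (Var.elim (fun _ z => Var.inl (Var.inl z)) (fun _ x => Var.inr x)) s.graph)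
          (Formula.rename (S := S.relational) (Γ := t.nodes ++ Γ) (Δ := (s.nodes ++ t.nodes) ++ Γ)
            (Var.elim (fun _ z => Var.inl (Var.inr z)) (fun _ x => Var.inr x)) t.graph))
        (.eq (S := S.relational) (.var (Var.inl (Var.inl s.root)))
          (.var (Var.inl (Var.inr t.root))))).subst
        (Subst.pair (S := S.relational) (Γ := Γ) (Subst.pair (S := S.relational) y z) a)) ↔
      (U.IsGraph χ s y a ∧ U.IsGraph χ t z a) ∧ Provable U χ (.eq (y s.root) (z t.root)) := by
  have key₁ := isGraph_rename (U := U) (χ := χ) (t := s)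
    (i := fun _ w => Var.inl (Δ := Γ) (Var.inl (Δ := t.nodes) w)) (j := fun _ x => Var.inr x)
    (σ := (Subst.pair (S := S.relational) (Γ := Γ) (Subst.pair (S := S.relational) y z) a))
  have key₂ := isGraph_rename (U := U) (χ := χ) (t := t)
    (i := fun _ w => Var.inl (Δ := Γ) (Var.inr (Γ := s.nodes) w)) (j := fun _ x => Var.inr x)
    (σ := (Subst.pair (S := S.relational) (Γ := Γ) (Subst.pair (S := S.relational) y z) a))
  simp only [Subst.pair, Var.elim_inl, Var.elim_inr] at key₁ key₂
  rw [Formula.subst, Formula.subst, Formula.subst]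
  simp only [Term.subst, Subst.pair, Var.elim_inl, Var.elim_inr]
  constructor
  · intro h
    exact ⟨⟨key₁.1 h.left.left, key₂.1 h.left.right⟩, h.right⟩
  · intro h
    exact .and_intro (.and_intro (key₁.2 h.1.1) (key₂.2 h.1.2)) h.2

/-- The mechanism is that of `translate_rel`: uniqueness of values in one direction, existence of
graphs in the other. -/
theorem Proves.translate_eq (hU : U.Proves S.relationalTheory) {s t : Term S Γ B}
    (hs : U.IsVal χ s a c) (ht : U.IsVal χ t a c') :
    Provable U χ ((Formula.eq s t).translate.subst a) ↔ Provable U χ (.eq c c') := by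
  constructor
  · intro k
    refine Provable.exs_elim' (S := S.relational) k fun Λ' χ' τ z hτ hz => ?_
    rw [← Subst.pair_eta (S := S.relational) z] at hz
    obtain ⟨⟨h₁, h₂⟩, h₃⟩ := eq_body.1 hz
    exact ((hs.transport hτ).unique hU h₁.isVal).eq_trans
      (h₃.eq_trans (h₂.isVal.unique hU (ht.transport hτ)))
  · intro k
    refine hU.exists_graph s a fun Λ₁ χ₁ τ₁ y ht₁ hy => ?_
    refine hU.exists_graph t (a.comp τ₁) fun Λ₂ χ₂ τ₂ z ht₂ hz => ?_
    rw [Formula.subst_subst, Formula.subst_subst]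
    have hτ := ht₁.comp ht₂
    have hy' := isGraph_comp.1 (hy.transport ht₂)
    have hz' := isGraph_comp.1 hz
    refine Provable.exs_intro (S := S.relational) (Subst.pair (S := S.relational) _ z)
      (eq_body.2 ⟨⟨hy', hz'⟩, ?_⟩)
    exact (hy'.isVal.unique hU (hs.transport hτ)).eq_trans
      ((hτ.eq k).eq_trans ((ht.transport hτ).unique hU hz'.isVal))

end Theory

end

/-! ## The translation preserves provability -/

section

variable {U : Theory.{u, w} S.relational} {Γ Δ : List S.Srt} {Λ Λ' : List S.relational.Srt}
  {B : S.Srt} {χ ψ : Formula.{u, w} S.relational Λ}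

namespace Theory

theorem isVal_lift {σ : Subst S Γ Δ} {b : Subst S.relational Δ Λ} {a : Subst S.relational Γ Λ}
    (hU : U.Proves S.relationalTheory) (h : ∀ A (v : Var Γ A), U.IsVal χ (σ v) b (a v))
    {B : S.Srt} (c : Term S.relational Λ B) (A : S.Srt) (v : Var (B :: Γ) A) :
    U.IsVal χ (σ.lift B v) (Subst.cons (S := S.relational) (Γ := Δ) c b)
      (Subst.cons (S := S.relational) (Γ := Γ) c a v) := by
  cases v with
  | zero => exact .refl _
  | succ v =>
    refine (isVal_subst (a := b) (fun A v => ?_) hU (σ v)).2 (h A v)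
    exact .refl _

/-- The substitute for a strict commutation of translation with substitution, which is impossible
since `σ` may contain function symbols. Substituting `σ` amounts to evaluating the translation at
values of `σ`; on atomic formulas this is `isVal_subst`. -/
theorem Proves.translate_subst (hU : U.Proves S.relationalTheory) (φ : Formula.{u, w} S Γ)
    {σ : Subst S Γ Δ} {b : Subst S.relational Δ Λ} {a : Subst S.relational Γ Λ}
    (h : ∀ A (v : Var Γ A), U.IsVal χ (σ v) b (a v)) :
    Provable U χ ((φ.subst σ).translate.subst b) ↔ Provable U χ (φ.translate.subst a) := by
  induction φ generalizing Δ Λ with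
  | rel R s =>
    constructor
    · intro k
      refine hU.exists_vals s a fun Λ' χ' τ c ht hc => ?_
      rw [Formula.subst_subst]
      exact (hU.translate_rel hc).2 ((hU.translate_rel fun A v =>
        (isVal_subst (fun A v => (h A v).transport ht) hU (s v)).2 (hc A v)).1 (ht.one k))
    · intro k
      refine hU.exists_vals s a fun Λ' χ' τ c ht hc => ?_
      rw [Formula.subst_subst]
      exact (hU.translate_rel fun A v =>
        (isVal_subst (fun A v => (h A v).transport ht) hU (s v)).2 (hc A v)).2
          ((hU.translate_rel hc).1 (ht.one k))
  | eq s t =>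
    constructor
    · intro k
      refine hU.exists_val s a fun Λ₁ χ₁ τ₁ c ht₁ hc => ?_
      refine hU.exists_val t (a.comp τ₁) fun Λ₂ χ₂ τ₂ d ht₂ hd => ?_
      rw [Formula.subst_subst, Formula.subst_subst]
      have ht := ht₁.comp ht₂
      have hc := isVal_comp.1 (hc.transport ht₂)
      have hd := isVal_comp.1 hd
      exact (hU.translate_eq hc hd).2 ((hU.translate_eq
        ((isVal_subst (fun A v => (h A v).transport ht) hU s).2 hc)
        ((isVal_subst (fun A v => (h A v).transport ht) hU t).2 hd)).1 (ht.one k))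
    · intro k
      refine hU.exists_val s a fun Λ₁ χ₁ τ₁ c ht₁ hc => ?_
      refine hU.exists_val t (a.comp τ₁) fun Λ₂ χ₂ τ₂ d ht₂ hd => ?_
      rw [Formula.subst_subst, Formula.subst_subst]
      have ht := ht₁.comp ht₂
      have hc := isVal_comp.1 (hc.transport ht₂)
      have hd := isVal_comp.1 hd
      exact (hU.translate_eq
        ((isVal_subst (fun A v => (h A v).transport ht) hU s).2 hc)
        ((isVal_subst (fun A v => (h A v).transport ht) hU t).2 hd)).2
          ((hU.translate_eq hc hd).1 (ht.one k))
  | top => exact Iff.rfl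
  | and φ ψ ih₁ ih₂ =>
    exact ⟨fun k => .and_intro ((ih₁ h).1 k.left) ((ih₂ h).1 k.right),
      fun k => .and_intro ((ih₁ h).2 k.left) ((ih₂ h).2 k.right)⟩
  | ex A φ ih =>
    constructor
    · intro k
      refine Provable.ex_elim' (S := S.relational) k fun Λ' χ' τ c ht hc => ?_
      rw [Formula.subst_subst]
      exact Provable.ex_intro' (S := S.relational) c
        ((ih (isVal_lift hU (fun A v => (h A v).transport ht) c)).1 hc)
    · intro k
      refine Provable.ex_elim' (S := S.relational) k fun Λ' χ' τ c ht hc => ?_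
      rw [Formula.subst_subst]
      exact Provable.ex_intro' (S := S.relational) c
        ((ih (isVal_lift hU (fun A v => (h A v).transport ht) c)).2 hc)
  | bot => exact Iff.rfl
  | disj I φ ih =>
    constructor
    · intro k
      refine k.disj_elim' fun i => ?_
      refine Provable.cut ?_ (.disj_intro _ i)
      -- The hypothesis on values is still available in the branch because `disj_elim'` retains `χ`.
      refine (ih i fun A v => (Provable.and_left _ _).cut (h A v)).1 (.and_right _ _)
    · intro k
      refine k.disj_elim' fun i => ?_
      refine Provable.cut ?_ (.disj_intro _ i)
      refine (ih i fun A v => (Provable.and_left _ _).cut (h A v)).2 (.and_right _ _)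

/-- Variables are their own values. -/
theorem Proves.translate_rename (hU : U.Proves S.relationalTheory) (φ : Formula.{u, w} S Γ)
    {ρ : ∀ ⦃A⦄, Var Γ A → Var Δ A} {b : Subst S.relational Δ Λ} :
    Provable U χ ((φ.rename ρ).translate.subst b) ↔
      Provable U χ (φ.translate.subst (fun _ v => b (ρ v))) :=
  hU.translate_subst φ fun _ _ => .refl _

theorem Proves.translate_weaken (hU : U.Proves S.relationalTheory) (φ : Formula.{u, w} S Γ)
    {χ : Formula.{u, w} S.relational (B :: Γ)} :
    Provable U χ ((φ.rename (fun _ v => Var.succ (B := B) v)).translate) ↔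
      Provable U χ (φ.translate.rename (fun _ v => .succ v)) := by
  have := hU.translate_rename φ (χ := χ) (ρ := fun _ v => Var.succ (B := B) v)
    (b := fun _ v => .var v)
  rwa [Formula.subst_var] at this

/-- By induction on proofs; only the rules involving substitution, equality or weakening need an
argument. The target `U` is kept general because the cartesian case uses it for another presentation
of the relational theory and for the empty theory on the source side. -/
theorem Proves.translate_provable {T : Theory.{u, w} S} (hU : U.Proves S.relationalTheory)
    (hT : ∀ s ∈ T, Provable U s.lhs.translate s.rhs.translate) {φ ψ : Formula.{u, w} S Γ}
    (h : Provable T φ ψ) : Provable U φ.translate ψ.translate := by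
  induction h with
  | ax s hs => exact hT s hs
  | id φ => exact .id _
  | cut _ _ ih₁ ih₂ => exact ih₁.cut ih₂
  | subst σ _ ih =>
    -- Once values of `σ` have been named, both substituted translations become instances of the
    -- translated premise at those values.
    refine .of_generic' fun Λ χ a k => hU.exists_vals σ a fun Λ' χ' τ c ht hc => ?_
    rw [Formula.subst_subst]
    exact (hU.translate_subst _ hc).2
      (((hU.translate_subst _ hc).1 (ht.one k)).subst_cut ih)
  | eq_refl t =>
    refine .of_generic' fun Λ χ a k => hU.exists_val t a fun Λ' χ' τ c ht hc => ?_
    rw [Formula.subst_subst]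
    exact (hU.translate_eq hc hc).2 (.refl _)
  | @eq_subst Γ A s t φ =>
    refine .of_generic' fun Λ χ a k => hU.exists_val s a fun Λ₁ χ₁ τ₁ c ht₁ hc => ?_
    refine hU.exists_val t (a.comp τ₁) fun Λ₂ χ₂ τ₂ d ht₂ hd => ?_
    rw [Formula.subst_subst, Formula.subst_subst]
    have ht := ht₁.comp ht₂
    have hc := isVal_comp.1 (hc.transport ht₂)
    have hd := isVal_comp.1 hd
    have k := ht.one k
    -- The instantiation of the first variable by `r` has as values `e` at the head and the old
    -- variables elsewhere. The translated rule thus becomes the replacement of `c` by `d`.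
    have val {r : Term S Γ A} {e : Term S.relational Λ₂ A}
        (he : U.IsVal χ₂ r (a.comp (Subst.comp τ₁ τ₂)) e) (B : S.Srt) (v : Var (A :: Γ) B) :
        U.IsVal χ₂ (Subst.inst r v) (a.comp (Subst.comp τ₁ τ₂))
          (Subst.cons (S := S.relational) (Γ := Γ) e (a.comp (Subst.comp τ₁ τ₂)) v) := by
      cases v with
      | zero => exact he
      | succ v => exact .refl _
    refine (hU.translate_subst φ (val hd)).2 ?_
    refine Provable.replaces (S := S.relational) ?_ ((hU.translate_subst φ (val hc)).1 k.right)
    exact Provable.cons_eq (S := S.relational) ((hU.translate_eq hc hd).1 k.left)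
      fun _ _ => .refl _
  | top_intro φ => exact .top_intro _
  | and_left φ ψ => exact .and_left _ _
  | and_right φ ψ => exact .and_right _ _
  | and_intro _ _ ih₁ ih₂ => exact .and_intro ih₁ ih₂
  | bot_elim φ => exact .bot_elim _
  | disj_intro φ i => exact .disj_intro (fun i => (φ i).translate) i
  | disj_elim _ ih => exact .disj_elim ih
  | ex_elim _ ih => exact Provable.ex_elim (S := S.relational) ((hU.translate_weaken _).1 ih)
  | ex_intro _ ih => exact (hU.translate_weaken _).2 (Provable.ex_intro (S := S.relational) ih)
  | distrib φ ψ => exact .distrib _ _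
  | frobenius φ ψ =>
    -- The weakening of a translation and the translation of a weakening are only provably
    -- equivalent, so the quantifier is opened and reintroduced after the exchange.
    refine (Provable.frobenius (S := S.relational) _ _).cut ?_
    refine Provable.ex_elim (S := S.relational) ?_
    refine Provable.cut ?_ (Provable.ex_intro (S := S.relational) (.id _))
    exact .and_intro ((hU.translate_weaken _).2 (.and_left _ _)) (.and_right _ _)

end Theory

end

/-! ## The inverse translation -/

/-- The translation of terms of the relational signature, which are variables. -/
def Term.ofRelational {Γ : List S.relational.Srt} : {B : S.relational.Srt} →
    Term S.relational Γ B → Term S Γ B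
  | _, var v => .var v
  | _, app f _ => f.elim

/-- The translation of families of terms of the relational signature. -/
abbrev Subst.ofRelational {Γ Δ : List S.relational.Srt} (a : Subst S.relational Γ Δ) :
    Subst S Γ Δ :=
  fun _ v => (a v).ofRelational

/-- The translation of formulas of the relational signature: `R_f (x⃗, y)` is replaced by
`f (x⃗) = y`. -/
def Formula.ofRelational : {Γ : List S.relational.Srt} → Formula.{u, w} S.relational Γ →
    Formula.{u, w} S Γ
  | _, rel (.inl R) a => .rel R (Subst.ofRelational a)
  | _, rel (.inr f) a =>
    .eq (.app f (fun _ v => Term.ofRelational (a (Var.inl v))))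
      (Term.ofRelational (a (Var.inr .zero)))
  | _, eq s t => .eq s.ofRelational t.ofRelational
  | _, top => .top
  | _, and φ ψ => .and (ofRelational φ) (ofRelational ψ)
  | _, ex A φ => .ex (S := S) A (ofRelational φ)
  | _, bot => .bot
  | _, disj I φ => .disj I (fun i => ofRelational (φ i))

theorem Term.ofRelational_subst {Γ Δ : List S.relational.Srt} {B : S.relational.Srt}
    (σ : Subst S.relational Γ Δ) (t : Term S.relational Γ B) :
    (t.subst σ).ofRelational = t.ofRelational.subst (Subst.ofRelational σ) := by
  cases t with
  | var v => rfl
  | app f a => exact f.elim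

theorem Subst.ofRelational_lift {Γ Δ : List S.relational.Srt} (A : S.relational.Srt)
    (σ : Subst S.relational Γ Δ) :
    Subst.ofRelational (σ.lift A) = Subst.lift (S := S) A (Subst.ofRelational σ) := by
  funext B v
  cases v with
  | zero => rfl
  | succ v => exact Term.ofRelational_subst _ _

namespace Formula

/-- Here commutation is an equality: substitution only moves variables, and no auxiliary variables
are introduced. -/
theorem ofRelational_subst {Γ Δ : List S.relational.Srt} (σ : Subst S.relational Γ Δ)
    (φ : Formula.{u, w} S.relational Γ) :
    (φ.subst σ).ofRelational = φ.ofRelational.subst (Subst.ofRelational σ) := by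
  induction φ generalizing Δ with
  | rel R a =>
    cases R with
    | inl R =>
      refine congrArg (rel (S := S) R) ?_
      funext A v
      exact Term.ofRelational_subst _ _
    | inr f =>
      simp only [Formula.subst, ofRelational, Term.ofRelational_subst, Term.subst]
  | eq s t => simp only [Formula.subst, ofRelational, Term.ofRelational_subst]
  | top => rfl
  | and φ ψ ih₁ ih₂ => simp only [Formula.subst, ofRelational, ih₁, ih₂]
  | ex A φ ih => simp only [Formula.subst, ofRelational, ih, Subst.ofRelational_lift]
  | bot => rfl
  | disj I φ ih => simp only [Formula.subst, ofRelational, ih]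

theorem ofRelational_rename {Γ Δ : List S.relational.Srt} (ρ : ∀ ⦃A⦄, Var Γ A → Var Δ A)
    (φ : Formula.{u, w} S.relational Γ) :
    (φ.rename ρ).ofRelational = rename (S := S) ρ φ.ofRelational :=
  ofRelational_subst _ φ

theorem ofRelational_exs {Γ : List S.relational.Srt} (Δ : List S.relational.Srt)
    (φ : Formula.{u, w} S.relational (Δ ++ Γ)) :
    (exs Δ φ).ofRelational = exs (S := S) Δ φ.ofRelational := by
  induction Δ with
  | nil => rfl
  | cons B Δ ih => exact ih _

theorem ofRelational_conj {Γ : List S.relational.Srt} (Δ : List S.relational.Srt)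
    (φ : ∀ ⦃A⦄, Var Δ A → Formula.{u, w} S.relational Γ) :
    (conj Δ φ).ofRelational = conj (S := S) Δ (fun _ v => (φ v).ofRelational) := by
  induction Δ with
  | nil => rfl
  | cons B Δ ih => exact congrArg (Formula.and _) (ih _)

theorem ofRelational_eqs {Γ Δ : List S.relational.Srt} (a b : Subst S.relational Δ Γ) :
    (eqs.{u, w} a b).ofRelational = eqs (Subst.ofRelational a) (Subst.ofRelational b) :=
  ofRelational_conj _ _

end Formula

/-! ## The inverse translation preserves provability -/

theorem Subst.ofRelational_inst {Γ : List S.relational.Srt} {A : S.relational.Srt}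
    (t : Term S.relational Γ A) :
    Subst.ofRelational (Subst.inst t) = Subst.inst (S := S) t.ofRelational := by
  funext B v
  cases v <;> rfl

/-- Since the reading is strictly compatible with substitution, each rule is carried to the same
rule and only the axioms need to be checked. -/
theorem Provable.ofRelational {T : Theory.{u, w} S} {U : Theory.{u, w} S.relational}
    (hT : ∀ s ∈ U, Provable T s.lhs.ofRelational s.rhs.ofRelational) {Γ : List S.relational.Srt}
    {φ ψ : Formula.{u, w} S.relational Γ} (h : Provable U φ ψ) :
    Provable T φ.ofRelational ψ.ofRelational := by
  induction h with
  | ax s hs => exact hT s hs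
  | id φ => exact .id _
  | cut _ _ ih₁ ih₂ => exact ih₁.cut ih₂
  | subst σ _ ih =>
    rw [Formula.ofRelational_subst, Formula.ofRelational_subst]
    exact ih.subst _
  | eq_refl t => exact .eq_refl _
  | @eq_subst Γ A s t φ =>
    rw [Formula.ofRelational_subst, Formula.ofRelational, Formula.ofRelational_subst,
      Subst.ofRelational_inst, Subst.ofRelational_inst]
    exact .eq_subst _ _ _
  | top_intro φ => exact .top_intro _
  | and_left φ ψ => exact .and_left _ _
  | and_right φ ψ => exact .and_right _ _
  | and_intro _ _ ih₁ ih₂ => exact .and_intro ih₁ ih₂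
  | bot_elim φ => exact .bot_elim _
  | disj_intro φ i => exact .disj_intro (fun i => (φ i).ofRelational) i
  | disj_elim _ ih => exact .disj_elim ih
  | ex_elim _ ih =>
    rw [Formula.ofRelational_rename] at ih
    exact Provable.ex_elim (S := S) ih
  | ex_intro _ ih =>
    rw [Formula.ofRelational_rename]
    exact Provable.ex_intro (S := S) ih
  | distrib φ ψ => exact .distrib _ _
  | frobenius φ ψ =>
    rw [Formula.ofRelational, Formula.ofRelational, Formula.ofRelational, Formula.ofRelational,
      Formula.ofRelational_rename]
    exact Provable.frobenius (S := S) _ _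

/-! ### The round trip on formulas of the relational signature -/

section

variable {U : Theory.{u, w} S.relational} {Γ Λ : List S.relational.Srt}
  {χ : Formula.{u, w} S.relational Λ}

theorem Theory.isVal_ofRelational {B : S.relational.Srt} (t : Term S.relational Γ B)
    (a : Subst S.relational Γ Λ) : U.IsVal χ t.ofRelational a (t.subst a) := by
  cases t with
  | var v => exact .refl _
  | app f s => exact f.elim

theorem Formula.rel_inr_eq (f : S.Fn) (s : Subst S.relational (S.dom f ++ [S.cod f]) Λ) :
    Formula.rel.{u, w} (S := S.relational) (Sum.inr f) s =
      .fnRel f (fun _ v => s (Var.inl v)) (s (Var.inr .zero)) := by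
  refine congrArg (rel (S := S.relational) (Sum.inr f)) ?_
  refine (Subst.pair_eta (S := S.relational) s).symm.trans ?_
  refine congrArg (Subst.pair (S := S.relational) (fun _ v => s (Var.inl v))) ?_
  funext A v
  cases v with
  | zero => rfl
  | succ v => cases v

/-- The only case with content is `R_f (x, y)`, read as `f (x) = y` and translated as equality of
the value of `f (x)` with `y`; totality and functionality make the two equivalent. -/
theorem Theory.Proves.translate_ofRelational (hU : U.Proves S.relationalTheory)
    (φ : Formula.{u, w} S.relational Γ) {a : Subst S.relational Γ Λ} :
    Provable U χ (φ.ofRelational.translate.subst a) ↔ Provable U χ (φ.subst a) := by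
  induction φ generalizing Λ with
  | @rel Γ R s =>
    cases R with
    | inl R => exact hU.translate_rel fun A v => isVal_ofRelational _ _
    | inr f =>
      have e := Formula.rel_inr_eq.{u, w} (S := S) f (fun _ v => (s v).subst a)
      have h₂ := isVal_ofRelational (U := U) (χ := χ) (s (Var.inr .zero)) a
      constructor
      · intro k
        refine (iff_of_eq (congrArg (Provable U χ) e)).2 ?_
        -- Totality provides some value `c` of `f`, and the translated equation identifies `c` with
        -- the given last coordinate.
        refine hU.total (fun _ v => (s (Var.inl v)).subst a) fun Λ' χ' τ c ht hc => ?_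
        have hf : U.IsVal χ' (Term.app f (fun _ v => (s (Var.inl v)).ofRelational)) (a.comp τ) c :=
          isVal_app_intro (fun A v => (isVal_ofRelational _ _).transport ht) hc
        have := (hU.translate_eq hf (h₂.transport ht)).1 (ht.one k)
        rw [Formula.subst_fnRel]
        exact hc.fnRel_replace (fun _ _ => .refl _) this
      · intro k
        -- The last coordinate itself serves as the value of `f`, so the equation becomes
        -- reflexivity.
        refine (hU.translate_eq (isVal_app_intro (fun A v => isVal_ofRelational _ _) ?_) h₂).2
          (.refl _)
        exact (iff_of_eq (congrArg (Provable U χ) e)).1 k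
  | eq s t => exact hU.translate_eq (isVal_ofRelational _ _) (isVal_ofRelational _ _)
  | top => exact Iff.rfl
  | and φ ψ ih₁ ih₂ =>
    exact ⟨fun k => .and_intro (ih₁.1 k.left) (ih₂.1 k.right),
      fun k => .and_intro (ih₁.2 k.left) (ih₂.2 k.right)⟩
  | ex A φ ih =>
    constructor
    · intro k
      refine Provable.ex_elim' (S := S.relational) k fun Λ' χ' τ c ht hc => ?_
      rw [Formula.subst_subst]
      exact Provable.ex_intro' (S := S.relational) c (ih.1 hc)
    · intro k
      refine Provable.ex_elim' (S := S.relational) k fun Λ' χ' τ c ht hc => ?_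
      rw [Formula.subst_subst]
      exact Provable.ex_intro' (S := S.relational) c (ih.2 hc)
  | bot => exact Iff.rfl
  | disj I φ ih =>
    constructor
    · intro k
      refine k.disj_elim' fun i => Provable.cut ?_ (.disj_intro _ i)
      exact (ih i).1 (.and_right _ _)
    · intro k
      refine k.disj_elim' fun i => Provable.cut ?_ (.disj_intro _ i)
      exact (ih i).2 (.and_right _ _)

end

/-! ## Prenex translations of Horn formulas -/

theorem Var.append_cases {K : Type u} {Γ Δ : List K} {A : K} (w : Var (Γ ++ Δ) A) :
    (∃ v : Var Γ A, w = inl v) ∨ ∃ v : Var Δ A, w = inr v := by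
  induction Γ with
  | nil => exact .inr ⟨w, rfl⟩
  | cons B Γ ih =>
    cases w with
    | zero => exact .inl ⟨.zero, rfl⟩
    | succ w =>
      rcases ih w with ⟨v, rfl⟩ | ⟨v, rfl⟩
      · exact .inl ⟨.succ v, rfl⟩
      · exact .inr ⟨v, rfl⟩

theorem Var.flat_cases {K : Type u} {Δ : List K} (N : ∀ ⦃A⦄, Var Δ A → List K) {B : K}
    (w : Var (Var.flat Δ N) B) : ∃ (A : K) (v : Var Δ A) (w' : Var (N v) B), w = inFlat N v w' := by
  induction Δ with
  | nil => exact nomatch w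
  | cons C Δ ih =>
    rcases append_cases w with ⟨v, rfl⟩ | ⟨v, rfl⟩
    · exact ⟨C, .zero, v, rfl⟩
    · obtain ⟨A, v', w', rfl⟩ := ih _ v
      exact ⟨A, .succ v', w', rfl⟩

/-- The subterms of a term, as a family indexed by its nodes. -/
def Term.subterms {Γ : List S.Srt} : {B : S.Srt} → (t : Term S Γ B) → Subst S t.nodes Γ
  | _, var x => Subst.cons (.var x) (fun _ v => nomatch v)
  | _, app f s => Subst.cons (.app f s) (Var.flatElim _ (fun _ v => subterms (s v)))

theorem Term.subterms_root {Γ : List S.Srt} {B : S.Srt} (t : Term S Γ B) :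
    t.subterms t.root = t := by
  cases t <;> rfl

/-! ### Graphs of terms read in the original signature -/

section

variable {T : Theory.{u, w} S} {Γ Δ Λ : List S.Srt} {χ : Formula.{u, w} S Λ} {B : S.Srt}
  {a : Subst S Γ Λ}

/-- Congruence is not a primitive rule; it comes from replacement in the equation between `f`
applied to two disjoint families of variables, starting from reflexivity. -/
theorem Provable.app_congr {f : S.Fn} {s t : Subst S (S.dom f) Λ}
    (h : ∀ A (v : Var (S.dom f) A), Provable T χ (.eq (s v) (t v))) :
    Provable T χ (.eq (.app f s) (.app f t)) := by
  have e (r : Subst S (S.dom f) Λ) : (Formula.eq.{u, w} (.app f (fun _ v => .var (Var.inl v)))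
      (.app f (fun _ v => .var (Var.inr v)))).subst (Subst.pair s r) =
      .eq (.app f s) (.app f r) := by
    simp only [Formula.subst, Term.subst, Subst.pair, Var.elim_inl, Var.elim_inr]
  have := Provable.replaces₂ (b := s) (a := s) (fun _ _ => .refl _) h (by rw [e]; exact .refl _)
  rwa [e] at this

theorem Provable.subst_congr {a b : Subst S Γ Λ}
    (h : ∀ A (v : Var Γ A), Provable T χ (.eq (a v) (b v))) (t : Term S Γ B) :
    Provable T χ (.eq (t.subst a) (t.subst b)) := by
  induction t with
  | var v => exact h _ v
  | app f s ih => exact .app_congr fun A v => ih v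

theorem Formula.ofRelational_graphRel (f : S.Fn) (x : ∀ ⦃A⦄, Var (S.dom f) A → Var Γ A)
    (y : Var Γ (S.cod f)) : (graphRel.{u, w} f x y).ofRelational =
      .eq (.app f (fun _ v => .var (x v))) (.var y) := by
  simp only [graphRel, ofRelational, Var.elim_inl, Var.elim_inr, Var.single, Term.ofRelational]

theorem Provable.ofRelational_rename {Θ : List S.Srt} {N : List S.Srt}
    {φ : Formula.{u, w} S.relational (N ++ Γ)} {i : ∀ ⦃A⦄, Var N A → Var Θ A}
    {j : ∀ ⦃A⦄, Var Γ A → Var Θ A} {σ : Subst S Θ Λ} :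
    Provable T χ ((Formula.rename (S := S.relational) (Γ := N ++ Γ) (Δ := Θ) (Var.elim i j)
      φ).ofRelational.subst σ) ↔
      Provable T χ (φ.ofRelational.subst
        (Subst.pair (S := S) (fun _ z => σ (i z)) (fun _ x => σ (j x)))) :=
  iff_of_eq (congrArg (Provable T χ) ((congrArg (Formula.subst σ)
    (Formula.ofRelational_rename (S := S) (Var.elim i j) φ)).trans
      (Formula.rename_elim (S := S) φ.ofRelational i j σ)))

/-- The graph of a term defines the family of its subterms. -/
theorem Term.ofRelational_graph {t : Term S Γ B} {z : Subst S t.nodes Λ} :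
    Provable T χ ((Term.graph.{u, w} t).ofRelational.subst (Subst.pair (S := S) z a)) ↔
      ∀ A (w : Var t.nodes A), Provable T χ (.eq (z w) ((t.subterms w).subst a)) := by
  induction t with
  | var x =>
    constructor
    · intro h A w
      cases w with
      | zero => exact h
      | succ w => exact nomatch w
    · exact fun h => h _ .zero
  | app f s ih =>
    have e₁ {B : S.Srt} (w : Var (Var.flat (S.dom f) (fun _ v => (s v).nodes)) B) :
        (Subst.pair (S := S) (Γ := Γ) z a) (.succ (Var.inl w)) = z (.succ w) :=
      Var.elim_inl z a (.succ w)
    have e₂ {B : S.Srt} (x : Var Γ B) :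
        (Subst.pair (S := S) (Γ := Γ) z a)
          (.succ (Var.inr (Γ := Var.flat (S.dom f) (fun _ v => (s v).nodes)) x)) = a x :=
      Var.elim_inr z a x
    rw [Term.graph, Formula.ofRelational, Formula.ofRelational_conj, Formula.subst,
      Formula.subst_conj]
    have key : ∀ {A} (v : Var (S.dom f) A), _ := fun v =>
      Provable.ofRelational_rename (T := T) (χ := χ) (φ := (s v).graph)
      (i := fun _ w => .succ (Var.inl (Var.inFlat (fun _ v => (s v).nodes) v w)))
      (j := fun _ x => .succ (Var.inr x)) (σ := (Subst.pair (S := S) (Γ := Γ) z a))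
    simp only [e₁, e₂, ih] at key
    have key' : Formula.subst (Subst.pair (S := S) (Γ := Γ) z a)
        (Formula.ofRelational (Formula.graphRel.{u, w} (S := S) f (fun _ v => .succ (Var.inl
          (Var.inFlat (fun _ v => (s v).nodes) v (s v).root))) .zero)) =
        .eq (.app f fun _ v => z (.succ
          (Var.inFlat (fun _ v => (s v).nodes) v (s v).root))) (z .zero) := by
      refine (congrArg (Formula.subst _) (Formula.ofRelational_graphRel (S := S) f _ _)).trans ?_
      simp only [Formula.subst, Term.subst, e₁]
      rfl
    have key' := iff_of_eq (congrArg (Provable T χ) key')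
    constructor
    · intro h
      have h₁ := fun A v => (key v).1 (Provable.conj_iff.1 h.left A v)
      have h₂ := h.right
      intro A w
      cases w with
      | zero =>
        -- The head variable equals `f` applied to the root variables of the arguments, and these
        -- equal the arguments by `h₁`.
        refine Provable.eq_symm (Provable.eq_trans (Provable.app_congr fun A v => ?_)
          (key'.1 h₂))
        have := (h₁ A v _ (s v).root).eq_symm
        rwa [Term.subterms_root] at this
      | succ w =>
        -- A node other than the root is a node of exactly one of the listed occurrences of
        -- arguments.
        obtain ⟨A', v, w, rfl⟩ := Var.flat_cases _ w
        have := h₁ A' v _ w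
        simpa only [Term.subterms, Subst.cons, Var.flatElim_inFlat] using this
    · intro h
      have h₁ : ∀ {A'} (v : Var (S.dom f) A') A (w : Var (s v).nodes A), Provable T χ
          (.eq (z (.succ (Var.inFlat (fun _ v => (s v).nodes) v w)))
            (((s v).subterms w).subst a)) := by
        intro A' v A w
        have := h _ (.succ (Var.inFlat (fun _ v => (s v).nodes) v w))
        simpa only [Term.subterms, Subst.cons, Var.flatElim_inFlat] using this
      refine .and_intro (Provable.conj_iff.2 fun A v => (key v).2 (h₁ v)) ?_
      refine key'.2 (Provable.eq_trans (Provable.app_congr fun A v => ?_) (h _ .zero).eq_symm)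
      have := h₁ v _ (s v).root
      rwa [Term.subterms_root] at this

end

section

variable {Γ Δ Λ : List S.Srt}

/-- A Horn formula `η (z⃗, x⃗)` of the relational signature which means that the `z⃗` are the values
of the terms `s (x⃗)` and that `φ (x⃗)` holds. -/
structure Formula.IsPrenex (φ : Formula.{u, w} S Γ) {N : List S.Srt} (s : Subst S N Γ)
    (η : Formula.{u, w} S.relational (N ++ Γ)) : Prop where
  horn : η.IsHorn
  iff : ∀ {T : Theory.{u, w} S} {Λ : List S.Srt} {χ : Formula.{u, w} S Λ} {z : Subst S N Λ}
    {a : Subst S Γ Λ}, Provable T χ (η.ofRelational.subst (Subst.pair (S := S) z a)) ↔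
      (∀ A (w : Var N A), Provable T χ (.eq (z w) ((s w).subst a))) ∧ Provable T χ (φ.subst a)

theorem Term.isHorn_graph {B : S.Srt} (t : Term S Γ B) : (graph.{u, w} t).IsHorn := by
  induction t with
  | var x => trivial
  | app f s ih =>
    exact ⟨Formula.isHorn_conj (S := S.relational) _ _ fun A v => (ih v).subst _, trivial⟩

/-- The matrix of the translation is already Horn; the terms which its auxiliary variables name are
all the subterms of the arguments. -/
theorem Formula.exists_prenex_rel (R : S.Rel) (s : Subst S (S.arity R) Γ) :
    ∃ (N : List S.Srt) (r : Subst S N Γ) (η : Formula.{u, w} S.relational (N ++ Γ)),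
      (rel.{u, w} R s).IsPrenex r η ∧ (rel R s).translate = exs (S := S.relational) N η := by
  refine ⟨_, Var.flatElim _ (fun _ v => (s v).subterms), _, ?_, rfl⟩
  refine ⟨⟨?_, trivial⟩, ?_⟩
  · exact isHorn_conj (S := S.relational) _ _ fun A v => (s v).isHorn_graph.subst _
  · intro T Λ χ z a
    have key : ∀ {A} (v : Var (S.arity R) A), _ := fun v =>
      Provable.ofRelational_rename (T := T) (χ := χ) (φ := (s v).graph)
      (i := fun _ w => Var.inl (Var.inFlat (fun _ v => (s v).nodes) v w))
      (j := fun _ x => Var.inr x) (σ := (Subst.pair (S := S) (Γ := Γ) z a))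
    simp only [Subst.pair, Var.elim_inl, Var.elim_inr, Term.ofRelational_graph] at key
    rw [show (rel R s).subst a = rel R (fun _ v => (s v).subst a) from rfl, ofRelational,
      ofRelational_conj, Formula.subst, Formula.subst_conj, ofRelational, Formula.subst]
    simp only [Subst.ofRelational, Term.ofRelational, Term.subst, Subst.pair, Var.elim_inl]
    constructor
    · intro h
      have h₁ := fun A v => (key v).1 (Provable.conj_iff.1 h.left A v)
      refine ⟨fun A w => ?_, h.right.rel_replace fun A v => ?_⟩
      · obtain ⟨A', v, w, rfl⟩ := Var.flat_cases _ w
        rw [Var.flatElim_inFlat]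
        exact h₁ A' v _ w
      · have := h₁ A v _ (s v).root
        rwa [Term.subterms_root] at this
    · rintro ⟨h₁, h₂⟩
      have h₁ : ∀ {A'} (v : Var (S.arity R) A') A (w : Var (s v).nodes A), Provable T χ
          (.eq (z (Var.inFlat (fun _ v => (s v).nodes) v w)) (((s v).subterms w).subst a)) := by
        intro A' v A w
        have := h₁ _ (Var.inFlat (fun _ v => (s v).nodes) v w)
        rwa [Var.flatElim_inFlat] at this
      refine .and_intro (Provable.conj_iff.2 fun A v => (key v).2 (h₁ v))
        (Provable.rel_replace (fun A v => ?_) h₂)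
      have := (h₁ v _ (s v).root).eq_symm
      rwa [Term.subterms_root] at this

theorem Formula.exists_prenex_eq {B : S.Srt} (s t : Term S Γ B) :
    ∃ (N : List S.Srt) (r : Subst S N Γ) (η : Formula.{u, w} S.relational (N ++ Γ)),
      (eq.{u, w} s t).IsPrenex r η ∧ (eq s t).translate = exs (S := S.relational) N η := by
  refine ⟨_, Subst.pair s.subterms t.subterms, _, ?_, rfl⟩
  refine ⟨⟨⟨?_, ?_⟩, trivial⟩, ?_⟩
  · exact s.isHorn_graph.subst _
  · exact t.isHorn_graph.subst _
  · intro T Λ χ z a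
    obtain ⟨x, y, rfl⟩ : ∃ x y, z = Subst.pair (S := S) x y := ⟨_, _, (Subst.pair_eta z).symm⟩
    have key₁ := Provable.ofRelational_rename (T := T) (χ := χ) (φ := s.graph)
      (i := fun _ w => Var.inl (Δ := Γ) (Var.inl (Δ := t.nodes) w)) (j := fun _ x => Var.inr x)
      (σ := (Subst.pair (S := S) (Γ := Γ) (Subst.pair (S := S) x y) a))
    have key₂ := Provable.ofRelational_rename (T := T) (χ := χ) (φ := t.graph)
      (i := fun _ w => Var.inl (Δ := Γ) (Var.inr (Γ := s.nodes) w)) (j := fun _ x => Var.inr x)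
      (σ := (Subst.pair (S := S) (Γ := Γ) (Subst.pair (S := S) x y) a))
    simp only [Subst.pair, Var.elim_inl, Var.elim_inr, Term.ofRelational_graph] at key₁ key₂
    rw [ofRelational, ofRelational, ofRelational, Formula.subst, Formula.subst, Formula.subst]
    simp only [Term.ofRelational, Term.subst, Subst.pair, Var.elim_inl, Var.elim_inr]
    constructor
    · intro h
      have h₁ := key₁.1 h.left.left
      have h₂ := key₂.1 h.left.right
      refine ⟨fun A w => ?_, ?_⟩
      · rcases Var.append_cases w with ⟨v, rfl⟩ | ⟨v, rfl⟩
        · simpa only [Var.elim_inl] using h₁ _ v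
        · simpa only [Var.elim_inr] using h₂ _ v
      · have e₁ := h₁ _ s.root
        have e₂ := h₂ _ t.root
        rw [Term.subterms_root] at e₁ e₂
        exact e₁.eq_symm.eq_trans (h.right.eq_trans e₂)
    · rintro ⟨h, h'⟩
      have h₁ : ∀ A (w : Var s.nodes A), Provable T χ (.eq (x w) ((s.subterms w).subst a)) := by
        intro A w
        simpa only [Var.elim_inl] using h _ (Var.inl w)
      have h₂ : ∀ A (w : Var t.nodes A), Provable T χ (.eq (y w) ((t.subterms w).subst a)) := by
        intro A w
        simpa only [Var.elim_inr] using h _ (Var.inr w)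
      have e₁ := h₁ _ s.root
      have e₂ := h₂ _ t.root
      rw [Term.subterms_root] at e₁ e₂
      exact .and_intro (.and_intro (key₁.2 h₁) (key₂.2 h₂))
        (e₁.eq_trans (Provable.eq_trans h' e₂.eq_symm))

/-- The auxiliary variables of the two conjuncts are kept disjoint, so conjunction does not create
any new condition between them. -/
theorem Formula.IsPrenex.and {φ ψ : Formula.{u, w} S Γ} {N M : List S.Srt} {s : Subst S N Γ}
    {t : Subst S M Γ} {η : Formula.{u, w} S.relational (N ++ Γ)}
    {ζ : Formula.{u, w} S.relational (M ++ Γ)} (h : φ.IsPrenex s η) (k : ψ.IsPrenex t ζ) :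
    (Formula.and φ ψ).IsPrenex (Subst.pair s t) (.and
      (rename (S := S.relational) (Γ := N ++ Γ) (Δ := (N ++ M) ++ Γ)
        (Var.elim (fun _ z => Var.inl (Var.inl z)) (fun _ x => Var.inr x)) η)
      (rename (S := S.relational) (Γ := M ++ Γ) (Δ := (N ++ M) ++ Γ)
        (Var.elim (fun _ z => Var.inl (Var.inr z)) (fun _ x => Var.inr x)) ζ)) := by
  refine ⟨⟨h.horn.subst _, k.horn.subst _⟩, ?_⟩
  intro T Λ χ z a
  obtain ⟨x, y, rfl⟩ : ∃ x y, z = Subst.pair (S := S) x y := ⟨_, _, (Subst.pair_eta z).symm⟩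
  have key₁ := Provable.ofRelational_rename (T := T) (χ := χ) (φ := η)
    (i := fun _ w => Var.inl (Δ := Γ) (Var.inl (Δ := M) w)) (j := fun _ x => Var.inr x)
    (σ := (Subst.pair (S := S) (Γ := Γ) (Subst.pair (S := S) x y) a))
  have key₂ := Provable.ofRelational_rename (T := T) (χ := χ) (φ := ζ)
    (i := fun _ w => Var.inl (Δ := Γ) (Var.inr (Γ := N) w)) (j := fun _ x => Var.inr x)
    (σ := (Subst.pair (S := S) (Γ := Γ) (Subst.pair (S := S) x y) a))
  simp only [Subst.pair, Var.elim_inl, Var.elim_inr] at key₁ key₂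
  rw [h.iff] at key₁
  rw [k.iff] at key₂
  rw [ofRelational, Formula.subst]
  constructor
  · intro hz
    obtain ⟨h₁, h₁'⟩ := key₁.1 hz.left
    obtain ⟨h₂, h₂'⟩ := key₂.1 hz.right
    refine ⟨fun A w => ?_, h₁'.and_intro h₂'⟩
    rcases Var.append_cases w with ⟨v, rfl⟩ | ⟨v, rfl⟩
    · simpa only [Subst.pair, Var.elim_inl] using h₁ _ v
    · simpa only [Subst.pair, Var.elim_inr] using h₂ _ v
  · rintro ⟨hz, h'⟩
    refine .and_intro (key₁.2 ⟨fun A w => ?_, h'.left⟩) (key₂.2 ⟨fun A w => ?_, h'.right⟩)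
    · simpa only [Subst.pair, Var.elim_inl] using hz _ (Var.inl w)
    · simpa only [Subst.pair, Var.elim_inr] using hz _ (Var.inr w)

/-- The literal translation of a Horn conjunction has quantifiers inside its conjuncts. Gathering
them in front gives a Horn matrix, as required of cartesian forms. -/
theorem Formula.IsHorn.exists_prenex {φ : Formula.{u, w} S Γ} (h : φ.IsHorn) :
    ∃ (N : List S.Srt) (r : Subst S N Γ) (η : Formula.{u, w} S.relational (N ++ Γ)),
      φ.IsPrenex r η := by
  induction φ with
  | rel R s =>
    obtain ⟨N, r, η, h, -⟩ := exists_prenex_rel R s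
    exact ⟨N, r, η, h⟩
  | eq s t =>
    obtain ⟨N, r, η, h, -⟩ := exists_prenex_eq s t
    exact ⟨N, r, η, h⟩
  | top =>
    refine ⟨[], ?_, Formula.top, trivial, ?_⟩
    · exact fun _ v => nomatch v
    · exact fun {T Λ χ z a} =>
        ⟨fun h => ⟨fun A w => (nomatch w), .top_intro _⟩, fun _ => .top_intro _⟩
  | and φ ψ ih₁ ih₂ =>
    obtain ⟨_, _, _, h₁⟩ := ih₁ h.1
    obtain ⟨_, _, _, h₂⟩ := ih₂ h.2
    exact ⟨_, _, _, h₁.and h₂⟩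
  | ex A φ _ => exact h.elim
  | bot => exact h.elim
  | disj I φ _ => exact h.elim

variable {T : Theory.{u, w} S} {χ : Formula.{u, w} S Λ}

/-- In the original signature the auxiliary variables have explicit witnesses, namely the terms `s`.
-/
theorem Formula.IsPrenex.exs_iff {φ : Formula.{u, w} S Γ} {N : List S.Srt} {s : Subst S N Γ}
    {η : Formula.{u, w} S.relational (N ++ Γ)} (h : φ.IsPrenex s η) {a : Subst S Γ Λ} :
    Provable T χ ((exs (S := S.relational) N η).ofRelational.subst a) ↔
      Provable T χ (φ.subst a) := by
  rw [show (exs (S := S.relational) N η).ofRelational = _ from ofRelational_exs (S := S) N η]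
  constructor
  · intro k
    refine Provable.exs_elim' (S := S) k fun Λ' χ' τ z ht hz => ?_
    rw [subst_subst]
    exact (h.iff.1 hz).2
  · intro k
    exact Provable.exs_intro (S := S) (fun _ w => (s w).subst a)
      (h.iff.2 ⟨fun _ _ => .refl _, k⟩)

/-- This round trip is pure equational logic and holds over every theory, in particular the empty
one, which the cartesian case exploits. -/
theorem Formula.translate_ofRelational (φ : Formula.{u, w} S Γ) {a : Subst S Γ Λ} :
    Provable T χ (φ.translate.ofRelational.subst a) ↔ Provable T χ (φ.subst a) := by
  induction φ generalizing Λ with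
  | rel R s =>
    obtain ⟨N, r, η, h, e⟩ := exists_prenex_rel R s
    rw [e]
    exact h.exs_iff
  | eq s t =>
    obtain ⟨N, r, η, h, e⟩ := exists_prenex_eq s t
    rw [e]
    exact h.exs_iff
  | top => exact Iff.rfl
  | and φ ψ ih₁ ih₂ =>
    exact ⟨fun k => .and_intro (ih₁.1 k.left) (ih₂.1 k.right),
      fun k => .and_intro (ih₁.2 k.left) (ih₂.2 k.right)⟩
  | ex A φ ih =>
    constructor
    · intro k
      refine Provable.ex_elim' (S := S) k fun Λ' χ' τ c ht hc => ?_
      rw [Formula.subst_subst]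
      exact Provable.ex_intro' (S := S) c (ih.1 hc)
    · intro k
      refine Provable.ex_elim' (S := S) k fun Λ' χ' τ c ht hc => ?_
      rw [Formula.subst_subst]
      exact Provable.ex_intro' (S := S) c (ih.2 hc)
  | bot => exact Iff.rfl
  | disj I φ ih =>
    constructor
    · intro k
      refine k.disj_elim' fun i => Provable.cut ?_ (.disj_intro _ i)
      exact (ih i).1 (.and_right _ _)
    · intro k
      refine k.disj_elim' fun i => Provable.cut ?_ (.disj_intro _ i)
      exact (ih i).2 (.and_right _ _)

end

/-! ## Provability in the relational theory -/

section

variable {T : Theory.{u, w} S} {Γ Δ : List S.relational.Srt}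

theorem Theory.equiv_translate_ofRelational (T : Theory.{u, w} S) {Γ : List S.Srt}
    (φ : Formula.{u, w} S Γ) : T.Equiv φ.translate.ofRelational φ :=
  ⟨.of_generic' fun _ _ _ => (Formula.translate_ofRelational φ).1,
    .of_generic' fun _ _ _ => (Formula.translate_ofRelational φ).2⟩

theorem Theory.Equiv.symm {Γ : List S.Srt} {φ ψ : Formula.{u, w} S Γ} (h : T.Equiv φ ψ) :
    T.Equiv ψ φ := ⟨h.2, h.1⟩

theorem Theory.Equiv.trans {Γ : List S.Srt} {φ ψ ω : Formula.{u, w} S Γ} (h : T.Equiv φ ψ)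
    (k : T.Equiv ψ ω) : T.Equiv φ ω := ⟨h.1.cut k.1, k.2.cut h.2⟩

theorem Theory.Proves.equiv_ofRelational_translate {U : Theory.{u, w} S.relational}
    (hU : U.Proves S.relationalTheory) (ψ : Formula.{u, w} S.relational Γ) :
    U.Equiv ψ.ofRelational.translate ψ :=
  ⟨.of_generic' fun _ _ _ => (hU.translate_ofRelational ψ).1,
    .of_generic' fun _ _ _ => (hU.translate_ofRelational ψ).2⟩

/-- Translate the proof of the readings, then remove the round trips at both ends. -/
theorem Theory.Proves.of_ofRelational {U : Theory.{u, w} S.relational}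
    (hU : U.Proves S.relationalTheory)
    (hT : ∀ s ∈ T, Provable U s.lhs.translate s.rhs.translate)
    {φ ψ : Formula.{u, w} S.relational Γ} (h : Provable T φ.ofRelational ψ.ofRelational) :
    Provable U φ ψ :=
  (hU.equiv_ofRelational_translate φ).2.cut
    ((hU.translate_provable hT h).cut (hU.equiv_ofRelational_translate ψ).1)

theorem Theory.proves_relationalTheory (T : Theory.{u, w} S) :
    T.relational.Proves S.relationalTheory := fun s hs => .ax s (Or.inl hs)

theorem Theory.translate_mem_provable (T : Theory.{u, w} S) (s : Sequent.{u, w} S) (hs : s ∈ T) :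
    Provable T.relational s.lhs.translate s.rhs.translate :=
  .ax s.translate (Or.inr ⟨s, hs, rfl⟩)

theorem Theory.ofRelational_mem_provable (T : Theory.{u, w} S) (s : Sequent.{u, w} S.relational)
    (hs : s ∈ T.relational) : Provable T s.lhs.ofRelational s.rhs.ofRelational := by
  have e {Γ : List S.Srt} (f : S.Fn) (x : ∀ ⦃A⦄, Var (S.dom f) A → Var Γ A)
    (y : Var Γ (S.cod f)) {χ : Formula.{u, w} S Γ} :
    Provable T χ (Formula.graphRel f x y).ofRelational ↔
      Provable T χ (.eq (.app f (fun _ v => .var (x v))) (.var y)) :=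
    iff_of_eq (congrArg (Provable T χ) (Formula.ofRelational_graphRel f x y))
  rcases hs with (⟨f, rfl⟩ | ⟨f, rfl⟩) | ⟨s, hs, rfl⟩
  · exact ((e f _ _).1 (.and_left _ _)).eq_symm.eq_trans ((e f _ _).1 (.and_right _ _))
  · have := Provable.ex_intro' (T := T) (χ := .top) (a := fun _ v => .var v)
      (θ := .eq (.app f (fun _ v => .var (Var.succ v))) (.var .zero))
      (.app f (fun _ v => .var v)) (.refl _)
    rw [Formula.subst_var] at this
    refine this.cut (Provable.ex_elim ?_)
    exact ((e f _ _).2 (.id _)).cut (Provable.ex_intro (S := S) (.id _))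
  · exact (T.equiv_translate_ofRelational s.lhs).1.cut
      ((Provable.ax s hs).cut (T.equiv_translate_ofRelational s.rhs).2)

/-- The reading both preserves and reflects provability. Every later question about the relational
theory is moved to the original theory through this equivalence. -/
theorem Theory.provable_relational_iff {φ ψ : Formula.{u, w} S.relational Γ} :
    Provable T.relational φ ψ ↔ Provable T φ.ofRelational ψ.ofRelational :=
  ⟨fun h => h.ofRelational T.ofRelational_mem_provable,
    fun h => T.proves_relationalTheory.of_ofRelational T.translate_mem_provable h⟩

theorem Theory.equiv_relational_iff {φ ψ : Formula.{u, w} S.relational Γ} :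
    T.relational.Equiv φ ψ ↔ T.Equiv φ.ofRelational ψ.ofRelational :=
  and_congr provable_relational_iff provable_relational_iff

theorem Theory.unique_relational_iff {θ : Formula.{u, w} S.relational (Δ ++ Γ)} :
    T.relational.Unique θ ↔ T.Unique (Γ := Γ) (Δ := Δ) θ.ofRelational := by
  rw [Unique, provable_relational_iff, Formula.ofRelational, Formula.ofRelational_rename,
    Formula.ofRelational_rename, Formula.ofRelational_eqs]
  rfl

/-- Each of the three sequents defining functionality is built by operations with which the reading
commutes strictly. -/
theorem Theory.functional_relational_iff {φ : Formula.{u, w} S.relational Γ}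
    {ψ : Formula.{u, w} S.relational Δ} {θ : Formula.{u, w} S.relational (Δ ++ Γ)} :
    T.relational.Functional φ ψ θ ↔
      T.Functional (Γ := Γ) (Δ := Δ) φ.ofRelational ψ.ofRelational θ.ofRelational := by
  have h₁ := provable_relational_iff (T := T) (φ := θ) (ψ := .and
    (φ.rename (fun _ v => Var.inr v)) (ψ.rename (fun _ v => Var.inl v)))
  rw [Formula.ofRelational, Formula.ofRelational_rename, Formula.ofRelational_rename] at h₁
  have h₂ := provable_relational_iff (T := T) (φ := φ) (ψ := .exs Δ θ)
  rw [Formula.ofRelational_exs] at h₂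
  exact ⟨fun h => ⟨h₁.1 h.sub, h₂.1 h.total, unique_relational_iff.1 h.unique⟩,
    fun h => ⟨h₁.2 h.sub, h₂.2 h.total, unique_relational_iff.2 h.unique⟩⟩

end

/-! ### Functional formulas up to provable equivalence -/

section

variable {T : Theory.{u, w} S} {Γ Δ : List S.Srt}

theorem Theory.Functional.congr {φ φ' : Formula.{u, w} S Γ} {ψ ψ' : Formula.{u, w} S Δ}
    {θ θ' : Formula.{u, w} S (Δ ++ Γ)} (h : T.Functional φ ψ θ) (hφ : T.Equiv φ φ')
    (hψ : T.Equiv ψ ψ') (hθ : T.Equiv θ θ') : T.Functional φ' ψ' θ' := by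
  refine .mk' (fun Λ χ b a k => ?_) ?_ (fun Λ χ b b' a k k' => ?_)
  · have k := k.subst_cut hθ.2
    exact ⟨(h.src k).subst_cut hφ.1, (h.tgt k).subst_cut hψ.1⟩
  · refine hφ.2.cut (h.total.cut (Provable.exs_adj.2 (hθ.1.cut ?_)))
    exact Provable.exs_adj.1 (.id _)
  · exact h.eq (k.subst_cut hθ.2) (k'.subst_cut hθ.2)

theorem Formula.idGraph_mono {φ ψ : Formula.{u, w} S Γ} (h : Provable T φ ψ) :
    Provable T φ.idGraph ψ.idGraph :=
  .of_generic fun _ _ _ _ k => idGraph_iff.2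
    ⟨(idGraph_iff.1 k).1.subst_cut h, (idGraph_iff.1 k).2⟩

theorem Formula.idGraph_comp_idGraph (φ : Formula.{u, w} S Γ) :
    T.Equiv (compGraph φ.idGraph φ.idGraph) φ.idGraph := by
  refine ⟨.of_generic fun Λ χ b a k => k.comp_elim fun Λ' χ' τ c ht h₁ h₂ => ?_,
    .of_generic fun Λ χ b a k => ?_⟩
  · rw [subst_pair]
    obtain ⟨h₁, h₁'⟩ := idGraph_iff.1 h₁
    exact idGraph_iff.2 ⟨h₁, fun A v => ((idGraph_iff.1 h₂).2 A v).eq_trans (h₁' A v)⟩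
  · exact .comp_intro (idGraph_iff.2 ⟨(idGraph_iff.1 k).1, fun _ _ => .refl _⟩) k

theorem Theory.Functional.translate {φ : Formula.{u, w} S Γ} {ψ : Formula.{u, w} S Δ}
    {θ : Formula.{u, w} S (Δ ++ Γ)} (h : T.Functional φ ψ θ) :
    T.relational.Functional (Γ := Γ) (Δ := Δ) φ.translate ψ.translate θ.translate :=
  functional_relational_iff.2 (h.congr (T.equiv_translate_ofRelational φ).symm
    (T.equiv_translate_ofRelational ψ).symm (T.equiv_translate_ofRelational θ).symm)

theorem Theory.Equiv.translate {φ ψ : Formula.{u, w} S Γ} (h : T.Equiv φ ψ) :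
    T.relational.Equiv φ.translate ψ.translate :=
  equiv_relational_iff.2 ((T.equiv_translate_ofRelational φ).trans
    (h.trans (T.equiv_translate_ofRelational ψ).symm))

end

theorem Formula.ofRelational_idGraph {Γ : List S.relational.Srt}
    (φ : Formula.{u, w} S.relational Γ) :
    φ.idGraph.ofRelational = idGraph (S := S) φ.ofRelational := by
  rw [idGraph, ofRelational, ofRelational_rename, ofRelational_eqs]
  rfl

theorem Formula.ofRelational_compGraph {Γ Δ Θ : List S.relational.Srt}
    (θ : Formula.{u, w} S.relational (Δ ++ Γ)) (θ' : Formula.{u, w} S.relational (Θ ++ Δ)) :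
    (compGraph θ θ').ofRelational =
      compGraph (S := S) (Γ := Γ) (Δ := Δ) (Θ := Θ) θ.ofRelational θ'.ofRelational := by
  rw [compGraph, ofRelational_exs, ofRelational, ofRelational_rename, ofRelational_rename]
  rfl

/-! ## The equivalence of categories -/

namespace SynCat

open CategoryTheory

variable {T : Theory.{u, w} S}

/-- The functor given by the translation of formulas. -/
def translateFunctor (T : Theory.{u, w} S) : SynCat T ⥤ SynCat T.relational where
  obj := translate
  map {X Y} := Quotient.map (sa := graphSetoid X Y)
    (sb := graphSetoid X.translate Y.translate)
    (fun θ => ⟨θ.1.translate, θ.2.translate⟩) (fun _ _ h => Theory.Equiv.translate h)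
  map_id X := by
    refine Hom.mk_eq (T := T.relational) (X := X.translate) (Y := X.translate)
      (Theory.equiv_relational_iff.2 ?_)
    rw [Formula.ofRelational_idGraph]
    have h := T.equiv_translate_ofRelational X.formula
    exact (T.equiv_translate_ofRelational _).trans
      ⟨Formula.idGraph_mono h.2, Formula.idGraph_mono h.1⟩
  map_comp := by
    rintro X Y Z ⟨θ, h⟩ ⟨θ', h'⟩
    refine Hom.mk_eq (T := T.relational) (X := X.translate) (Y := Z.translate)
      (Theory.equiv_relational_iff.2 ?_)
    rw [Formula.ofRelational_compGraph]
    have k := T.equiv_translate_ofRelational θ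
    have k' := T.equiv_translate_ofRelational θ'
    exact (T.equiv_translate_ofRelational _).trans
      ⟨Formula.comp_mono k.2 k'.2, Formula.comp_mono k.1 k'.1⟩

/-- The functor has the prescribed objects by definition, so the transport morphisms are identities.
-/
theorem translateFunctor_isTranslation (T : Theory.{u, w} S) :
    IsTranslation (translateFunctor T) :=
  ⟨fun _ => rfl, fun _ _ _ h => ⟨h.translate,
    ((Category.id_comp _).trans (Category.comp_id _)).symm⟩⟩

theorem exists_homMk {X Y : SynCat T} (f : X ⟶ Y) : ∃ θ h, f = homMk θ h := by
  obtain ⟨θ, h⟩ := f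
  exact ⟨θ, h, rfl⟩

theorem translateFunctor_map_homMk {X Y : SynCat T} {θ : Formula.{u, w} S (Y.ctx ++ X.ctx)}
    (h : T.Functional X.formula Y.formula θ) : (translateFunctor T).map (homMk θ h) =
      homMk (X := X.translate) (Y := Y.translate) θ.translate h.translate := rfl

theorem homMk_eq_iff {X Y : SynCat T} {θ θ' : Formula.{u, w} S (Y.ctx ++ X.ctx)}
    {h : T.Functional X.formula Y.formula θ} {h' : T.Functional X.formula Y.formula θ'} :
    homMk θ h = homMk θ' h' ↔ T.Equiv θ θ' :=
  ⟨fun e => Quotient.exact e, Hom.mk_eq⟩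

/-- Provably equivalent formulas are isomorphic. -/
def isoOfEquiv {Γ : List S.Srt} {φ ψ : Formula.{u, w} S Γ} (h : T.Equiv φ ψ) :
    (⟨Γ, φ⟩ : SynCat T) ≅ ⟨Γ, ψ⟩ where
  hom := homMk (X := ⟨Γ, φ⟩) (Y := ⟨Γ, ψ⟩) φ.idGraph
    ((T.functional_id φ).congr ⟨.id _, .id _⟩ h ⟨.id _, .id _⟩)
  inv := homMk (X := ⟨Γ, ψ⟩) (Y := ⟨Γ, φ⟩) φ.idGraph
    ((T.functional_id φ).congr h ⟨.id _, .id _⟩ ⟨.id _, .id _⟩)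
  hom_inv_id := Hom.mk_eq (X := ⟨Γ, φ⟩) (Y := ⟨Γ, φ⟩) φ.idGraph_comp_idGraph
  inv_hom_id := Hom.mk_eq (X := ⟨Γ, ψ⟩) (Y := ⟨Γ, ψ⟩)
    (φ.idGraph_comp_idGraph.trans ⟨Formula.idGraph_mono h.1, Formula.idGraph_mono h.2⟩)

theorem functional_ofRelational {X Y : SynCat T}
    {θ : Formula.{u, w} S.relational (Y.ctx ++ X.ctx)}
    (h : T.relational.Functional X.translate.formula Y.translate.formula θ) :
    T.Functional X.formula Y.formula θ.ofRelational :=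
  (Theory.functional_relational_iff.1 h).congr (T.equiv_translate_ofRelational X.formula)
    (T.equiv_translate_ofRelational Y.formula) ⟨.id _, .id _⟩

/-- The preimage of a morphism is represented by the reading of its graph. Fullness follows, and in
a form precise enough to keep track of the fragment containing the representative. -/
theorem map_homMk_ofRelational {X Y : SynCat T}
    {θ : Formula.{u, w} S.relational (Y.ctx ++ X.ctx)}
    (h : T.relational.Functional X.translate.formula Y.translate.formula θ) :
    (translateFunctor T).map (homMk θ.ofRelational (functional_ofRelational h)) =
      homMk (X := X.translate) (Y := Y.translate) θ h :=
  homMk_eq_iff.2 (T.proves_relationalTheory.equiv_ofRelational_translate θ)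

instance : (translateFunctor T).Faithful where
  map_injective {X Y f g} e := by
    obtain ⟨θ, h, rfl⟩ := exists_homMk f
    obtain ⟨θ', h', rfl⟩ := exists_homMk g
    have := Theory.equiv_relational_iff.1 (homMk_eq_iff.1 e)
    exact homMk_eq_iff.2 ((T.equiv_translate_ofRelational θ).symm.trans
      (this.trans (T.equiv_translate_ofRelational θ')))

instance : (translateFunctor T).Full where
  map_surjective {X Y} f := by
    obtain ⟨θ, h, rfl⟩ := exists_homMk f
    exact ⟨_, map_homMk_ofRelational h⟩

instance : (translateFunctor T).EssSurj where
  mem_essImage Y := ⟨⟨Y.ctx, Y.formula.ofRelational⟩,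
    ⟨isoOfEquiv (T.proves_relationalTheory.equiv_ofRelational_translate Y.formula)⟩⟩

instance : (translateFunctor T).IsEquivalence where

end SynCat

/-! ### Restriction of the equivalence to fragments -/

namespace SynSub

open CategoryTheory

variable {T : Theory.{u, w} S}

/-- The restriction of the equivalence to classes of formulas which correspond to each other. -/
theorem exists_equivalence (P : Fragment T) (Q : Fragment T.relational)
    (hP : ∀ {Γ : List S.Srt} {φ : Formula.{u, w} S Γ}, P.mem φ → Q.mem φ.translate)
    (hQ : ∀ {Γ : List S.relational.Srt} {φ : Formula.{u, w} S.relational Γ},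
      Q.mem φ → P.mem φ.ofRelational) :
    ∃ G : SynSub P ⥤ SynSub Q, G ⋙ ι Q = ι P ⋙ SynCat.translateFunctor T ∧ G.IsEquivalence := by
  let G : SynSub P ⥤ SynSub Q :=
    { obj := fun X => ⟨X.obj.translate, hP X.mem⟩
      map := fun f => ⟨(SynCat.translateFunctor T).map f.1, by
        obtain ⟨_, θ, h, hm, rfl⟩ := f
        exact ⟨_, _, hP hm, SynCat.translateFunctor_map_homMk h⟩⟩
      map_id := fun X => Subtype.ext ((SynCat.translateFunctor T).map_id X.obj)
      map_comp := fun f g => Subtype.ext ((SynCat.translateFunctor T).map_comp f.1 g.1) }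
  refine ⟨G, rfl, { faithful := ⟨?_⟩, full := ⟨?_⟩, essSurj := ⟨?_⟩ }⟩
  · intro X Y f g e
    exact Subtype.ext ((SynCat.translateFunctor T).map_injective (congrArg Subtype.val e))
  · rintro X Y ⟨_, θ, h, hm, rfl⟩
    exact ⟨⟨_, _, _, hQ hm, rfl⟩, Subtype.ext (SynCat.map_homMk_ofRelational h)⟩
  · intro Y
    have e := T.proves_relationalTheory.equiv_ofRelational_translate Y.obj.formula
    -- The subcategories need not be full, so the isomorphism must be checked to lie in them. Both
    -- of its directions are represented by the identity graph of the translated reading, a member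
    -- of `Q`.
    have hm := Q.id_mem (hP (hQ Y.mem))
    exact ⟨⟨⟨Y.obj.ctx, Y.obj.formula.ofRelational⟩, hQ Y.mem⟩,
      ⟨{hom := ⟨(SynCat.isoOfEquiv e).hom, _, _, hm, rfl⟩
        inv := ⟨(SynCat.isoOfEquiv e).inv, _, _, hm, rfl⟩
        hom_inv_id := Subtype.ext (SynCat.isoOfEquiv e).hom_inv_id
        inv_hom_id := Subtype.ext (SynCat.isoOfEquiv e).inv_hom_id }⟩⟩

end SynSub

/-! ## Coherent, regular and cartesian theories -/

section

variable {Γ : List S.Srt}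

/-- The translation of an atomic formula adds only existential quantifiers over a Horn matrix. -/
theorem Formula.IsRegular.translate {φ : Formula.{u, w} S Γ} (h : φ.IsRegular) :
    φ.translate.IsRegular := by
  induction φ with
  | rel R s =>
    obtain ⟨N, r, η, h, e⟩ := exists_prenex_rel R s
    rw [e]
    exact h.horn.isRegular.exs
  | eq s t =>
    obtain ⟨N, r, η, h, e⟩ := exists_prenex_eq s t
    rw [e]
    exact h.horn.isRegular.exs
  | top => trivial
  | and φ ψ ih₁ ih₂ => exact ⟨ih₁ h.1, ih₂ h.2⟩
  | ex A φ ih => exact ih h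
  | bot => exact h.elim
  | disj I φ _ => exact h.elim

theorem Formula.IsCoherent.translate {φ : Formula.{u, w} S Γ} (h : φ.IsCoherent) :
    φ.translate.IsCoherent := by
  induction φ with
  | rel R s => exact (IsRegular.translate (φ := .rel R s) trivial).isCoherent
  | eq s t => exact (IsRegular.translate (φ := .eq s t) trivial).isCoherent
  | top => trivial
  | and φ ψ ih₁ ih₂ => exact ⟨ih₁ h.1, ih₂ h.2⟩
  | ex A φ ih => exact ih h
  | bot => trivial
  | disj I φ ih => exact ⟨h.1, fun i => ih i (h.2 i)⟩

end

section

variable {Γ : List S.relational.Srt} {φ : Formula.{u, w} S.relational Γ}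

theorem Formula.IsHorn.ofRelational (h : φ.IsHorn) : φ.ofRelational.IsHorn := by
  induction φ with
  | rel R s => cases R <;> trivial
  | and φ ψ ih₁ ih₂ => exact ⟨ih₁ h.1, ih₂ h.2⟩
  | ex A φ _ => exact h.elim
  | bot => exact h.elim
  | disj I φ _ => exact h.elim
  | _ => trivial

theorem Formula.IsRegular.ofRelational (h : φ.IsRegular) : φ.ofRelational.IsRegular := by
  induction φ with
  | rel R s => cases R <;> trivial
  | and φ ψ ih₁ ih₂ => exact ⟨ih₁ h.1, ih₂ h.2⟩
  | ex A φ ih => exact ih h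
  | bot => exact h.elim
  | disj I φ _ => exact h.elim
  | _ => trivial

theorem Formula.IsCoherent.ofRelational (h : φ.IsCoherent) : φ.ofRelational.IsCoherent := by
  induction φ with
  | rel R s => cases R <;> trivial
  | and φ ψ ih₁ ih₂ => exact ⟨ih₁ h.1, ih₂ h.2⟩
  | ex A φ ih => exact ih h
  | disj I φ ih => exact ⟨h.1, fun i => ih i (h.2 i)⟩
  | _ => trivial

end

/-! ### Transfer of the properties of theories and of cartesian forms -/

namespace Theory

variable {T : Theory.{u, w} S}

theorem IsRegular.relational (h : T.IsRegular) : T.relational.IsRegular := by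
  rintro s ((⟨f, rfl⟩ | ⟨f, rfl⟩) | ⟨s, hs, rfl⟩)
  · exact ⟨⟨trivial, trivial⟩, trivial⟩
  · exact ⟨trivial, trivial⟩
  · exact ⟨(h s hs).1.translate, (h s hs).2.translate⟩

theorem IsCoherent.relational (h : T.IsCoherent) : T.relational.IsCoherent := by
  rintro s ((⟨f, rfl⟩ | ⟨f, rfl⟩) | ⟨s, hs, rfl⟩)
  · exact ⟨⟨trivial, trivial⟩, trivial⟩
  · exact ⟨trivial, trivial⟩
  · exact ⟨(h s hs).1.translate, (h s hs).2.translate⟩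

/-- A formula in cartesian form is equivalent to the inverse translation of a formula in
cartesian form. -/
theorem IsCartesianForm.exists_ofRelational {Γ : List S.Srt} {φ : Formula.{u, w} S Γ}
    (h : T.IsCartesianForm φ) : ∃ φ' : Formula.{u, w} S.relational Γ,
      T.relational.IsCartesianForm φ' ∧ ∀ T' : Theory.{u, w} S, T'.Equiv φ'.ofRelational φ := by
  obtain ⟨Δ, η, hη, hu, rfl⟩ := h
  obtain ⟨N, r, ζ, hζ⟩ := hη.exists_prenex
  -- The prenex formula treats the variables of `Δ` as parameters. Regrouping the context moves them
  -- among the quantified variables, next to the auxiliary ones.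
  let p : ∀ ⦃A⦄, Var (Δ ++ Γ) A → Var ((N ++ Δ) ++ Γ) A :=
    Var.elim (fun _ v => Var.inl (Var.inr v)) (fun _ v => Var.inr v)
  let ξ : Formula.{u, w} S.relational ((N ++ Δ) ++ Γ) :=
    Formula.rename (S := S.relational) (Γ := N ++ (Δ ++ Γ)) (Δ := (N ++ Δ) ++ Γ)
      (Var.elim (fun _ v => Var.inl (Var.inl v)) p) ζ
  have key {T : Theory.{u, w} S} {Λ : List S.Srt} {χ : Formula.{u, w} S Λ} (z : Subst S N Λ)
      (b : Subst S Δ Λ) (a : Subst S Γ Λ) :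
      Provable T χ (ξ.ofRelational.subst (Subst.pair (S := S) (Subst.pair (S := S) z b) a)) ↔
        (∀ A (v : Var N A), Provable T χ (.eq (z v) ((r v).subst (Subst.pair b a)))) ∧
          Provable T χ (η.subst (Subst.pair b a)) := by
    rw [← hζ.iff]
    refine (Provable.ofRelational_rename (T := T) (χ := χ) (φ := ζ)).trans ?_
    have e : (fun A (v : Var (Δ ++ Γ) A) => Subst.pair (S := S) (Subst.pair (S := S) z b) a (p v)) =
        Subst.pair (S := S) b a := by
      funext A v
      refine (Var.elim_comp _ _ (fun _ v =>
        Subst.pair (S := S) (Subst.pair (S := S) z b) a v) v).trans ?_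
      simp only [Subst.pair, Var.elim_inl, Var.elim_inr]
    rw [e]
    simp only [Subst.pair, Var.elim_inl]
  refine ⟨.exs (N ++ Δ) ξ, ⟨N ++ Δ, ξ, hζ.horn.subst _, ?_, rfl⟩, fun T' => ?_⟩
  · rw [unique_relational_iff, unique_iff]
    rw [unique_iff] at hu
    intro Λ χ d d' a h h'
    obtain ⟨z, b, rfl⟩ : ∃ z b, d = Subst.pair (S := S) z b := ⟨_, _, (Subst.pair_eta d).symm⟩
    obtain ⟨z', b', rfl⟩ : ∃ z b, d' = Subst.pair (S := S) z b := ⟨_, _, (Subst.pair_eta d').symm⟩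
    rw [key] at h h'
    -- The variables of `Δ` are unique by hypothesis, and those of `N` are then unique as values of
    -- fixed terms at equal arguments.
    have e := hu _ _ _ _ _ h.2 h'.2
    refine Provable.pair_eq (fun A v => ?_) e
    refine (h.1 A v).eq_trans (Provable.eq_trans ?_ (h'.1 A v).eq_symm)
    exact Provable.subst_congr (Provable.pair_eq e fun _ _ => .refl _) (r v)
  · rw [show (Formula.exs (S := S.relational) (N ++ Δ) ξ).ofRelational = _ from
      Formula.ofRelational_exs (S := S) _ ξ]
    constructor
    · refine .of_generic' fun Λ χ a h => h.exs_elim' (S := S) fun Λ' χ' τ d ht hd => ?_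
      rw [Formula.subst_subst]
      rw [← Subst.pair_eta (S := S) d, key] at hd
      exact Provable.exs_intro _ hd.2
    · refine .of_generic' fun Λ χ a h => h.exs_elim' fun Λ' χ' τ b ht hb => ?_
      rw [Formula.subst_subst]
      -- The auxiliary variables are witnessed by the terms `r` themselves, so no axiom is used and
      -- the equivalence holds in every `T'`.
      exact Provable.exs_intro (S := S) (Subst.pair (S := S)
        (fun _ v => (r v).subst (Subst.pair b (a.comp τ))) b)
        ((key _ _ _).2 ⟨fun _ _ => .refl _, hb⟩)

theorem IsCartesianForm.ofRelational {Γ : List S.relational.Srt}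
    {φ : Formula.{u, w} S.relational Γ} (h : T.relational.IsCartesianForm φ) :
    T.IsCartesianForm (Γ := Γ) φ.ofRelational := by
  obtain ⟨Δ, η, hη, hu, rfl⟩ := h
  exact ⟨Δ, η.ofRelational, hη.ofRelational, unique_relational_iff.1 hu,
    Formula.ofRelational_exs _ _⟩

theorem IsCartesianFormula.translate {Γ : List S.Srt} {φ : Formula.{u, w} S Γ}
    (h : T.IsCartesianFormula φ) : T.relational.IsCartesianFormula (Γ := Γ) φ.translate := by
  obtain ⟨hr, ψ, hψ, he⟩ := h
  obtain ⟨ψ', hψ', he'⟩ := hψ.exists_ofRelational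
  exact ⟨hr.translate, ψ', hψ', equiv_relational_iff.2
    ((T.equiv_translate_ofRelational φ).trans (he.trans (he' T).symm))⟩

theorem IsCartesianFormula.ofRelational {Γ : List S.relational.Srt}
    {φ : Formula.{u, w} S.relational Γ} (h : T.relational.IsCartesianFormula φ) :
    T.IsCartesianFormula (Γ := Γ) φ.ofRelational := by
  obtain ⟨hr, ψ, hψ, he⟩ := h
  exact ⟨hr.ofRelational, ψ.ofRelational, hψ.ofRelational, equiv_relational_iff.1 he⟩

theorem isCartesianForm_of_isHorn {Γ : List S.Srt} {φ : Formula.{u, w} S Γ} (h : φ.IsHorn) :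
    T.IsCartesianForm φ :=
  by
  refine ⟨[], φ, h, unique_iff.2 fun _ _ _ _ _ _ _ _ v => ?_, rfl⟩
  exact nomatch v

/-- The new presentation consists of all sequents between cartesian forms which the relational
theory proves. It is sound by construction; completeness amounts to recovering the axioms on the
`R_f` and the translations of a cartesian presentation `T₀`. -/
theorem IsCartesian.relational (h : T.IsCartesian) : T.relational.IsCartesian := by
  obtain ⟨T₀, hT₀, hc⟩ := h
  let U : Theory.{u, w} S.relational := {s | (T.relational.IsCartesianForm s.lhs ∧
    T.relational.IsCartesianForm s.rhs) ∧ Provable T.relational s.lhs s.rhs}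
  have hU : U.Proves S.relationalTheory := by
    intro s hs
    refine .ax s ⟨?_, T.proves_relationalTheory s hs⟩
    rcases hs with ⟨f, rfl⟩ | ⟨f, rfl⟩
    · exact ⟨isCartesianForm_of_isHorn ⟨trivial, trivial⟩, isCartesianForm_of_isHorn trivial⟩
    -- Totality has a cartesian right-hand side because functionality of `R_f` makes the quantified
    -- variable unique.
    · refine ⟨isCartesianForm_of_isHorn trivial, [S.cod f],
        Formula.graphRel f (fun _ v => .succ v) .zero, trivial, ?_, rfl⟩
      refine unique_iff.2 fun Λ χ b b' a h h' A v => ?_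
      cases v with
      | zero =>
        have h := (provable_graphRel (S := S)).1 h
        have h' := (provable_graphRel (S := S)).1 h'
        exact T.proves_relationalTheory.functional h h'
      | succ v => exact nomatch v
  have hU₀ : ∀ s ∈ T₀, Provable U s.lhs.translate s.rhs.translate := by
    intro s hs
    obtain ⟨φ, hφ, eφ⟩ := (hc s hs).1.exists_ofRelational
    obtain ⟨ψ, hψ, eψ⟩ := (hc s hs).2.exists_ofRelational
    -- Sequents whose readings hold in pure logic need only the axioms on the `R_f`, which `U`
    -- already proves. This permits replacing the translated sides of an axiom by cartesian forms
    -- inside `U`, without circularity.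
    have pure {φ ψ : Formula.{u, w} S.relational s.ctx}
        (h : Provable (∅ : Theory.{u, w} S) φ.ofRelational ψ.ofRelational) : Provable U φ ψ :=
      hU.of_ofRelational (T := ∅) (fun s hs => hs.elim) h
    refine (pure (((∅ : Theory S).equiv_translate_ofRelational s.lhs).trans (eφ _).symm).1).cut
      (.cut ?_ (pure ((eψ _).trans ((∅ : Theory S).equiv_translate_ofRelational s.rhs).symm).1))
    refine .ax (T := U) ⟨s.ctx, φ, ψ⟩ ⟨⟨hφ, hψ⟩, provable_relational_iff.2 ?_⟩
    exact (eφ T).1.cut (((hT₀ _ _ _).1 (.ax s hs)).cut (eψ T).2)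
  refine ⟨U, fun Γ φ ψ => ⟨fun h => ?_, fun h => ?_⟩, fun s hs => hs.1⟩
  · exact provable_relational_iff.2
      (h.ofRelational fun s hs => provable_relational_iff.1 hs.2)
  · exact hU.of_ofRelational hU₀ ((hT₀ _ _ _).2 (provable_relational_iff.1 h))

end Theory

end GeometricLogic

theorem proposition3p3p18 (S : GeometricLogic.Signature.{u})
    (T : GeometricLogic.Theory.{u, w} S) :
    ∃ F : CategoryTheory.Functor (GeometricLogic.SynCat T) (GeometricLogic.SynCat T.relational),
      GeometricLogic.SynCat.IsTranslation F ∧ F.IsEquivalence ∧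
      (T.IsCoherent → T.relational.IsCoherent ∧
        ∃ G : CategoryTheory.Functor (GeometricLogic.SynSub T.coherent)
            (GeometricLogic.SynSub T.relational.coherent),
          G.comp (GeometricLogic.SynSub.ι T.relational.coherent) =
            (GeometricLogic.SynSub.ι T.coherent).comp F ∧ G.IsEquivalence) ∧
      (T.IsRegular → T.relational.IsRegular ∧
        ∃ G : CategoryTheory.Functor (GeometricLogic.SynSub T.regular)
            (GeometricLogic.SynSub T.relational.regular),
          G.comp (GeometricLogic.SynSub.ι T.relational.regular) =
            (GeometricLogic.SynSub.ι T.regular).comp F ∧ G.IsEquivalence) ∧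
      (T.IsCartesian → T.relational.IsCartesian ∧
        ∃ G : CategoryTheory.Functor (GeometricLogic.SynSub T.cartesian)
            (GeometricLogic.SynSub T.relational.cartesian),
          G.comp (GeometricLogic.SynSub.ι T.relational.cartesian) =
            (GeometricLogic.SynSub.ι T.cartesian).comp F ∧ G.IsEquivalence) :=
  ⟨GeometricLogic.SynCat.translateFunctor T,
    GeometricLogic.SynCat.translateFunctor_isTranslation T, inferInstance,
    fun h => ⟨h.relational, GeometricLogic.SynSub.exists_equivalence _ _
      GeometricLogic.Formula.IsCoherent.translate GeometricLogic.Formula.IsCoherent.ofRelational⟩,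
    fun h => ⟨h.relational, GeometricLogic.SynSub.exists_equivalence _ _
      GeometricLogic.Formula.IsRegular.translate GeometricLogic.Formula.IsRegular.ofRelational⟩,
    fun h => ⟨h.relational, GeometricLogic.SynSub.exists_equivalence _ _
      GeometricLogic.Theory.IsCartesianFormula.translate
      GeometricLogic.Theory.IsCartesianFormula.ofRelational⟩⟩
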